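/- For a connected smooth Riemannian $n$-manifold $(M,g)$, $n\ge 3$, let $R$, $W$ and $E=\mathrm{Ric}-\frac{R}{n}g$ denote the scalar curvature, the Weyl tensor and the traceless Ricci tensor, and let $$Q(M,g)=\inf_{0\ne u\in C_0^\infty(M)}\frac{\int_M |\nabla u|^2+\frac{n-2}{4(n-1)}R\,u^2\,dV_g}{\left(\int_M |u|^{2n/(n-2)}\,dV_g\right)^{(n-2)/n}}$$ be the Sobolev constant. The manifold has harmonic curvature if the divergence of its curvature tensor vanishes, $\nabla^iR_{ijkl}=0$, and it is Einstein if $\mathrm{Ric}=\lambda g$ for a constant $\lambda$. Theorem. For every integer $n\ge 4$ and every real $\Lambda>0$ there is a constant $c_0=c_0(n,\Lambda)>0$ with the following property. Let $(M,g)$ be a noncompact complete connected Riemannian $n$-manifold with harmonic curvature and $Q(M,g)\ge\Lambda$, and assume that one of the following holds: (A') the scalar curvature satisfies $R\ge 0$; (B') the scalar curvature satisfies $R<0$, and $n\ge 6$. If $\int_M |W|^{n/2}+|E|^{n/2}\,dV_g\le c_0$, then $(M,g)$ is Einstein. -/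

import Mathlib

open Set MeasureTheory Manifold Bundle
open scoped ENNReal ContDiff

namespace HarmonicCurvature

/-- The model space `ℝⁿ`. -/
abbrev Coord (n : ℕ) : Type := EuclideanSpace ℝ (Fin n)

noncomputable section

/-! ### Riemannian geometry in coordinates

Here `G : Coord n → Matrix (Fin n) (Fin n) ℝ` is the matrix `(g_ij)` of a metric in a chart. -/

section Local

variable {n : ℕ}

/-- The partial derivative `∂_i F` at `y`. -/
def pd (F : Coord n → ℝ) (i : Fin n) (y : Coord n) : ℝ :=
  fderiv ℝ F y (EuclideanSpace.single i (1 : ℝ))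

variable (G : Coord n → Matrix (Fin n) (Fin n) ℝ)

/-- Christoffel symbols `Γ^k_ij = ½ g^{kl} (∂_i g_jl + ∂_j g_il - ∂_l g_ij)` of the
Levi-Civita connection. -/
def christoffel (k i j : Fin n) (y : Coord n) : ℝ :=
  (1 / 2) * ∑ l, (G y)⁻¹ k l *
    (pd (fun z => G z j l) i y + pd (fun z => G z i l) j y - pd (fun z => G z i j) l y)

/-- The component along `∂_l` of
`R(∂_i, ∂_j) ∂_k = ∇_{∂_i} ∇_{∂_j} ∂_k - ∇_{∂_j} ∇_{∂_i} ∂_k`. -/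
def curvUp (l i j k : Fin n) (y : Coord n) : ℝ :=
  pd (christoffel G l j k) i y - pd (christoffel G l i k) j y
    + ∑ m, (christoffel G m j k y * christoffel G l i m y
      - christoffel G m i k y * christoffel G l j m y)

/-- The curvature tensor `R_ijkl = g(R(∂_i, ∂_j) ∂_l, ∂_k)`; in this convention a metric of constant
curvature `K` has `R_ijkl = K (g_ik g_jl - g_il g_jk)`. -/
def riem (i j k l : Fin n) (y : Coord n) : ℝ :=
  ∑ m, G y k m * curvUp G m i j l y

/-- The Ricci tensor `R_jl = g^{ik} R_ijkl`. -/
def ric (j l : Fin n) (y : Coord n) : ℝ :=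
  ∑ i, ∑ k, (G y)⁻¹ i k * riem G i j k l y

/-- The scalar curvature `R = g^{jl} R_jl`. -/
def scal (y : Coord n) : ℝ :=
  ∑ j, ∑ l, (G y)⁻¹ j l * ric G j l y

/-- The traceless Ricci tensor `E_ij = R_ij - (R / n) g_ij`. -/
def tracelessRic (i j : Fin n) (y : Coord n) : ℝ :=
  ric G i j y - scal G y / n * G y i j

/-- The Weyl tensor: the curvature tensor minus its traceless Ricci and scalar parts. -/
def weyl (i j k l : Fin n) (y : Coord n) : ℝ :=
  riem G i j k l y
    - (1 / ((n : ℝ) - 2)) *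
        (tracelessRic G i k y * G y j l + tracelessRic G j l y * G y i k
          - tracelessRic G i l y * G y j k - tracelessRic G j k y * G y i l)
    - scal G y / ((n : ℝ) * ((n : ℝ) - 1)) * (G y i k * G y j l - G y i l * G y j k)

/-- The covariant derivative `∇_p R_ijkl`. -/
def nablaRiem (p i j k l : Fin n) (y : Coord n) : ℝ :=
  pd (riem G i j k l) p y
    - ∑ a, (christoffel G a p i y * riem G a j k l y + christoffel G a p j y * riem G i a k l y
      + christoffel G a p k y * riem G i j a l y + christoffel G a p l y * riem G i j k a y)

/-- The divergence `∇^i R_ijkl` of the curvature tensor. -/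
def divRiem (j k l : Fin n) (y : Coord n) : ℝ :=
  ∑ p, ∑ i, (G y)⁻¹ p i * nablaRiem G p i j k l y

/-- The norm `|E| = (g^{ia} g^{jb} E_ij E_ab)^{1/2}`. -/
def normTracelessRic (y : Coord n) : ℝ :=
  √(∑ i, ∑ j, ∑ a, ∑ b, (G y)⁻¹ i a * (G y)⁻¹ j b * tracelessRic G i j y * tracelessRic G a b y)

/-- The norm `|W| = (g^{ia} g^{jb} g^{kc} g^{ld} W_ijkl W_abcd)^{1/2}`. -/
def normWeyl (y : Coord n) : ℝ :=
  √(∑ i, ∑ j, ∑ k, ∑ l, ∑ a, ∑ b, ∑ c, ∑ d,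
    (G y)⁻¹ i a * (G y)⁻¹ j b * (G y)⁻¹ k c * (G y)⁻¹ l d * weyl G i j k l y * weyl G a b c d y)

/-- `|∇F|² = g^{ij} ∂_i F ∂_j F`. -/
def gradSq (F : Coord n → ℝ) (y : Coord n) : ℝ :=
  ∑ i, ∑ j, (G y)⁻¹ i j * pd F i y * pd F j y

end Local

/-! ### Riemannian manifolds -/

section Global

variable {n : ℕ} {M : Type*} [TopologicalSpace M] [ChartedSpace (Coord n) M]
  [RiemannianBundle (fun x : M => TangentSpace (𝓡 n) x)]

/-- The matrix `g_ij(y) = g(∂_i, ∂_j)` of the Riemannian metric in the chart `e`, as a function on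
`e.target ⊆ ℝⁿ`; here `∂_i = d(e⁻¹)_y (e_i)`. -/
def metricInChart (e : OpenPartialHomeomorph M (Coord n)) (y : Coord n) :
    Matrix (Fin n) (Fin n) ℝ :=
  fun i j => inner ℝ
    (mfderiv (𝓡 n) (𝓡 n) e.symm y (EuclideanSpace.single i (1 : ℝ) : Coord n))
    (mfderiv (𝓡 n) (𝓡 n) e.symm y (EuclideanSpace.single j (1 : ℝ) : Coord n))

/-- Scalar curvature at `x` (computed in the preferred chart at `x`, as are the other
coordinate-invariant functions below). -/
def scalarCurvature (x : M) : ℝ :=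
  scal (metricInChart (chartAt (Coord n) x)) (chartAt (Coord n) x x)

/-- `|E|` at `x`. -/
def normE (x : M) : ℝ :=
  normTracelessRic (metricInChart (chartAt (Coord n) x)) (chartAt (Coord n) x x)

/-- `|W|` at `x`. -/
def normW (x : M) : ℝ :=
  normWeyl (metricInChart (chartAt (Coord n) x)) (chartAt (Coord n) x x)

/-- `|∇u|²` at `x`. -/
def normGradSq (u : M → ℝ) (x : M) : ℝ :=
  gradSq (metricInChart (chartAt (Coord n) x)) (u ∘ (chartAt (Coord n) x).symm)
    (chartAt (Coord n) x x)

variable (n M) in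
/-- Harmonic curvature: `∇^i R_ijkl = 0` in every chart of the atlas. -/
def HasHarmonicCurvature : Prop :=
  ∀ e ∈ atlas (Coord n) M, ∀ y ∈ e.target, ∀ j k l : Fin n, divRiem (metricInChart e) j k l y = 0

variable (n M) in
/-- Einstein: `Ric = c g` for some constant `c`. -/
def IsEinstein : Prop :=
  ∃ c : ℝ, ∀ e ∈ atlas (Coord n) M, ∀ y ∈ e.target, ∀ i j : Fin n,
    ric (metricInChart e) i j y = c * metricInChart e y i j

end Global

/-- A nonempty second countable manifold is covered by a sequence of charts. -/
theorem exists_seq_charts (n : ℕ) (M : Type*) [TopologicalSpace M] [ChartedSpace (Coord n) M]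
    [SecondCountableTopology M] [Nonempty M] :
    ∃ p : ℕ → M, ⋃ k, (chartAt (Coord n) (p k)).source = univ := by
  obtain ⟨s, hs, hU⟩ := TopologicalSpace.countable_cover_nhds
    (fun x : M => (chartAt (Coord n) x).open_source.mem_nhds (mem_chart_source (Coord n) x))
  have hne : s.Nonempty := by
    by_contra h
    rw [not_nonempty_iff_eq_empty] at h
    rw [h, biUnion_empty] at hU
    exact empty_ne_univ hU
  obtain ⟨p, rfl⟩ := hs.exists_eq_range hne
  exact ⟨p, by simpa using hU⟩

section Measure

variable (n : ℕ) (M : Type*) [TopologicalSpace M] [ChartedSpace (Coord n) M]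
  [RiemannianBundle (fun x : M => TangentSpace (𝓡 n) x)]
  [SecondCountableTopology M] [Nonempty M] [MeasurableSpace M]

/-- The centres of a sequence of charts that covers `M`. -/
def chartSeq : ℕ → M := (exists_seq_charts n M).choose

/-- The Riemannian volume `dV_g`, equal to `√(det g_ij) dy` in every chart. It is glued from the
disjoint pieces `source k \ ⋃ j < k, source j` of a sequence of charts that covers `M`; by the
change of variables formula it does not depend on the sequence. -/
def riemannianVolume : Measure M :=
  Measure.sum fun k : ℕ =>
    let e := chartAt (Coord n) (chartSeq n M k)
    ((volume.restrict (e.target ∩ e.symm ⁻¹'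
        disjointed (fun j => (chartAt (Coord n) (chartSeq n M j)).source) k)).withDensity
      (fun y => ENNReal.ofReal √(metricInChart e y).det)).map e.symm

/-- The Sobolev (Yamabe) constant: the infimum over all nonzero `u ∈ C_c^∞(M)` of
`∫ (|∇u|² + (n-2)/(4(n-1)) R u²) dV_g / (∫ |u|^{2n/(n-2)} dV_g)^{(n-2)/n}`, taken in the extended
reals so that it is `-∞` when the quotients are unbounded below. -/
def sobolevConstant : EReal :=
  ⨅ u : {u : M → ℝ // ContMDiff (𝓡 n) 𝓘(ℝ, ℝ) ∞ u ∧ HasCompactSupport u ∧ u ≠ 0},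
    (((∫ x, (normGradSq (n := n) u.1 x
          + ((n : ℝ) - 2) / (4 * ((n : ℝ) - 1)) * scalarCurvature (n := n) x * u.1 x ^ 2)
            ∂riemannianVolume n M)
      / (∫ x, |u.1 x| ^ (2 * (n : ℝ) / ((n : ℝ) - 2)) ∂riemannianVolume n M)
          ^ (((n : ℝ) - 2) / (n : ℝ)) : ℝ) : EReal)

end Measure

end

end HarmonicCurvature

/-!
Why small curvature forces the metric to be Einstein.

*Codazzi.* By the second Bianchi identity, harmonic curvature means that the Ricci tensor
satisfies the Codazzi equation (`IsLeviCivita.ricci_codazzi`). Hence the scalar curvature `R` is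
constant (`scalarCurvature_const`) and `E` is a trace-free Codazzi tensor. It remains to prove
`E = 0`, since then `Ric = (R / n) g` with `R` constant (`isEinstein_of_normE`).

*Bochner.* Commuting derivatives in `ΔE` turns the Codazzi equation into
`½ Δ|E|² = |∇E|² + (curvature) * E * E`, and the curvature term is bounded below by
`-(|W| + n / (n - 2) |E|) |E|² + R / (n - 1) |E|²`. Moreover trace-free Codazzi tensors satisfy
the refined Kato inequality `(n + 2) |∇|E|²|² ≤ 4 n |E|² |∇E|²` (`refined_kato`). Both facts are
combined in `IsLeviCivita.bochner`. An integration by parts in charts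
(`IsMetricOn.integral_parts`) and a partition of unity give the weak form `weak_bochner` on the
manifold.

*Energy estimate.* Let `f = |E|²`, `w = (f + ε) ^ (n / 8)`, and test with
`φ² (f + ε) ^ (n / 4 - 1)`. Up to terms which vanish with `ε`, the integral over `M` of
`a φ² |∇w|² + (8 / n) φ w ⟨∇φ, ∇w⟩ + R / (n - 1) φ² w²` is at most that of
`(|W| + n / (n - 2) |E|) φ² w²`, where `a = 8 (n² - 2 n + 4) / n³` (`test_integral`). To this one
adds `m` times the Sobolev inequality for `φ w`, whose coefficient of `R ∫ φ² w²` is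
`m (n - 2) / (4 (n - 1))`. If `m < a` and `(4 / (n - 2) - m) R ≥ 0`, the gradient terms and the
terms with `R` have the good sign, and Hölder's inequality bounds the right-hand side by half of
the Sobolev term, because the curvature is small in `L^(n/2)`. What is left is
`‖φ w‖²_{2n/(n-2)} ≤ C ∫ |∇φ|² w²` (`absorb`, `energy_estimate`), in which `ε` tends to `0`
(`energy_estimate_limit`).
For `R ≥ 0` every small `m` is admissible. For `R < 0` one takes `m = 4 / (n - 2)`, and `m < a`
holds exactly when `n (n - 4)² > 16`, that is, for `n ≥ 6`.

*Cutoffs.* Since `M` is complete and connected, it has cutoff functions `φ` which are `1` on a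
given compact set and have arbitrarily small gradient (`exists_cutoff`): closed balls are compact,
and a cutoff of the distance function can be smoothed. As `f ^ (n / 4) = |E| ^ (n / 2)` is
integrable, the right-hand side of the energy estimate becomes arbitrarily small, so `E = 0`
(`normE_eq_zero`).

The local calculus is done without indices, for a metric on an open subset of a vector space `V`
whose Christoffel symbols are a function `Γ : V → V →L[ℝ] V →L[ℝ] V` (`IsLeviCivita`); the tensors
given by components are identified with it in `IsMetricOn.riem_eq`, `IsMetricOn.ric_eq` and their
companions. Pointwise inequalities are proved for arrays of components in an orthonormal basis.
-/

namespace HarmonicCurvature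

-- needed to find instances on iterated spaces of continuous linear maps
set_option maxSynthPendingDepth 3
set_option linter.unusedSectionVars false

/-! ### The Levi-Civita connection on an open subset of a vector space -/

section Connection

variable {V : Type*} [NormedAddCommGroup V] [NormedSpace ℝ V]

/-- A Riemannian metric `g` on the open set `U` of a vector space, together with its Levi-Civita
connection `∇_u v = ∂_u v + Γ(u, v)`. Both are functions on the whole space; only their values on
`U` matter. -/
structure IsLeviCivita (U : Set V) (g : V → V →L[ℝ] V →L[ℝ] ℝ) (Γ : V → V →L[ℝ] V →L[ℝ] V) :
    Prop where
  isOpen : IsOpen U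
  contDiff_metric : ∀ y ∈ U, ContDiffAt ℝ ∞ g y
  contDiff_conn : ∀ y ∈ U, ContDiffAt ℝ ∞ Γ y
  symm : ∀ y ∈ U, ∀ u v, g y u v = g y v u
  pos : ∀ y ∈ U, ∀ v, v ≠ 0 → 0 < g y v v
  torsion : ∀ y ∈ U, ∀ u v, Γ y u v = Γ y v u
  compat : ∀ y ∈ U, ∀ w u v, fderiv ℝ g y w u v = g y (Γ y w u) v + g y u (Γ y w v)

/-- The covariant derivative `∇_a A = ∂_a A + [Γ(a, ·), A]` of a field of endomorphisms. -/
noncomputable def covEnd (Γ : V → V →L[ℝ] V →L[ℝ] V) (a : V) (A : V → V →L[ℝ] V) (y : V) :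
    V →L[ℝ] V :=
  fderiv ℝ A y a + (Γ y a * A y - A y * Γ y a)

/-- The curvature endomorphism `R(a, b) = [∇_a, ∇_b]` of constant vector fields `a` and `b`. -/
noncomputable def curvEnd (Γ : V → V →L[ℝ] V →L[ℝ] V) (a b : V) (y : V) : V →L[ℝ] V :=
  fderiv ℝ Γ y a b - fderiv ℝ Γ y b a + (Γ y a * Γ y b - Γ y b * Γ y a)

/-- The covariant derivative `(∇_p R)(a, b)` of the curvature tensor. -/
noncomputable def covCurv (Γ : V → V →L[ℝ] V →L[ℝ] V) (p a b : V) (y : V) : V →L[ℝ] V :=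
  covEnd Γ p (curvEnd Γ a b) y - curvEnd Γ (Γ y p a) b y - curvEnd Γ a (Γ y p b) y

/-- The second covariant derivative `∇²_{u,v} A` of a field of endomorphisms. -/
noncomputable def covEnd₂ (Γ : V → V →L[ℝ] V →L[ℝ] V) (u v : V) (A : V → V →L[ℝ] V) (y : V) :
    V →L[ℝ] V :=
  covEnd Γ u (covEnd Γ v A) y - covEnd Γ (Γ y u v) A y

variable {Γ : V → V →L[ℝ] V →L[ℝ] V} {A : V → V →L[ℝ] V} {y : V}

lemma fderiv_clm_apply_const {W : Type*} [NormedAddCommGroup W] [NormedSpace ℝ W]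
    {X : Type*} [NormedAddCommGroup X] [NormedSpace ℝ X] {c : V → X →L[ℝ] W}
    (hc : DifferentiableAt ℝ c y) (u : X) (a : V) :
    fderiv ℝ (fun z => c z u) y a = fderiv ℝ c y a u := by
  rw [fderiv_clm_apply hc (differentiableAt_const u)]
  simp

lemma fderiv_mul_apply {𝔸 : Type*} [NormedRing 𝔸] [NormedAlgebra ℝ 𝔸] {p q : V → 𝔸}
    (hp : DifferentiableAt ℝ p y) (hq : DifferentiableAt ℝ q y) (a : V) :
    fderiv ℝ (fun z => p z * q z) y a = p y * fderiv ℝ q y a + fderiv ℝ p y a * q y := by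
  rw [fderiv_fun_mul' hp hq]
  simp

lemma _root_.ContDiffAt.clm_apply_const {W : Type*} [NormedAddCommGroup W] [NormedSpace ℝ W]
    {X : Type*} [NormedAddCommGroup X] [NormedSpace ℝ X] {c : V → X →L[ℝ] W}
    (hc : ContDiffAt ℝ ∞ c y) (u : X) : ContDiffAt ℝ ∞ (fun z => c z u) y :=
  hc.clm_apply contDiffAt_const

lemma _root_.ContDiffAt.fderiv_infty {W : Type*} [NormedAddCommGroup W] [NormedSpace ℝ W]
    {c : V → W} (hc : ContDiffAt ℝ ∞ c y) : ContDiffAt ℝ ∞ (fderiv ℝ c) y :=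
  hc.fderiv_right (m := ∞) (by norm_cast)

lemma _root_.ContDiffAt.diff_infty {W : Type*} [NormedAddCommGroup W] [NormedSpace ℝ W]
    {c : V → W} (hc : ContDiffAt ℝ ∞ c y) : DifferentiableAt ℝ c y :=
  hc.differentiableAt (by simp)

lemma fderiv_fderiv_symm {W : Type*} [NormedAddCommGroup W] [NormedSpace ℝ W]
    {c : V → W} (hc : ContDiffAt ℝ ∞ c y) (u v : V) :
    fderiv ℝ (fderiv ℝ c) y u v = fderiv ℝ (fderiv ℝ c) y v u :=
  (hc.isSymmSndFDerivAt (by simp; exact WithTop.coe_le_coe.2 le_top)) u v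

lemma fderiv_congr_of_eqOn {W : Type*} [NormedAddCommGroup W] [NormedSpace ℝ W]
    {U : Set V} (hU : IsOpen U) {c d : V → W} (h : ∀ z ∈ U, c z = d z) (hy : y ∈ U) :
    fderiv ℝ c y = fderiv ℝ d y :=
  Filter.EventuallyEq.fderiv_eq (Filter.eventually_of_mem (hU.mem_nhds hy) h)

lemma contDiffAt_covEnd (hΓ : ContDiffAt ℝ ∞ Γ y) (hA : ContDiffAt ℝ ∞ A y) (a : V) :
    ContDiffAt ℝ ∞ (covEnd Γ a A) y :=
  (hA.fderiv_infty.clm_apply_const a).add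
    (((hΓ.clm_apply_const a).mul hA).sub (hA.mul (hΓ.clm_apply_const a)))

lemma contDiffAt_curvEnd (hΓ : ContDiffAt ℝ ∞ Γ y) (a b : V) :
    ContDiffAt ℝ ∞ (curvEnd Γ a b) y :=
  (((hΓ.fderiv_infty.clm_apply_const a).clm_apply_const b).sub
    ((hΓ.fderiv_infty.clm_apply_const b).clm_apply_const a)).add
    (((hΓ.clm_apply_const a).mul (hΓ.clm_apply_const b)).sub
      ((hΓ.clm_apply_const b).mul (hΓ.clm_apply_const a)))

lemma covEnd_add_dir (a b : V) : covEnd Γ (a + b) A y = covEnd Γ a A y + covEnd Γ b A y := by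
  simp only [covEnd, map_add]; noncomm_ring

lemma covEnd_smul_dir (r : ℝ) (a : V) : covEnd Γ (r • a) A y = r • covEnd Γ a A y := by
  simp only [covEnd, map_smul, smul_mul_assoc, mul_smul_comm, smul_add, smul_sub]

lemma curvEnd_add_left (a b c : V) :
    curvEnd Γ (a + b) c y = curvEnd Γ a c y + curvEnd Γ b c y := by
  simp only [curvEnd, map_add, add_apply]; noncomm_ring

lemma curvEnd_smul_left (r : ℝ) (a c : V) : curvEnd Γ (r • a) c y = r • curvEnd Γ a c y := by
  simp only [curvEnd, map_smul, smul_mul_assoc, mul_smul_comm, smul_add, smul_sub,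
    smul_apply]

lemma curvEnd_swap (a b : V) : curvEnd Γ b a y = -curvEnd Γ a b y := by
  simp only [curvEnd]; noncomm_ring

lemma curvEnd_add_right (a b c : V) :
    curvEnd Γ c (a + b) y = curvEnd Γ c a y + curvEnd Γ c b y := by
  rw [curvEnd_swap, curvEnd_add_left, curvEnd_swap c a, curvEnd_swap c b]; abel

lemma curvEnd_smul_right (r : ℝ) (a c : V) : curvEnd Γ c (r • a) y = r • curvEnd Γ c a y := by
  rw [curvEnd_swap, curvEnd_smul_left, curvEnd_swap c a, smul_neg, neg_neg]

lemma fderiv_covEnd (hΓ : ContDiffAt ℝ ∞ Γ y) (hA : ContDiffAt ℝ ∞ A y) (u v : V) :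
    fderiv ℝ (covEnd Γ v A) y u = fderiv ℝ (fderiv ℝ A) y u v
      + ((Γ y v * fderiv ℝ A y u + fderiv ℝ Γ y u v * A y)
        - (A y * fderiv ℝ Γ y u v + fderiv ℝ A y u * Γ y v)) := by
  have h1 := (hA.fderiv_infty.clm_apply_const v).diff_infty
  have h2 := (hΓ.clm_apply_const v).diff_infty
  have h3 := hA.diff_infty
  have e : covEnd Γ v A = fun z => fderiv ℝ A z v + (Γ z v * A z - A z * Γ z v) := rfl
  rw [e, fderiv_fun_add h1 ((h2.fun_mul h3).fun_sub (h3.fun_mul h2)),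
    fderiv_fun_sub (h2.fun_mul h3) (h3.fun_mul h2)]
  simp only [add_apply, sub_apply]
  rw [fderiv_clm_apply_const hA.fderiv_infty.diff_infty, fderiv_mul_apply h2 h3,
    fderiv_mul_apply h3 h2, fderiv_clm_apply_const hΓ.diff_infty]

/-- The Ricci identity for endomorphism fields. -/
lemma covEnd_comm (hΓ : ContDiffAt ℝ ∞ Γ y) (hA : ContDiffAt ℝ ∞ A y) (u v : V) :
    covEnd Γ u (covEnd Γ v A) y - covEnd Γ v (covEnd Γ u A) y
      = curvEnd Γ u v y * A y - A y * curvEnd Γ u v y := by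
  have hs := fderiv_fderiv_symm hA u v
  rw [covEnd.eq_def Γ u (covEnd Γ v A), covEnd.eq_def Γ v (covEnd Γ u A),
    fderiv_covEnd hΓ hA, fderiv_covEnd hΓ hA, hs]
  simp only [covEnd, curvEnd]
  noncomm_ring

lemma fderiv_curvEnd (hΓ : ContDiffAt ℝ ∞ Γ y) (p a b : V) :
    fderiv ℝ (curvEnd Γ a b) y p = fderiv ℝ (fderiv ℝ Γ) y p a b - fderiv ℝ (fderiv ℝ Γ) y p b a
      + ((Γ y a * fderiv ℝ Γ y p b + fderiv ℝ Γ y p a * Γ y b)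
        - (Γ y b * fderiv ℝ Γ y p a + fderiv ℝ Γ y p b * Γ y a)) := by
  have d := hΓ.fderiv_infty
  have h1 := ((d.clm_apply_const a).clm_apply_const b).diff_infty
  have h2 := ((d.clm_apply_const b).clm_apply_const a).diff_infty
  have h3 := (hΓ.clm_apply_const a).diff_infty
  have h4 := (hΓ.clm_apply_const b).diff_infty
  have e : curvEnd Γ a b = fun z => fderiv ℝ Γ z a b - fderiv ℝ Γ z b a
    + (Γ z a * Γ z b - Γ z b * Γ z a) := rfl
  rw [e, fderiv_fun_add (h1.fun_sub h2) ((h3.fun_mul h4).fun_sub (h4.fun_mul h3)),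
    fderiv_fun_sub h1 h2, fderiv_fun_sub (h3.fun_mul h4) (h4.fun_mul h3)]
  simp only [add_apply, sub_apply]
  rw [fderiv_mul_apply h3 h4, fderiv_mul_apply h4 h3,
    fderiv_clm_apply_const (d.clm_apply_const a).diff_infty,
    fderiv_clm_apply_const (d.clm_apply_const b).diff_infty, fderiv_clm_apply_const d.diff_infty,
    fderiv_clm_apply_const d.diff_infty, fderiv_clm_apply_const hΓ.diff_infty,
    fderiv_clm_apply_const hΓ.diff_infty]

/-- The second Bianchi identity for the covariant derivatives in the endomorphism slot only. The
connection terms in the slots `a` and `b` of `R(a, b)` cancel in the cyclic sum if `Γ` is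
symmetric. -/
lemma covEnd_curvEnd_cyclic (hΓ : ContDiffAt ℝ ∞ Γ y) (a b c : V) :
    covEnd Γ a (curvEnd Γ b c) y + covEnd Γ b (curvEnd Γ c a) y
      + covEnd Γ c (curvEnd Γ a b) y = 0 := by
  have h1 := fderiv_fderiv_symm hΓ b a
  have h2 := fderiv_fderiv_symm hΓ c a
  have h3 := fderiv_fderiv_symm hΓ c b
  simp only [covEnd, fderiv_curvEnd hΓ, h1, h2, h3]
  simp only [curvEnd]
  noncomm_ring

end Connection

namespace IsLeviCivita

variable {V : Type*} [NormedAddCommGroup V] [NormedSpace ℝ V]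
variable {U : Set V} {g : V → V →L[ℝ] V →L[ℝ] ℝ} {Γ : V → V →L[ℝ] V →L[ℝ] V}
  {A : V → V →L[ℝ] V} {y : V}

/-- The second Bianchi identity. -/
lemma bianchi₂ (h : IsLeviCivita U g Γ) (hy : y ∈ U) (a b c : V) :
    covCurv Γ a b c y + covCurv Γ b c a y + covCurv Γ c a b y = 0 := by
  have h0 := covEnd_curvEnd_cyclic (h.contDiff_conn y hy) a b c
  have e : covCurv Γ a b c y + covCurv Γ b c a y + covCurv Γ c a b y =
      (covEnd Γ a (curvEnd Γ b c) y + covEnd Γ b (curvEnd Γ c a) y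
      + covEnd Γ c (curvEnd Γ a b) y) := by
    simp only [covCurv]
    rw [h.torsion y hy b a, h.torsion y hy c a, h.torsion y hy c b,
      curvEnd_swap (Γ y a c) b, curvEnd_swap (Γ y a b) c, curvEnd_swap (Γ y b c) a]
    abel
  rw [e, h0]

lemma fderiv_torsion (h : IsLeviCivita U g Γ) (hy : y ∈ U) (a u v : V) :
    fderiv ℝ Γ y a u v = fderiv ℝ Γ y a v u := by
  have hΓ := h.contDiff_conn y hy
  have h1 := fderiv_congr_of_eqOn h.isOpen (fun z hz => h.torsion z hz u v) hy
  have h2 := congrArg (fun F => F a) h1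
  rwa [fderiv_clm_apply_const (hΓ.clm_apply_const u).diff_infty,
    fderiv_clm_apply_const (hΓ.clm_apply_const v).diff_infty,
    fderiv_clm_apply_const hΓ.diff_infty, fderiv_clm_apply_const hΓ.diff_infty] at h2

/-- The first Bianchi identity. -/
lemma bianchi₁ (h : IsLeviCivita U g Γ) (hy : y ∈ U) (a b c : V) :
    curvEnd Γ a b y c + curvEnd Γ b c y a + curvEnd Γ c a y b = 0 := by
  simp only [curvEnd, add_apply, sub_apply,
    mul_apply_eq_comp]
  rw [h.fderiv_torsion hy a c b, h.fderiv_torsion hy b c a, h.fderiv_torsion hy c b a,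
    h.torsion y hy c b, h.torsion y hy c a, h.torsion y hy b a]
  abel

/-- Metric compatibility `∂_a g(X, Z) = g(∇_a X, Z) + g(X, ∇_a Z)` for vector fields `X` and `Z`. -/
lemma fderiv_metric_apply (h : IsLeviCivita U g Γ) (hy : y ∈ U) {X Z : V → V}
    (hX : DifferentiableAt ℝ X y) (hZ : DifferentiableAt ℝ Z y) (a : V) :
    fderiv ℝ (fun z => g z (X z) (Z z)) y a
      = g y (fderiv ℝ X y a + Γ y a (X y)) (Z y) + g y (X y) (fderiv ℝ Z y a + Γ y a (Z y)) := by
  have hg := (h.contDiff_metric y hy).diff_infty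
  rw [fderiv_clm_apply (hg.clm_apply hX) hZ]
  simp only [add_apply, ContinuousLinearMap.comp_apply,
    ContinuousLinearMap.flip_apply]
  rw [fderiv_clm_apply hg hX]
  simp only [add_apply, ContinuousLinearMap.comp_apply,
    ContinuousLinearMap.flip_apply, h.compat y hy, map_add]
  ring

/-- The curvature endomorphisms are skew: antisymmetrise the second derivatives of
`g(u, v)` for constant `u` and `v`. -/
lemma curv_skew (h : IsLeviCivita U g Γ) (hy : y ∈ U) (a b u v : V) :
    g y (curvEnd Γ a b y u) v = - g y (curvEnd Γ a b y v) u := by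
  have hg := h.contDiff_metric y hy
  have hΓ := h.contDiff_conn y hy
  have key : ∀ a b : V, fderiv ℝ (fderiv ℝ g) y a b u v =
      g y (fderiv ℝ Γ y a b u + Γ y a (Γ y b u)) v + g y (Γ y b u) (Γ y a v)
      + (g y (Γ y a u) (Γ y b v) + g y u (fderiv ℝ Γ y a b v + Γ y a (Γ y b v))) := by
    intro a b
    have h1 := fderiv_congr_of_eqOn h.isOpen (fun z hz => h.compat z hz b u v) hy
    have h2 := congrArg (fun F => F a) h1
    have d := hg.fderiv_infty
    rw [fderiv_clm_apply_const ((d.clm_apply_const b).clm_apply_const u).diff_infty,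
      fderiv_clm_apply_const (d.clm_apply_const b).diff_infty,
      fderiv_clm_apply_const d.diff_infty] at h2
    have c1 := ((hΓ.clm_apply_const b).clm_apply_const u).diff_infty
    have c2 := ((hΓ.clm_apply_const b).clm_apply_const v).diff_infty
    rw [h2, fderiv_fun_add]
    · rw [add_apply, h.fderiv_metric_apply hy c1 (differentiableAt_const v),
        h.fderiv_metric_apply hy (differentiableAt_const u) c2,
        fderiv_clm_apply_const (hΓ.clm_apply_const b).diff_infty,
        fderiv_clm_apply_const (hΓ.clm_apply_const b).diff_infty,
        fderiv_clm_apply_const hΓ.diff_infty]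
      simp
    · exact ((hg.clm_apply ((hΓ.clm_apply_const b).clm_apply_const u)).clm_apply_const v).diff_infty
    · exact ((hg.clm_apply_const u).clm_apply
        ((hΓ.clm_apply_const b).clm_apply_const v)).diff_infty
  have hs := congrArg (fun F => F u v) (fderiv_fderiv_symm hg a b)
  rw [key a b, key b a] at hs
  rw [h.symm y hy (curvEnd Γ a b y v) u]
  simp only [curvEnd, add_apply, sub_apply,
    mul_apply_eq_comp, map_add, map_sub] at hs ⊢
  linarith

/-- The pair symmetry `R_ijkl = R_klij`, the usual linear combination of first Bianchi identities.
-/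
lemma curv_pair (h : IsLeviCivita U g Γ) (hy : y ∈ U) (a b c d : V) :
    g y (curvEnd Γ a b y c) d = g y (curvEnd Γ c d y a) b := by
  have B : ∀ a b c d : V, g y (curvEnd Γ a b y c) d + g y (curvEnd Γ b c y a) d
      + g y (curvEnd Γ c a y b) d = 0 := by
    intro a b c d
    have := congrArg (fun v => g y v d) (h.bianchi₁ hy a b c)
    simpa using this
  have S : ∀ a b c d : V, g y (curvEnd Γ b a y c) d = - g y (curvEnd Γ a b y c) d := by
    intro a b c d
    rw [curvEnd_swap a b]; simp
  have K := fun a b c d => h.curv_skew hy a b c d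
  linarith [B a b c d, B b c d a, B c d a b, B d a b c, S a b c d, S a b d c, S b c a d, S b c d a,
    S c a b d, S c a d b, S d a b c, S d a c b, S b d a c, S b d c a, S c d a b, S c d b a,
    K a b c d, K b c a d, K c a b d, K b c d a, K c d a b, K d a b c, K b d a c, K b d c a,
    K c d b a, K d b a c, K a c b d, K d a c b, K c a d b, K a d b c, K d b c a]

/-- `∇_a A` is self-adjoint if `A` is. -/
lemma covEnd_symm (h : IsLeviCivita U g Γ) (hA : ∀ z ∈ U, ContDiffAt ℝ ∞ A z)
    (hs : ∀ z ∈ U, ∀ u v, g z (A z u) v = g z u (A z v)) (hy : y ∈ U) (a u v : V) :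
    g y (covEnd Γ a A y u) v = g y u (covEnd Γ a A y v) := by
  have h1 := fderiv_congr_of_eqOn h.isOpen (fun z hz => hs z hz u v) hy
  have h2 := congrArg (fun F => F a) h1
  have hA' := hA y hy
  rw [h.fderiv_metric_apply hy (hA'.clm_apply_const u).diff_infty (differentiableAt_const v),
    h.fderiv_metric_apply hy (differentiableAt_const u) (hA'.clm_apply_const v).diff_infty,
    fderiv_clm_apply_const hA'.diff_infty, fderiv_clm_apply_const hA'.diff_infty] at h2
  simp only [covEnd, add_apply, sub_apply,
    mul_apply_eq_comp, map_add, map_sub, fderiv_fun_const, Pi.zero_apply,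
    zero_apply, zero_add] at h2 ⊢
  have e1 := hs y hy (Γ y a u) v
  have e2 := hs y hy u (Γ y a v)
  linarith

/-- The Codazzi equation passes to the second covariant derivative. -/
lemma covEnd₂_codazzi (h : IsLeviCivita U g Γ) (hA : ∀ z ∈ U, ContDiffAt ℝ ∞ A z)
    (hC : ∀ z ∈ U, ∀ v w, covEnd Γ v A z w = covEnd Γ w A z v) (hy : y ∈ U) (u v w : V) :
    covEnd₂ Γ u v A y w = covEnd₂ Γ u w A y v := by
  have h1 := fderiv_congr_of_eqOn h.isOpen (fun z hz => hC z hz v w) hy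
  have h2 := congrArg (fun F => F u) h1
  have hc := fun v => contDiffAt_covEnd (h.contDiff_conn y hy) (hA y hy) v
  rw [fderiv_clm_apply_const (hc v).diff_infty, fderiv_clm_apply_const (hc w).diff_infty] at h2
  simp only [covEnd₂]
  rw [covEnd.eq_def Γ u (covEnd Γ v A), covEnd.eq_def Γ u (covEnd Γ w A)]
  simp only [add_apply, sub_apply,
    mul_apply_eq_comp, h2]
  rw [hC y hy v w, hC y hy (Γ y u v) w, hC y hy (Γ y u w) v]
  abel

lemma covEnd₂_comm (h : IsLeviCivita U g Γ) (hA : ∀ z ∈ U, ContDiffAt ℝ ∞ A z) (hy : y ∈ U)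
    (u v : V) : covEnd₂ Γ u v A y - covEnd₂ Γ v u A y
      = curvEnd Γ u v y * A y - A y * curvEnd Γ u v y := by
  rw [← covEnd_comm (h.contDiff_conn y hy) (hA y hy), covEnd₂, covEnd₂, h.torsion y hy v u]
  abel

lemma covEnd₂_symm (h : IsLeviCivita U g Γ) (hA : ∀ z ∈ U, ContDiffAt ℝ ∞ A z)
    (hs : ∀ z ∈ U, ∀ u v, g z (A z u) v = g z u (A z v)) (hy : y ∈ U) (a b u v : V) :
    g y (covEnd₂ Γ a b A y u) v = g y u (covEnd₂ Γ a b A y v) := by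
  simp only [covEnd₂, sub_apply, map_sub]
  rw [h.covEnd_symm (A := covEnd Γ b A)
    (fun z hz => contDiffAt_covEnd (h.contDiff_conn z hz) (hA z hz) b)
    (fun z hz u v => h.covEnd_symm hA hs hz b u v) hy, h.covEnd_symm hA hs hy]

end IsLeviCivita

/-! ### Traces, the Ricci tensor and harmonic curvature -/

section Trace

variable {V : Type*} [NormedAddCommGroup V] [NormedSpace ℝ V] [FiniteDimensional ℝ V]
  {ι : Type*} [Fintype ι]

/-- The trace as a continuous linear form on endomorphisms. -/
noncomputable def traceL (V : Type*) [NormedAddCommGroup V] [NormedSpace ℝ V]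
    [FiniteDimensional ℝ V] : (V →L[ℝ] V) →L[ℝ] ℝ :=
  LinearMap.toContinuousLinearMap ((LinearMap.trace ℝ V).comp (ContinuousLinearMap.coeLM ℝ))

lemma traceL_apply (A : V →L[ℝ] V) : traceL V A = LinearMap.trace ℝ V A := rfl

lemma traceL_mul_comm (A B : V →L[ℝ] V) : traceL V (A * B) = traceL V (B * A) :=
  LinearMap.trace_mul_comm ℝ (A : V →ₗ[ℝ] V) (B : V →ₗ[ℝ] V)

lemma trace_eq_sum_coord (e : Module.Basis ι ℝ V) (F : V →ₗ[ℝ] V) :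
    LinearMap.trace ℝ V F = ∑ i, e.coord i (F (e i)) := by
  classical
  rw [LinearMap.trace_eq_matrix_trace ℝ e, Matrix.trace]
  simp [LinearMap.toMatrix_apply]

/-- `b` is an orthonormal basis for the bilinear form `B`. -/
def IsOrthoBasis (B : V →L[ℝ] V →L[ℝ] ℝ) (b : Module.Basis ι ℝ V) : Prop :=
  (∀ i, B (b i) (b i) = 1) ∧ ∀ i j, i ≠ j → B (b i) (b j) = 0

lemma IsOrthoBasis.apply [DecidableEq ι] {B : V →L[ℝ] V →L[ℝ] ℝ} {b : Module.Basis ι ℝ V}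
    (h : IsOrthoBasis B b) (i j : ι) : B (b i) (b j) = if i = j then 1 else 0 := by
  split_ifs with hij
  · rw [← hij, h.1]
  · exact h.2 i j hij

lemma IsOrthoBasis.coord {B : V →L[ℝ] V →L[ℝ] ℝ} {b : Module.Basis ι ℝ V}
    (h : IsOrthoBasis B b) (i : ι) (v : V) : b.coord i v = B v (b i) := by
  classical
  conv_rhs => rw [← b.sum_repr v]
  rw [map_sum, sum_apply]
  simp [h.apply]

lemma IsOrthoBasis.sum_eq {B : V →L[ℝ] V →L[ℝ] ℝ} {b : Module.Basis ι ℝ V}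
    (h : IsOrthoBasis B b) (v : V) : ∑ i, B v (b i) • b i = v := by
  conv_rhs => rw [← b.sum_repr v]
  exact Finset.sum_congr rfl fun i _ => by rw [← h.coord]; rfl

lemma IsOrthoBasis.trace {B : V →L[ℝ] V →L[ℝ] ℝ} {b : Module.Basis ι ℝ V}
    (h : IsOrthoBasis B b) (F : V →ₗ[ℝ] V) :
    LinearMap.trace ℝ V F = ∑ i, B (F (b i)) (b i) := by
  rw [trace_eq_sum_coord b]
  exact Finset.sum_congr rfl fun i _ => h.coord _ _

lemma IsOrthoBasis.ext {B : V →L[ℝ] V →L[ℝ] ℝ} {b : Module.Basis ι ℝ V}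
    (h : IsOrthoBasis B b) {v w : V} (hvw : ∀ u, B v u = B w u) : v = w := by
  rw [← h.sum_eq v, ← h.sum_eq w]
  exact Finset.sum_congr rfl fun i _ => by rw [hvw]

lemma IsOrthoBasis.sum_mul {B : V →L[ℝ] V →L[ℝ] ℝ} {b : Module.Basis ι ℝ V}
    (h : IsOrthoBasis B b) (v : V) (F : V →ₗ[ℝ] ℝ) : ∑ i, B v (b i) * F (b i) = F v := by
  conv_rhs => rw [← h.sum_eq v]
  simp [map_sum]

lemma exists_isOrthoBasis (e : Module.Basis ι ℝ V) (B : V →L[ℝ] V →L[ℝ] ℝ)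
    (hs : ∀ u v, B u v = B v u) (hp : ∀ v, v ≠ 0 → 0 < B v v) :
    ∃ b : Module.Basis ι ℝ V, IsOrthoBasis B b := by
  classical
  let B' : LinearMap.BilinForm ℝ V := LinearMap.mk₂ ℝ (fun u v => B u v) (by simp) (by simp)
    (by simp) (by simp)
  obtain ⟨v, hv⟩ := LinearMap.BilinForm.exists_orthogonal_basis (B := B') ⟨fun u v => by
    simpa [B'] using hs u v⟩
  have hc : Module.finrank ℝ V = Fintype.card ι := Module.finrank_eq_card_basis e
  let v' : Module.Basis ι ℝ V := v.reindex ((finCongr hc).trans (Fintype.equivFin ι).symm)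
  have hv' : ∀ i j, i ≠ j → B (v' i) (v' j) = 0 := by
    intro i j hij
    have := hv (i := (Fintype.equivFin ι i).cast hc.symm) (j := (Fintype.equivFin ι j).cast hc.symm)
      (by simpa using hij)
    simpa [B', v'] using this
  have hpos : ∀ i, 0 < B (v' i) (v' i) := fun i => hp _ (v'.ne_zero i)
  have hu : ∀ i, IsUnit ((√(B (v' i) (v' i)))⁻¹) := fun i =>
    (isUnit_iff_ne_zero.2 (inv_ne_zero (Real.sqrt_ne_zero'.2 (hpos i))))
  refine ⟨v'.isUnitSMul hu, fun i => ?_, fun i j hij => ?_⟩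
  · have h1 := Real.mul_self_sqrt (hpos i).le
    have h2 := (Real.sqrt_ne_zero'.2 (hpos i))
    simp only [Module.Basis.isUnitSMul_apply, map_smul, smul_apply, smul_eq_mul]
    field_simp
    rw [sq, h1]
  · simp [Module.Basis.isUnitSMul_apply, hv' i j hij]

end Trace

section Ricci

variable {V : Type*} [NormedAddCommGroup V] [NormedSpace ℝ V] [FiniteDimensional ℝ V]
  {ι : Type*} [Fintype ι]
  {U : Set V} {g : V → V →L[ℝ] V →L[ℝ] ℝ} {Γ : V → V →L[ℝ] V →L[ℝ] V}
  {A S : V → V →L[ℝ] V} {y : V}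

/-- The linear map `a ↦ R(a, u) v`. -/
noncomputable def curvSlot (Γ : V → V →L[ℝ] V →L[ℝ] V) (u v y : V) : V →ₗ[ℝ] V where
  toFun a := curvEnd Γ a u y v
  map_add' a b := by rw [curvEnd_add_left, add_apply]
  map_smul' r a := by rw [curvEnd_smul_left, smul_apply, RingHom.id_apply]

/-- The Ricci tensor, the trace of `a ↦ R(a, u) v`. -/
noncomputable def ricciForm (Γ : V → V →L[ℝ] V →L[ℝ] V) (u v y : V) : ℝ :=
  LinearMap.trace ℝ V (curvSlot Γ u v y)

/-- The covariant derivative `(∇_p Ric)(u, v)`. -/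
noncomputable def covRicci (Γ : V → V →L[ℝ] V →L[ℝ] V) (p u v y : V) : ℝ :=
  fderiv ℝ (ricciForm Γ u v) y p - ricciForm Γ (Γ y p u) v y - ricciForm Γ u (Γ y p v) y

lemma fderiv_sum_coord (e : Module.Basis ι ℝ V) {c : ι → V → V}
    (hc : ∀ i, DifferentiableAt ℝ (c i) y) (p : V) :
    fderiv ℝ (fun z => ∑ i, e.coord i (c i z)) y p = ∑ i, e.coord i (fderiv ℝ (c i) y p) := by
  have h : ∀ i, HasFDerivAt (fun z => e.coord i (c i z))
      ((LinearMap.toContinuousLinearMap (e.coord i)).comp (fderiv ℝ (c i) y)) y := fun i =>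
    (LinearMap.toContinuousLinearMap (e.coord i)).hasFDerivAt.comp y (hc i).hasFDerivAt
  rw [(HasFDerivAt.fun_sum fun i _ => h i).fderiv]
  simp

/-- `∇_p Ric` is the trace of `∇_p R`. -/
lemma covRicci_eq_sum (hΓ : ContDiffAt ℝ ∞ Γ y) (e : Module.Basis ι ℝ V) (p u v : V) :
    covRicci Γ p u v y = ∑ i, e.coord i (covCurv Γ p (e i) u y v) := by
  have h1 : ricciForm Γ u v = fun z => ∑ i, e.coord i (curvEnd Γ (e i) u z v) := by
    funext z; exact trace_eq_sum_coord e _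
  have hd := fun i => (contDiffAt_curvEnd hΓ (e i) u)
  have ht : ∑ i, e.coord i (Γ y p (curvEnd Γ (e i) u y v))
      = ∑ i, e.coord i (curvEnd Γ (Γ y p (e i)) u y v) := by
    have := LinearMap.trace_mul_comm ℝ (Γ y p : V →ₗ[ℝ] V) (curvSlot Γ u v y)
    rw [trace_eq_sum_coord e, trace_eq_sum_coord e] at this
    exact this
  rw [covRicci, h1, fderiv_sum_coord e fun i => ((hd i).clm_apply_const v).diff_infty]
  simp only [ricciForm, trace_eq_sum_coord e]
  simp only [fderiv_clm_apply_const (hd _).diff_infty, covCurv, covEnd, add_apply, sub_apply,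
    mul_apply_eq_comp, map_add, map_sub, Finset.sum_add_distrib, Finset.sum_sub_distrib, ht]
  simp only [curvSlot, LinearMap.coe_mk, AddHom.coe_mk]
  ring

namespace IsLeviCivita

lemma covCurv_apply (h : IsLeviCivita U g Γ) (hy : y ∈ U) (p a b c d : V) :
    g y (covCurv Γ p a b y c) d = fderiv ℝ (fun z => g z (curvEnd Γ a b z c) d) y p
      - (g y (curvEnd Γ (Γ y p a) b y c) d + g y (curvEnd Γ a (Γ y p b) y c) d
        + g y (curvEnd Γ a b y (Γ y p c)) d + g y (curvEnd Γ a b y c) (Γ y p d)) := by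
  have hd := contDiffAt_curvEnd (h.contDiff_conn y hy) a b
  rw [h.fderiv_metric_apply hy (hd.clm_apply_const c).diff_infty (differentiableAt_const d),
    fderiv_clm_apply_const hd.diff_infty]
  simp only [covCurv, covEnd, add_apply, sub_apply,
    mul_apply_eq_comp, map_add, map_sub, fderiv_fun_const, Pi.zero_apply,
    zero_apply, zero_add]
  ring

lemma covCurv_pair (h : IsLeviCivita U g Γ) (hy : y ∈ U) (p a b c d : V) :
    g y (covCurv Γ p a b y c) d = g y (covCurv Γ p c d y a) b := by
  rw [h.covCurv_apply hy, h.covCurv_apply hy,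
    fderiv_congr_of_eqOn h.isOpen (fun z hz => h.curv_pair hz a b c d) hy,
    h.curv_pair hy (Γ y p a) b, h.curv_pair hy a (Γ y p b), h.curv_pair hy a b (Γ y p c),
    h.curv_pair hy a b c (Γ y p d)]
  ring

lemma covCurv_swap (a b p : V) : covCurv Γ p b a y = - covCurv Γ p a b y := by
  have e : curvEnd Γ b a = fun z => - curvEnd Γ a b z := by funext z; exact curvEnd_swap a b
  have e2 : fderiv ℝ (fun z => - curvEnd Γ a b z) y = - fderiv ℝ (curvEnd Γ a b) y := fderiv_neg
  rw [covCurv, covCurv, covEnd, covEnd, e, e2, curvEnd_swap a, curvEnd_swap (Γ y p a)]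
  simp only [neg_apply, mul_neg, neg_mul]
  abel

lemma covCurv_skew (h : IsLeviCivita U g Γ) (hy : y ∈ U) (p a b c d : V) :
    g y (covCurv Γ p a b y c) d = - g y (covCurv Γ p a b y d) c := by
  rw [h.covCurv_pair hy, covCurv_swap, neg_apply, map_neg, neg_apply, h.covCurv_pair hy]

lemma ricci_symm (h : IsLeviCivita U g Γ) (hy : y ∈ U) (u v : V) :
    ricciForm Γ u v y = ricciForm Γ v u y := by
  obtain ⟨b, hb⟩ := exists_isOrthoBasis (Module.finBasis ℝ V) (g y) (h.symm y hy) (h.pos y hy)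
  rw [ricciForm, ricciForm, hb.trace, hb.trace]
  refine Finset.sum_congr rfl fun i _ => ?_
  change g y (curvEnd Γ (b i) u y v) (b i) = g y (curvEnd Γ (b i) v y u) (b i)
  rw [h.curv_pair hy, h.curv_skew hy, curvEnd_swap, neg_apply, map_neg, neg_apply, neg_neg]

/-- If the endomorphism field `S` represents the Ricci tensor, `∇S` represents `∇Ric`. -/
lemma covRicci_eq (h : IsLeviCivita U g Γ) (hS : ∀ z ∈ U, ContDiffAt ℝ ∞ S z)
    (hSr : ∀ z ∈ U, ∀ u v, g z (S z u) v = ricciForm Γ u v z) (hy : y ∈ U) (p u v : V) :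
    covRicci Γ p u v y = g y (covEnd Γ p S y u) v := by
  rw [covRicci, ← fderiv_congr_of_eqOn h.isOpen (fun z hz => hSr z hz u v) hy,
    h.fderiv_metric_apply hy ((hS y hy).clm_apply_const u).diff_infty (differentiableAt_const v),
    fderiv_clm_apply_const (hS y hy).diff_infty, ← hSr y hy, ← hSr y hy]
  simp only [covEnd, add_apply, sub_apply,
    mul_apply_eq_comp, map_add, map_sub, fderiv_fun_const, Pi.zero_apply,
    zero_apply, zero_add]
  ring

/-- The product rule `∂_u tr(P Q) = tr(∇_u P Q) + tr(P ∇_u Q)`; the commutators with `Γ` have trace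
zero. -/
lemma fderiv_trace_mul {P Q : V → V →L[ℝ] V}
    (hP : ContDiffAt ℝ ∞ P y) (hQ : ContDiffAt ℝ ∞ Q y) (u : V) :
    fderiv ℝ (fun z => traceL V (P z * Q z)) y u
      = traceL V (covEnd Γ u P y * Q y) + traceL V (P y * covEnd Γ u Q y) := by
  have h1 : HasFDerivAt (fun z => traceL V (P z * Q z))
      ((traceL V).comp (fderiv ℝ (fun z => P z * Q z) y)) y :=
    (traceL V).hasFDerivAt.comp y (hP.mul hQ).diff_infty.hasFDerivAt
  rw [h1.fderiv, ContinuousLinearMap.comp_apply, fderiv_mul_apply hP.diff_infty hQ.diff_infty]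
  have h2 := traceL_mul_comm (Γ y u) (P y * Q y)
  simp only [covEnd, mul_add, add_mul, mul_sub, sub_mul, map_add, map_sub, ← mul_assoc] at h2 ⊢
  linarith

lemma fderiv_trace (hS : ContDiffAt ℝ ∞ S y) (u : V) :
    fderiv ℝ (fun z => traceL V (S z)) y u = traceL V (covEnd Γ u S y) := by
  have h1 : HasFDerivAt (fun z => traceL V (S z)) ((traceL V).comp (fderiv ℝ S y)) y :=
    (traceL V).hasFDerivAt.comp y hS.diff_infty.hasFDerivAt
  rw [h1.fderiv, ContinuousLinearMap.comp_apply]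
  have h2 := traceL_mul_comm (Γ y u) (S y)
  simp only [covEnd, map_add, map_sub]
  linarith

/-- The divergence of the curvature tensor vanishes on `U`, expressed in orthonormal bases (indexed
by `ι`). -/
def DivFree (ι : Type*) [Fintype ι] (U : Set V) (g : V → V →L[ℝ] V →L[ℝ] ℝ)
    (Γ : V → V →L[ℝ] V →L[ℝ] V) : Prop :=
  ∀ y ∈ U, ∀ b : Module.Basis ι ℝ V, IsOrthoBasis (g y) b → ∀ u v w,
    ∑ i, g y (covCurv Γ (b i) (b i) u y w) v = 0

/-- Harmonic curvature makes the Ricci tensor a Codazzi tensor: contract the second Bianchi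
identity. -/
lemma ricci_codazzi (h : IsLeviCivita U g Γ) (e : Module.Basis ι ℝ V) (hdiv : DivFree ι U g Γ)
    (hS : ∀ z ∈ U, ContDiffAt ℝ ∞ S z)
    (hSr : ∀ z ∈ U, ∀ u v, g z (S z u) v = ricciForm Γ u v z) (hy : y ∈ U) (k l : V) :
    covEnd Γ k S y l = covEnd Γ l S y k := by
  obtain ⟨b, hb⟩ := exists_isOrthoBasis e (g y) (h.symm y hy) (h.pos y hy)
  have hΓ := h.contDiff_conn y hy
  refine hb.ext fun j => ?_
  rw [← h.covRicci_eq hS hSr hy, ← h.covRicci_eq hS hSr hy, covRicci_eq_sum hΓ b,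
    covRicci_eq_sum hΓ b, ← sub_eq_zero, ← Finset.sum_sub_distrib, ← hdiv y hy b hb j k l]
  refine Finset.sum_congr rfl fun i _ => ?_
  have h2 := congrArg (fun F => g y (F j) (b i)) (h.bianchi₂ hy (b i) k l)
  have h3 : g y (covCurv Γ (b i) (b i) j y l) k = g y (covCurv Γ (b i) k l y j) (b i) := by
    rw [h.covCurv_pair hy, h.covCurv_skew hy, covCurv_swap, neg_apply, map_neg, neg_apply, neg_neg]
  rw [hb.coord, hb.coord, h3, covCurv_swap l (b i) k, neg_apply, map_neg, neg_apply]
  simp only [add_apply, map_add, zero_apply, map_zero] at h2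
  linarith

/-- Harmonic curvature forces the scalar curvature to be locally constant: by the Codazzi equation
`∂_u R` is the divergence of `Ric`, which is a contraction of the divergence of the curvature. -/
lemma fderiv_trace_ricci (h : IsLeviCivita U g Γ) (e : Module.Basis ι ℝ V)
    (hdiv : DivFree ι U g Γ) (hS : ∀ z ∈ U, ContDiffAt ℝ ∞ S z)
    (hSr : ∀ z ∈ U, ∀ u v, g z (S z u) v = ricciForm Γ u v z) (hy : y ∈ U) (u : V) :
    fderiv ℝ (fun z => traceL V (S z)) y u = 0 := by
  obtain ⟨b, hb⟩ := exists_isOrthoBasis e (g y) (h.symm y hy) (h.pos y hy)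
  have hΓ := h.contDiff_conn y hy
  rw [fderiv_trace (Γ := Γ) (hS y hy), traceL_apply, hb.trace]
  calc ∑ i, g y (covEnd Γ u S y (b i)) (b i)
      = ∑ i, ∑ a, g y (covCurv Γ (b i) (b i) (b a) y (b a)) u := by
        refine Finset.sum_congr rfl fun i _ => ?_
        rw [h.ricci_codazzi e hdiv hS hSr hy, ← h.covRicci_eq hS hSr hy, covRicci_eq_sum hΓ b]
        refine Finset.sum_congr rfl fun a _ => ?_
        rw [hb.coord, h.covCurv_pair hy]
    _ = 0 := by
        rw [Finset.sum_comm]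
        exact Finset.sum_eq_zero fun a _ => hdiv y hy b hb (b a) u (b a)

/-! ### The Bochner formula for a Codazzi tensor -/

/-- The Hessian `∇²_{u,v} f = ∂_u ∂_v f - ∂_{Γ(u, v)} f` of a function. -/
noncomputable def _root_.HarmonicCurvature.hess (Γ : V → V →L[ℝ] V →L[ℝ] V) (f : V → ℝ)
    (u v y : V) : ℝ :=
  fderiv ℝ (fun z => fderiv ℝ f z v) y u - fderiv ℝ f y (Γ y u v)

lemma fderiv_normSq (hA : ContDiffAt ℝ ∞ A y) (u : V) :
    fderiv ℝ (fun z => traceL V (A z * A z)) y u = 2 * traceL V (A y * covEnd Γ u A y) := by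
  rw [fderiv_trace_mul (Γ := Γ) hA hA, traceL_mul_comm]; ring

lemma hess_normSq (h : IsLeviCivita U g Γ) (hA : ∀ z ∈ U, ContDiffAt ℝ ∞ A z) (hy : y ∈ U)
    (u v : V) : hess Γ (fun z => traceL V (A z * A z)) u v y
      = 2 * traceL V (covEnd Γ u A y * covEnd Γ v A y)
        + 2 * traceL V (A y * covEnd₂ Γ u v A y) := by
  have hΓ := h.contDiff_conn y hy
  rw [hess, fderiv_congr_of_eqOn h.isOpen (fun z hz =>
    fderiv_normSq (Γ := Γ) (hA z hz) v) hy, fderiv_normSq (Γ := Γ) (hA y hy)]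
  have hc := contDiffAt_covEnd hΓ (hA y hy) v
  have hd : DifferentiableAt ℝ (fun z => traceL V (A z * covEnd Γ v A z)) y :=
    (traceL V).differentiableAt.comp y ((hA y hy).mul hc).diff_infty
  rw [fderiv_const_mul hd, smul_apply, smul_eq_mul, fderiv_trace_mul (Γ := Γ) (hA y hy) hc]
  simp only [covEnd₂, mul_sub, map_sub]
  ring

/-- The rough Laplacian of a trace-free Codazzi tensor, paired with the tensor, is a curvature
term. By the Codazzi equation `∇_k ∇_k A_ij = ∇_k ∇_i A_kj`; commuting the derivatives leaves
`∇_i ∇_k A_kj`, which vanishes because a trace-free Codazzi tensor is divergence-free. -/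
lemma laplacian_codazzi (h : IsLeviCivita U g Γ)
    (hA : ∀ z ∈ U, ContDiffAt ℝ ∞ A z)
    (hs : ∀ z ∈ U, ∀ u v, g z (A z u) v = g z u (A z v))
    (hC : ∀ z ∈ U, ∀ v w, covEnd Γ v A z w = covEnd Γ w A z v)
    (htr : ∀ z ∈ U, traceL V (A z) = 0) (hy : y ∈ U)
    (b : Module.Basis ι ℝ V) (hb : IsOrthoBasis (g y) b) :
    ∑ k, traceL V (A y * covEnd₂ Γ (b k) (b k) A y)
      = ∑ k, ∑ i, g y ((curvEnd Γ (b k) (b i) y * A y - A y * curvEnd Γ (b k) (b i) y) (b k))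
        (A y (b i)) := by
  have hΓ := h.contDiff_conn y hy
  have htr1 : ∀ z ∈ U, ∀ v, traceL V (covEnd Γ v A z) = 0 := by
    intro z hz v
    rw [← fderiv_trace (hA z hz), fderiv_congr_of_eqOn h.isOpen htr hz]
    simp
  have htr2 : ∀ u v, traceL V (covEnd₂ Γ u v A y) = 0 := by
    intro u v
    rw [covEnd₂, map_sub, htr1 y hy, ← fderiv_trace (contDiffAt_covEnd hΓ (hA y hy) v),
      fderiv_congr_of_eqOn h.isOpen (fun z hz => htr1 z hz v) hy]
    simp
  -- the divergence `∇_k A_kj` is the derivative of the trace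
  have hdiv : ∀ w x, ∑ k, g y (covEnd₂ Γ w (b k) A y (b k)) x = 0 := by
    intro w x
    rw [← htr2 w x, traceL_apply, hb.trace]
    refine Finset.sum_congr rfl fun k _ => ?_
    rw [h.covEnd₂_symm hA hs hy, h.covEnd₂_codazzi hA hC hy, h.symm y hy]
    rfl
  have h1 : ∀ k, traceL V (A y * covEnd₂ Γ (b k) (b k) A y)
      = ∑ i, g y (covEnd₂ Γ (b k) (b i) A y (b k)) (A y (b i)) := by
    intro k
    rw [traceL_apply, hb.trace]
    refine Finset.sum_congr rfl fun i _ => ?_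
    rw [← h.covEnd₂_codazzi hA hC hy, ← hs y hy]
    rfl
  simp only [h1, ← h.covEnd₂_comm hA hy, sub_apply, map_sub]
  simp only [Finset.sum_sub_distrib]
  rw [eq_comm, sub_eq_self, Finset.sum_comm]
  exact Finset.sum_eq_zero fun i _ => hdiv (b i) _

end IsLeviCivita

end Ricci

/-! ### Tensor algebra in an orthonormal basis -/

section Algebra

variable {ι : Type*} [Fintype ι] [DecidableEq ι]

lemma cauchy_schwarz₂ (X Y : ι → ι → ℝ) :
    (∑ i, ∑ j, X i j * Y i j) ^ 2 ≤ (∑ i, ∑ j, X i j ^ 2) * ∑ i, ∑ j, Y i j ^ 2 := by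
  have := Finset.sum_mul_sq_le_sq_mul_sq (Finset.univ : Finset (ι × ι))
    (fun p => X p.1 p.2) (fun p => Y p.1 p.2)
  simpa only [Fintype.sum_prod_type] using this

lemma cauchy_schwarz₃ (X Y : ι → ι → ι → ℝ) :
    (∑ i, ∑ j, ∑ k, X i j k * Y i j k) ^ 2
      ≤ (∑ i, ∑ j, ∑ k, X i j k ^ 2) * ∑ i, ∑ j, ∑ k, Y i j k ^ 2 := by
  have := Finset.sum_mul_sq_le_sq_mul_sq (Finset.univ : Finset (ι × ι × ι))
    (fun p => X p.1 p.2.1 p.2.2) (fun p => Y p.1 p.2.1 p.2.2)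
  simpa only [Fintype.sum_prod_type] using this

lemma cauchy_schwarz₄ (X Y : ι → ι → ι → ι → ℝ) :
    (∑ i, ∑ j, ∑ k, ∑ l, X i j k l * Y i j k l) ^ 2
      ≤ (∑ i, ∑ j, ∑ k, ∑ l, X i j k l ^ 2) * ∑ i, ∑ j, ∑ k, ∑ l, Y i j k l ^ 2 := by
  have := Finset.sum_mul_sq_le_sq_mul_sq (Finset.univ : Finset (ι × ι × ι × ι))
    (fun p => X p.1 p.2.1 p.2.2.1 p.2.2.2) (fun p => Y p.1 p.2.1 p.2.2.1 p.2.2.2)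
  simpa only [Fintype.sum_prod_type] using this

/-- A trace-free symmetric matrix satisfies `|E v|² ≤ (n - 1) / n |E|² |v|²`: test `E` against the
trace-free symmetric part of `E v ⊗ v`. -/
lemma sq_apply_le_of_traceFree (E : ι → ι → ℝ) (hE : ∀ i j, E i j = E j i)
    (ht : ∑ i, E i i = 0) (v : ι → ℝ) (hn : 2 ≤ Fintype.card ι) :
    ∑ i, (∑ j, E i j * v j) ^ 2 ≤ ((Fintype.card ι : ℝ) - 1) / Fintype.card ι *
      ((∑ i, ∑ j, E i j ^ 2) * ∑ i, v i ^ 2) := by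
  set n : ℝ := (Fintype.card ι : ℝ) with hn'
  have hn2 : (2 : ℝ) ≤ n := by rw [hn']; exact_mod_cast hn
  set y : ι → ℝ := fun i => ∑ j, E i j * v j with hy
  -- the trace-free symmetric part of `y ⊗ v`; pairing with it agrees with pairing with `y ⊗ v` on
  -- trace-free symmetric matrices
  set F : ι → ι → ℝ := fun i j => (1 / 2) * (y i * v j + y j * v i)
    - (1 / n) * (∑ k, y k * v k) * (if i = j then 1 else 0) with hF
  have key : ∀ X : ι → ι → ℝ, (∀ i j, X i j = X j i) → ∑ i, X i i = 0 →
      ∑ i, ∑ j, X i j * F i j = ∑ i, ∑ j, X i j * (y i * v j) := by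
    intro X hX hXt
    have h1 : ∑ i, ∑ j, X i j * (y j * v i) = ∑ i, ∑ j, X i j * (y i * v j) := by
      rw [Finset.sum_comm]
      exact Finset.sum_congr rfl fun i _ => Finset.sum_congr rfl fun j _ => by rw [hX]
    have h2 : ∑ i, ∑ j, X i j * ((1 / n) * (∑ k, y k * v k) * (if i = j then 1 else 0)) = 0 := by
      simp only [mul_ite, mul_one, mul_zero, Finset.sum_ite_eq, Finset.mem_univ, if_true]
      rw [← Finset.sum_mul, hXt, zero_mul]
    have h3 : ∀ i j, X i j * F i j = (1 / 2) * (X i j * (y i * v j)) + (1 / 2) *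
        (X i j * (y j * v i)) - X i j * ((1 / n) * (∑ k, y k * v k) *
          (if i = j then 1 else 0)) := by intro i j; simp only [hF]; ring
    simp only [h3, Finset.sum_add_distrib, Finset.sum_sub_distrib, ← Finset.mul_sum, h1]
    linarith
  have hFs : ∀ i j, F i j = F j i := by
    intro i j; simp only [hF, eq_comm (a := i)]; ring
  have hFt : ∑ i, F i i = 0 := by
    simp only [hF, if_true, Finset.sum_sub_distrib, ← Finset.mul_sum, Finset.sum_const,
      Finset.card_univ, nsmul_eq_mul, ← hn']
    have : ∑ i, (y i * v i + y i * v i) = 2 * ∑ i, y i * v i := by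
      rw [Finset.sum_add_distrib]; ring
    rw [this]; field_simp; ring
  have hEF : ∑ i, ∑ j, E i j * F i j = ∑ i, y i ^ 2 := by
    rw [key E hE ht]
    refine Finset.sum_congr rfl fun i _ => ?_
    rw [sq, hy]; simp only [Finset.mul_sum, Finset.sum_mul]
    exact Finset.sum_congr rfl fun j _ => Finset.sum_congr rfl fun k _ => by ring
  have hFF : ∑ i, ∑ j, F i j ^ 2 = (1 / 2) * ((∑ i, y i ^ 2) * (∑ i, v i ^ 2))
      + (1 / 2 - 1 / n) * (∑ k, y k * v k) ^ 2 := by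
    have : ∑ i, ∑ j, F i j ^ 2 = ∑ i, ∑ j, F i j * (y i * v j) := by
      rw [← key F hFs hFt]; exact Finset.sum_congr rfl fun i _ => Finset.sum_congr rfl
        fun j _ => by ring
    rw [this]
    have h3 : ∀ i j, F i j * (y i * v j) = (1 / 2) * (y i ^ 2 * v j ^ 2) + (1 / 2) *
        ((y i * v i) * (y j * v j)) - (1 / n) * (∑ k, y k * v k) *
          (if i = j then y i * v j else 0) := by
      intro i j; simp only [hF]; split_ifs <;> ring
    simp only [h3, Finset.sum_add_distrib, Finset.sum_sub_distrib, ← Finset.mul_sum,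
      Finset.sum_ite_eq, Finset.mem_univ, if_true, ← Finset.sum_mul]
    ring
  have hcs := cauchy_schwarz₂ E F
  rw [hEF, hFF] at hcs
  have hyv : (∑ k, y k * v k) ^ 2 ≤ (∑ i, y i ^ 2) * ∑ i, v i ^ 2 :=
    Finset.sum_mul_sq_le_sq_mul_sq _ _ _
  have hy0 : 0 ≤ ∑ i, y i ^ 2 := Finset.sum_nonneg fun i _ => sq_nonneg _
  have hE0 : 0 ≤ ∑ i, ∑ j, E i j ^ 2 :=
    Finset.sum_nonneg fun i _ => Finset.sum_nonneg fun j _ => sq_nonneg _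
  have hv0 : 0 ≤ ∑ i, v i ^ 2 := Finset.sum_nonneg fun i _ => sq_nonneg _
  have hc : 0 ≤ 1 / 2 - 1 / n := by
    rw [sub_nonneg]; exact one_div_le_one_div_of_le two_pos hn2
  set Y := ∑ i, y i ^ 2
  set E2 := ∑ i, ∑ j, E i j ^ 2
  set V2 := ∑ i, v i ^ 2
  have h4 : Y ^ 2 ≤ Y * ((n - 1) / n * (E2 * V2)) := by
    have h5 : (n - 1) / n = 1 / 2 + (1 / 2 - 1 / n) := by field_simp; ring
    calc Y ^ 2 ≤ E2 * (1 / 2 * (Y * V2) + (1 / 2 - 1 / n) * (∑ k, y k * v k) ^ 2) := hcs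
      _ ≤ E2 * (1 / 2 * (Y * V2) + (1 / 2 - 1 / n) * (Y * V2)) := by gcongr
      _ = _ := by rw [h5]; ring
  rcases hy0.eq_or_lt with h0 | h0
  · rw [← h0]
    have : 0 ≤ (n - 1) / n := div_nonneg (by linarith) (by linarith)
    positivity
  · rw [sq] at h4
    exact le_of_mul_le_mul_left h4 h0

set_option maxHeartbeats 1000000 in
/-- The refined Kato inequality, in algebraic form: `T` plays the role of the covariant
derivative of the trace-free Codazzi tensor `E`. One tests `T` against the totally symmetric
trace-free part of `v ⊗ E`, where `v = ⟨T, E⟩`. -/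
lemma refined_kato (E : ι → ι → ℝ) (hE : ∀ i j, E i j = E j i)
    (ht : ∑ i, E i i = 0) (T : ι → ι → ι → ℝ) (hT1 : ∀ k i j, T k i j = T i k j)
    (hT2 : ∀ k i j, T k i j = T k j i) (hTt : ∀ k, ∑ i, T k i i = 0)
    (hn : 2 ≤ Fintype.card ι) :
    ((Fintype.card ι : ℝ) + 2) * ∑ k, (∑ i, ∑ j, E i j * T k i j) ^ 2 ≤ Fintype.card ι *
      ((∑ i, ∑ j, E i j ^ 2) * ∑ k, ∑ i, ∑ j, T k i j ^ 2) := by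
  set v : ι → ℝ := fun k => ∑ i, ∑ j, E i j * T k i j with hv
  have hy2 := sq_apply_le_of_traceFree E hE ht v hn
  set n : ℝ := (Fintype.card ι : ℝ) with hn'
  have hn2 : (2 : ℝ) ≤ n := by rw [hn']; exact_mod_cast hn
  set y : ι → ℝ := fun i => ∑ j, E i j * v j with hy
  -- the coefficient that makes `P` trace-free
  set c : ℝ := 2 / (3 * (n + 2)) with hc
  -- pairing with `P` agrees with pairing with `v ⊗ E` on totally symmetric trace-free arrays
  set P : ι → ι → ι → ℝ := fun k i j => (1 / 3) * (v k * E i j + v i * E k j + v j * E k i)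
    - c * ((if i = j then y k else 0) + (if k = i then y j else 0) + (if k = j then y i else 0))
    with hP
  have key : ∀ X : ι → ι → ι → ℝ, (∀ k i j, X k i j = X i k j) → (∀ k i j, X k i j = X k j i) →
      (∀ k, ∑ i, X k i i = 0) →
      ∑ k, ∑ i, ∑ j, X k i j * P k i j = ∑ k, ∑ i, ∑ j, X k i j * (v k * E i j) := by
    intro X hX1 hX2 hXt
    have h1 : ∑ k, ∑ i, ∑ j, X k i j * (v i * E k j) = ∑ k, ∑ i, ∑ j, X k i j * (v k * E i j) := by
      rw [Finset.sum_comm]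
      exact Finset.sum_congr rfl fun k _ => Finset.sum_congr rfl fun i _ =>
        Finset.sum_congr rfl fun j _ => by rw [hX1]
    have h2 : ∑ k, ∑ i, ∑ j, X k i j * (v j * E k i) = ∑ k, ∑ i, ∑ j, X k i j * (v k * E i j) := by
      have e1 : ∑ k, ∑ i, ∑ j, X k i j * (v j * E k i)
          = ∑ k, ∑ j, ∑ i, X k i j * (v j * E k i) :=
        Finset.sum_congr rfl fun k _ => Finset.sum_comm
      rw [e1, Finset.sum_comm]
      refine Finset.sum_congr rfl fun j _ => Finset.sum_congr rfl fun k _ =>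
        Finset.sum_congr rfl fun i _ => ?_
      rw [hX2 k i j, hX1 k j i]
    have h3 : ∑ k, ∑ i, ∑ j, X k i j * (if i = j then y k else 0) = 0 := by
      simp only [mul_ite, mul_zero, Finset.sum_ite_eq, Finset.mem_univ, if_true, ← Finset.sum_mul,
        hXt, zero_mul, Finset.sum_const_zero]
    have h4 : ∑ k, ∑ i, ∑ j, X k i j * (if k = i then y j else 0) = 0 := by
      have : ∀ k i, ∑ j, X k i j * (if k = i then y j else 0)
          = if k = i then ∑ j, X k k j * y j else 0 := by
        intro k i; split_ifs with h
        · rw [h]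
        · simp
      simp only [this, Finset.sum_ite_eq, Finset.mem_univ, if_true]
      rw [Finset.sum_comm]
      refine Finset.sum_eq_zero fun j _ => ?_
      rw [← Finset.sum_mul]
      have : ∑ k, X k k j = 0 := by
        rw [← hXt j]; exact Finset.sum_congr rfl fun k _ => by rw [hX2, hX1]
      rw [this, zero_mul]
    have h5 : ∑ k, ∑ i, ∑ j, X k i j * (if k = j then y i else 0) = 0 := by
      simp only [mul_ite, mul_zero, Finset.sum_ite_eq, Finset.mem_univ, if_true]
      rw [Finset.sum_comm]
      refine Finset.sum_eq_zero fun i _ => ?_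
      rw [← Finset.sum_mul]
      have : ∑ k, X k i k = 0 := by
        rw [← hXt i]; exact Finset.sum_congr rfl fun k _ => by rw [hX1]
      rw [this, zero_mul]
    have h6 : ∀ k i j, X k i j * P k i j = (1 / 3) * (X k i j * (v k * E i j))
        + (1 / 3) * (X k i j * (v i * E k j)) + (1 / 3) * (X k i j * (v j * E k i))
        - (c * (X k i j * (if i = j then y k else 0)) + c * (X k i j * (if k = i then y j else 0))
          + c * (X k i j * (if k = j then y i else 0))) := by
      intro k i j; simp only [hP]; ring
    simp only [h6, Finset.sum_add_distrib, Finset.sum_sub_distrib]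
    simp only [← Finset.mul_sum]
    rw [h1, h2, h3, h4, h5]; ring
  have hP1 : ∀ k i j, P k i j = P i k j := by
    intro k i j
    simp only [hP, eq_comm (a := k) (b := i), hE k i]
    ring
  have hP2 : ∀ k i j, P k i j = P k j i := by
    intro k i j
    simp only [hP, eq_comm (a := i) (b := j), hE i j]
    ring
  have hsw : ∀ k, ∑ i, v i * E k i = y k := fun k =>
    Finset.sum_congr rfl fun i _ => mul_comm _ _
  have hPt : ∀ k, ∑ i, P k i i = 0 := by
    intro k
    have h6 : ∀ i, P k i i = (1 / 3) * (v k * E i i) + (2 / 3) * (v i * E k i)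
      - (c * y k + 2 * c * (if k = i then y i else 0)) := by
      intro i; simp only [hP, if_true]; ring
    simp only [h6, Finset.sum_add_distrib, Finset.sum_sub_distrib, ← Finset.mul_sum,
      Finset.sum_ite_eq, Finset.mem_univ, if_true, ht, hsw, Finset.sum_const,
      Finset.card_univ, nsmul_eq_mul, ← hn', hc]
    field_simp; ring
  have hTP : ∑ k, ∑ i, ∑ j, T k i j * P k i j = ∑ k, v k ^ 2 := by
    rw [key T hT1 hT2 hTt]
    refine Finset.sum_congr rfl fun k _ => ?_
    rw [sq]
    conv_rhs => rw [hv]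
    simp only [Finset.sum_mul]
    refine Finset.sum_congr rfl fun i _ => Finset.sum_congr rfl fun j _ => ?_
    simp only [hv]; ring
  have hPP : ∑ k, ∑ i, ∑ j, P k i j ^ 2 = (1 / 3) * ((∑ k, v k ^ 2) * ∑ i, ∑ j, E i j ^ 2)
      + (2 / 3 - 2 * c) * ∑ k, y k ^ 2 := by
    have : ∑ k, ∑ i, ∑ j, P k i j ^ 2 = ∑ k, ∑ i, ∑ j, P k i j * (v k * E i j) := by
      rw [← key P hP1 hP2 hPt]
      exact Finset.sum_congr rfl fun i _ => Finset.sum_congr rfl fun j _ =>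
        Finset.sum_congr rfl fun j _ => by ring
    rw [this]
    have h6 : ∀ k i j, P k i j * (v k * E i j) = (1 / 3) * (v k ^ 2 * E i j ^ 2)
        + (1 / 3) * ((v k * E k j) * (v i * E i j)) + (1 / 3) * ((v k * E k i) * (v j * E i j))
        - (c * ((if i = j then y k * (v k * E i j) else 0))
          + c * (if k = i then (v k * E i j) * y j else 0)
          + c * ((if k = j then (v k * E i j) * y i else 0))) := by
      intro k i j; simp only [hP]; split_ifs <;> ring
    have h7 : ∑ k, ∑ i, ∑ j, v k ^ 2 * E i j ^ 2 = (∑ k, v k ^ 2) * ∑ i, ∑ j, E i j ^ 2 := by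
      simp only [← Finset.mul_sum, ← Finset.sum_mul]
    have hsw' : ∀ j, ∑ i, v i * E i j = y j := fun j => by
      rw [← hsw]; exact Finset.sum_congr rfl fun i _ => by rw [hE]
    have h8 : ∑ k, ∑ i, ∑ j, (v k * E k j) * (v i * E i j) = ∑ j, y j ^ 2 := by
      have : ∀ k, ∑ i, ∑ j, (v k * E k j) * (v i * E i j) = ∑ j, (v k * E k j) * y j := by
        intro k; rw [Finset.sum_comm]
        exact Finset.sum_congr rfl fun j _ => by rw [← Finset.mul_sum, hsw']
      simp only [this]
      rw [Finset.sum_comm]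
      exact Finset.sum_congr rfl fun j _ => by rw [← Finset.sum_mul, hsw', sq]
    have h9 : ∑ k, ∑ i, ∑ j, (v k * E k i) * (v j * E i j) = ∑ j, y j ^ 2 := by
      simp only [← Finset.mul_sum, hsw]
      rw [Finset.sum_comm]
      exact Finset.sum_congr rfl fun j _ => by rw [← Finset.sum_mul, hsw', sq]
    have h10 : ∑ k, ∑ i, ∑ j, (if i = j then y k * (v k * E i j) else 0) = 0 := by
      simp only [Finset.sum_ite_eq, Finset.mem_univ, if_true, ← Finset.mul_sum, ht, mul_zero,
        Finset.sum_const_zero]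
    have h11 : ∑ k, ∑ i, ∑ j, (if k = i then (v k * E i j) * y j else 0) = ∑ j, y j ^ 2 := by
      have : ∀ k i, ∑ j, (if k = i then (v k * E i j) * y j else 0)
          = if k = i then ∑ j, (v k * E k j) * y j else 0 := by
        intro k i; split_ifs with h
        · rw [h]
        · simp
      simp only [this, Finset.sum_ite_eq, Finset.mem_univ, if_true]
      rw [Finset.sum_comm]
      exact Finset.sum_congr rfl fun j _ => by rw [← Finset.sum_mul, hsw', sq]
    have h12 : ∑ k, ∑ i, ∑ j, (if k = j then (v k * E i j) * y i else 0) = ∑ j, y j ^ 2 := by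
      simp only [Finset.sum_ite_eq, Finset.mem_univ, if_true]
      rw [Finset.sum_comm]
      exact Finset.sum_congr rfl fun j _ => by rw [← Finset.sum_mul, hsw, sq]
    simp only [h6, Finset.sum_add_distrib, Finset.sum_sub_distrib]
    simp only [← Finset.mul_sum]
    simp only [Finset.mul_sum] at h7 h8 h9 h10 h11 h12 ⊢
    simp only [← Finset.mul_sum] at h7 h8 h9 h10 h11 h12 ⊢
    rw [h7, h8, h9, h10, h11, h12]; ring
  have hcs := cauchy_schwarz₃ T P
  rw [hTP, hPP] at hcs
  set V2 := ∑ k, v k ^ 2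
  set Y := ∑ i, y i ^ 2
  set E2 := ∑ i, ∑ j, E i j ^ 2
  set T2 := ∑ k, ∑ i, ∑ j, T k i j ^ 2
  have hV0 : 0 ≤ V2 := Finset.sum_nonneg fun i _ => sq_nonneg _
  have hE0 : 0 ≤ E2 := Finset.sum_nonneg fun i _ => Finset.sum_nonneg fun j _ => sq_nonneg _
  have hT0 : 0 ≤ T2 := Finset.sum_nonneg fun i _ => Finset.sum_nonneg fun j _ =>
    Finset.sum_nonneg fun k _ => sq_nonneg _
  have hcc : 2 / 3 - 2 * c = 2 * n / (3 * (n + 2)) := by rw [hc]; field_simp; ring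
  have h4 : V2 * ((n + 2) * V2) ≤ V2 * (n * (E2 * T2)) := by
    have h5 : V2 ^ 2 ≤ T2 * (1 / 3 * (V2 * E2) + 2 * n / (3 * (n + 2)) *
        ((n - 1) / n * (E2 * V2))) := by
      calc V2 ^ 2 ≤ T2 * (1 / 3 * (V2 * E2) + (2 / 3 - 2 * c) * Y) := hcs
        _ ≤ _ := by rw [hcc]; gcongr
    have h6 : T2 * (1 / 3 * (V2 * E2) + 2 * n / (3 * (n + 2)) * ((n - 1) / n * (E2 * V2)))
        = V2 * (n * (E2 * T2)) / (n + 2) := by field_simp; ring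
    rw [h6, le_div_iff₀ (by linarith)] at h5
    linarith
  rcases hV0.eq_or_lt with h0 | h0
  · rw [← h0]; simp only [mul_zero]; positivity
  · exact le_of_mul_le_mul_left h4 h0

/-- The curvature term of the Bochner formula, split into Weyl, traceless Ricci and scalar parts. -/
lemma bochner_term_eq (E : ι → ι → ℝ) (hE : ∀ i j, E i j = E j i) (ht : ∑ i, E i i = 0)
    (R W : ι → ι → ι → ι → ℝ) (s a c : ℝ)
    (hW : ∀ i j k l, R i j k l = W i j k l + a * (E i k * (if j = l then 1 else 0)
        + E j l * (if i = k then 1 else 0) - E i l * (if j = k then 1 else 0)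
        - E j k * (if i = l then 1 else 0)) + c * ((if i = k then 1 else 0) *
        (if j = l then 1 else 0) - (if i = l then 1 else 0) * (if j = k then 1 else 0))) :
    ∑ k, ∑ i, ∑ l, ∑ m, E l k * E m i * R k i m l
        + ∑ i, ∑ m, ∑ p, (E i m + s * (if i = m then 1 else 0)) * (E m p * E p i)
      = ∑ k, ∑ i, ∑ l, ∑ m, (E l k * E m i) * W k i m l
        + (1 + 2 * a) * (∑ i, ∑ m, ∑ p, E i m * (E m p * E p i))
        + (s + c) * ∑ i, ∑ j, E i j ^ 2 := by
  have e1 : ∑ i, ∑ m, ∑ p, (E i m + s * (if i = m then 1 else 0)) * (E m p * E p i)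
      = ∑ i, ∑ m, ∑ p, E i m * (E m p * E p i) + s * ∑ i, ∑ j, E i j ^ 2 := by
    have : ∀ i m, ∑ p, (E i m + s * (if i = m then 1 else 0)) * (E m p * E p i)
        = ∑ p, E i m * (E m p * E p i) + s * (if i = m then ∑ p, E i p ^ 2 else 0) := by
      intro i m
      split_ifs with h
      · subst h
        rw [Finset.mul_sum, ← Finset.sum_add_distrib]
        exact Finset.sum_congr rfl fun p _ => by rw [hE p i]; ring
      · simp
    simp only [this, Finset.sum_add_distrib]
    simp only [← Finset.mul_sum, Finset.sum_ite_eq, Finset.mem_univ, if_true]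
  have t1 : ∑ k, ∑ i, ∑ l, ∑ m, E l k * E m i * (E k m * (if i = l then 1 else 0))
      = ∑ i, ∑ m, ∑ p, E i m * (E m p * E p i) := by
    have : ∀ k i, ∑ l, ∑ m, E l k * E m i * (E k m * (if i = l then 1 else 0))
        = ∑ m, E k i * (E i m * E m k) := by
      intro k i
      rw [Finset.sum_comm]
      refine Finset.sum_congr rfl fun m _ => ?_
      simp only [mul_ite, mul_one, mul_zero, Finset.sum_ite_eq, Finset.mem_univ, if_true]
      rw [hE i k, hE m i, hE k m]; ring
    simp only [this]
  have t2 : ∑ k, ∑ i, ∑ l, ∑ m, E l k * E m i * (E i l * (if k = m then 1 else 0))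
      = ∑ i, ∑ m, ∑ p, E i m * (E m p * E p i) := by
    have : ∀ k i, ∑ l, ∑ m, E l k * E m i * (E i l * (if k = m then 1 else 0))
        = ∑ l, E k i * (E i l * E l k) := by
      intro k i
      refine Finset.sum_congr rfl fun l _ => ?_
      simp only [mul_ite, mul_one, mul_zero, Finset.sum_ite_eq, Finset.mem_univ, if_true]
      ring
    simp only [this]
  have t3 : ∑ k, ∑ i, ∑ l, ∑ m, E l k * E m i * (E k l * (if i = m then 1 else 0)) = 0 := by
    have : ∀ k i, ∑ l, ∑ m, E l k * E m i * (E k l * (if i = m then 1 else 0))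
        = E i i * ∑ l, E l k * E k l := by
      intro k i
      rw [Finset.mul_sum]
      refine Finset.sum_congr rfl fun l _ => ?_
      simp only [mul_ite, mul_one, mul_zero, Finset.sum_ite_eq, Finset.mem_univ, if_true]
      ring
    simp only [this, ← Finset.sum_mul, ht, zero_mul, Finset.sum_const_zero]
  have t4 : ∑ k, ∑ i, ∑ l, ∑ m, E l k * E m i * (E i m * (if k = l then 1 else 0)) = 0 := by
    have : ∀ k i, ∑ l, ∑ m, E l k * E m i * (E i m * (if k = l then 1 else 0))
        = E k k * ∑ m, E m i * E i m := by
      intro k i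
      rw [Finset.sum_comm, Finset.mul_sum]
      refine Finset.sum_congr rfl fun m _ => ?_
      simp only [mul_ite, mul_one, mul_zero, Finset.sum_ite_eq, Finset.mem_univ, if_true]
      ring
    simp only [this, ← Finset.mul_sum, ← Finset.sum_mul, ht, zero_mul]
  have t5 : ∑ k, ∑ i, ∑ l, ∑ m, E l k * E m i * ((if k = m then 1 else 0) *
      (if i = l then 1 else 0)) = ∑ i, ∑ j, E i j ^ 2 := by
    refine Finset.sum_congr rfl fun k _ => Finset.sum_congr rfl fun i _ => ?_
    have : ∀ l, ∑ m, E l k * E m i * ((if k = m then 1 else 0) * (if i = l then 1 else 0))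
        = if i = l then E l k * E k i else 0 := by
      intro l; split_ifs with h <;> simp
    simp only [this, Finset.sum_ite_eq, Finset.mem_univ, if_true]
    rw [hE i k]; ring
  have t6 : ∑ k, ∑ i, ∑ l, ∑ m, E l k * E m i * ((if k = l then 1 else 0) *
      (if i = m then 1 else 0)) = 0 := by
    have : ∀ k i, ∑ l, ∑ m, E l k * E m i * ((if k = l then 1 else 0) *
      (if i = m then 1 else 0)) = E k k * E i i := by
      intro k i
      have : ∀ l, ∑ m, E l k * E m i * ((if k = l then 1 else 0) * (if i = m then 1 else 0))
          = if k = l then E l k * E i i else 0 := by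
        intro l; split_ifs with h <;> simp
      simp only [this, Finset.sum_ite_eq, Finset.mem_univ, if_true]
    simp only [this, ← Finset.mul_sum, ht, mul_zero, Finset.sum_const_zero]
  have e2 : ∀ k i l m, E l k * E m i * R k i m l = E l k * E m i * W k i m l
      + a * (E l k * E m i * (E k m * (if i = l then 1 else 0)))
      + a * (E l k * E m i * (E i l * (if k = m then 1 else 0)))
      - a * (E l k * E m i * (E k l * (if i = m then 1 else 0)))
      - a * (E l k * E m i * (E i m * (if k = l then 1 else 0)))
      + c * (E l k * E m i * ((if k = m then 1 else 0) * (if i = l then 1 else 0)))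
      - c * (E l k * E m i * ((if k = l then 1 else 0) * (if i = m then 1 else 0))) := by
    intro k i l m; rw [hW]; ring
  rw [e1]
  simp only [e2, Finset.sum_add_distrib, Finset.sum_sub_distrib]
  simp only [← Finset.mul_sum _ _ a, ← Finset.mul_sum _ _ c]
  rw [t1, t2, t3, t4, t5, t6]; ring

lemma abs_weyl_term_le (E : ι → ι → ℝ) (W : ι → ι → ι → ι → ℝ) :
    |∑ k, ∑ i, ∑ l, ∑ m, (E l k * E m i) * W k i m l|
      ≤ √(∑ i, ∑ j, ∑ k, ∑ l, W i j k l ^ 2) * ∑ i, ∑ j, E i j ^ 2 := by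
  have h0 : 0 ≤ ∑ i, ∑ j, E i j ^ 2 :=
    Finset.sum_nonneg fun i _ => Finset.sum_nonneg fun j _ => sq_nonneg _
  have h1 := cauchy_schwarz₄ (fun k i m l => W k i m l) (fun k i m l => E l k * E m i)
  have h2 : ∑ k, ∑ i, ∑ l, ∑ m, (E l k * E m i) * W k i m l
      = ∑ k, ∑ i, ∑ m, ∑ l, W k i m l * (E l k * E m i) := by
    refine Finset.sum_congr rfl fun k _ => Finset.sum_congr rfl fun i _ => ?_
    rw [Finset.sum_comm]
    exact Finset.sum_congr rfl fun m _ => Finset.sum_congr rfl fun l _ => mul_comm _ _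
  have h3 : ∑ k, ∑ i, ∑ m, ∑ l, (E l k * E m i) ^ 2 = (∑ i, ∑ j, E i j ^ 2) ^ 2 := by
    have e : ∀ k, ∑ i, ∑ m, ∑ l, (E l k * E m i) ^ 2
        = (∑ l, E l k ^ 2) * (∑ m, ∑ i, E m i ^ 2) := by
      intro k
      rw [Finset.sum_comm, Finset.mul_sum]
      refine Finset.sum_congr rfl fun m _ => ?_
      rw [Finset.mul_sum]
      refine Finset.sum_congr rfl fun i _ => ?_
      rw [Finset.sum_mul]
      exact Finset.sum_congr rfl fun l _ => by ring
    simp only [e, ← Finset.sum_mul]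
    rw [Finset.sum_comm, sq]
  rw [← h2, h3] at h1
  refine abs_le_of_sq_le_sq ?_ (mul_nonneg (Real.sqrt_nonneg _) h0)
  rw [mul_pow, Real.sq_sqrt]
  · exact h1
  · exact Finset.sum_nonneg fun i _ => Finset.sum_nonneg fun j _ =>
      Finset.sum_nonneg fun k _ => Finset.sum_nonneg fun l _ => sq_nonneg _

lemma abs_cubic_term_le (E : ι → ι → ℝ) :
    |∑ i, ∑ m, ∑ p, E i m * (E m p * E p i)|
      ≤ √(∑ i, ∑ j, E i j ^ 2) * ∑ i, ∑ j, E i j ^ 2 := by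
  have h0 : 0 ≤ ∑ i, ∑ j, E i j ^ 2 :=
    Finset.sum_nonneg fun i _ => Finset.sum_nonneg fun j _ => sq_nonneg _
  have h1 := cauchy_schwarz₂ E (fun i m => ∑ p, E m p * E p i)
  have h2 : ∑ i, ∑ m, ∑ p, E i m * (E m p * E p i) = ∑ i, ∑ m, E i m * ∑ p, E m p * E p i := by
    simp only [Finset.mul_sum]
  have h3 : ∑ i, ∑ m, (∑ p, E m p * E p i) ^ 2 ≤ (∑ i, ∑ j, E i j ^ 2) ^ 2 := by
    calc ∑ i, ∑ m, (∑ p, E m p * E p i) ^ 2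
        ≤ ∑ i, ∑ m, (∑ p, E m p ^ 2) * (∑ p, E p i ^ 2) :=
          Finset.sum_le_sum fun i _ => Finset.sum_le_sum fun m _ =>
            Finset.sum_mul_sq_le_sq_mul_sq _ _ _
      _ = _ := by
          simp only [← Finset.sum_mul, ← Finset.mul_sum]
          rw [sq]
          congr 1
          rw [Finset.sum_comm]
  refine abs_le_of_sq_le_sq ?_ (mul_nonneg (Real.sqrt_nonneg _) h0)
  rw [mul_pow, Real.sq_sqrt h0, h2]
  exact h1.trans (mul_le_mul_of_nonneg_left h3 h0)

end Algebra

/-! ### The Bochner inequality for the traceless Ricci tensor -/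

section Bochner

variable {V : Type*} [NormedAddCommGroup V] [NormedSpace ℝ V] [FiniteDimensional ℝ V]
  {ι : Type*} [Fintype ι] [DecidableEq ι]
  {U : Set V} {g : V → V →L[ℝ] V →L[ℝ] ℝ} {Γ : V → V →L[ℝ] V →L[ℝ] V}
  {S : V → V →L[ℝ] V} {y : V}

/-- Parseval's identity. -/
lemma IsOrthoBasis.inner_eq_sum {B : V →L[ℝ] V →L[ℝ] ℝ} {b : Module.Basis ι ℝ V}
    (h : IsOrthoBasis B b) (hs : ∀ u v, B u v = B v u) (v w : V) :
    B v w = ∑ j, B v (b j) * B w (b j) := by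
  have := h.sum_mul v (B w : V →ₗ[ℝ] ℝ)
  rw [hs v w]
  exact this.symm

/-- The curvature tensor as a multilinear form `g(R(u, v) x, w)`, with the order of arguments of
`riem`: the pair `u, w` is the one contracted in the Ricci tensor. -/
noncomputable def curvComp (g : V → V →L[ℝ] V →L[ℝ] ℝ) (Γ : V → V →L[ℝ] V →L[ℝ] V) (y : V)
    (u v w x : V) : ℝ := g y (curvEnd Γ u v y x) w

/-- The traceless part `S - (tr S / n) Id` of an endomorphism field. -/
noncomputable def tracelessEnd (S : V → V →L[ℝ] V) (n : ℝ) (y : V) : V →L[ℝ] V :=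
  S y - (traceL V (S y) / n) • (1 : V →L[ℝ] V)

lemma traceL_one (e : Module.Basis ι ℝ V) : traceL V (1 : V →L[ℝ] V) = Fintype.card ι := by
  rw [← Module.finrank_eq_card_basis e]
  exact LinearMap.trace_one ℝ V

namespace IsLeviCivita

/-- The pointwise Bochner inequality for the traceless Ricci tensor of a metric of harmonic
curvature, together with the refined Kato inequality; `N` is `|∇E|²`. The endomorphism field `S`
is the Ricci tensor, and `E`, `W` are the components of the traceless Ricci tensor and the Weyl
tensor in the orthonormal basis `b`. -/
theorem bochner (h : IsLeviCivita U g Γ) (hdiv : DivFree ι U g Γ)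
    (hS : ∀ z ∈ U, ContDiffAt ℝ ∞ S z)
    (hSr : ∀ z ∈ U, ∀ u v, g z (S z u) v = ricciForm Γ u v z) (hy : y ∈ U)
    (b : Module.Basis ι ℝ V) (hb : IsOrthoBasis (g y) b) (n : ℝ) (hn : n = Fintype.card ι)
    (hn3 : 3 ≤ Fintype.card ι) (E : ι → ι → ℝ) (W : ι → ι → ι → ι → ℝ) (s : ℝ) (f : V → ℝ)
    (hE : ∀ i j, E i j = g y (tracelessEnd S n y (b i)) (b j))
    (hs : s = traceL V (S y))
    (hW : ∀ i j k l, W i j k l = curvComp g Γ y (b i) (b j) (b k) (b l)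
      - 1 / (n - 2) * (E i k * (if j = l then 1 else 0)
        + E j l * (if i = k then 1 else 0) - E i l * (if j = k then 1 else 0)
        - E j k * (if i = l then 1 else 0)) - s / (n * (n - 1)) * ((if i = k then 1 else 0) *
        (if j = l then 1 else 0) - (if i = l then 1 else 0) * (if j = k then 1 else 0)))
    (hf : ∀ z ∈ U, f z = traceL V (tracelessEnd S n z * tracelessEnd S n z)) :
    f y = ∑ i, ∑ j, E i j ^ 2 ∧ ∃ N : ℝ, 0 ≤ N ∧
      (n + 2) * ∑ k, fderiv ℝ f y (b k) ^ 2 ≤ 4 * n * (f y * N) ∧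
      N - (√(∑ i, ∑ j, ∑ k, ∑ l, W i j k l ^ 2) + n / (n - 2) * √(f y)) * f y
        + s / (n - 1) * f y ≤ 1 / 2 * ∑ k, hess Γ f (b k) (b k) y := by
  have hΓ := h.contDiff_conn y hy
  have hgs := h.symm y hy
  have hn3' : (3 : ℝ) ≤ n := by rw [hn]; exact_mod_cast hn3
  have hn0 : n ≠ 0 := by linarith
  set A := tracelessEnd S n with hAdef
  have hA : ∀ z ∈ U, ContDiffAt ℝ ∞ A z := fun z hz =>
    (hS z hz).sub ((((traceL V).contDiff.contDiffAt.comp z (hS z hz)).div_const n).smul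
      contDiffAt_const)
  have hSs : ∀ z ∈ U, ∀ u v, g z (S z u) v = g z u (S z v) := fun z hz u v => by
    rw [hSr z hz, h.ricci_symm hz, ← hSr z hz, h.symm z hz]
  have hAs : ∀ z ∈ U, ∀ u v, g z (A z u) v = g z u (A z v) := fun z hz u v => by
    simp only [hAdef, tracelessEnd, sub_apply, smul_apply, map_sub, map_smul,
      one_apply_eq_self, hSs z hz u v]
  -- the scalar curvature is constant, so `S` and its traceless part have the same derivative
  have hcov : ∀ z ∈ U, ∀ v, covEnd Γ v A z = covEnd Γ v S z := by
    intro z hz v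
    have h0 : DifferentiableAt ℝ (fun z => traceL V (S z)) z :=
      ((traceL V).contDiff.contDiffAt.comp z (hS z hz)).diff_infty
    have h1 : HasFDerivAt A (fderiv ℝ S z
        - ((1 / n) • fderiv ℝ (fun z => traceL V (S z)) z).smulRight (1 : V →L[ℝ] V)) z := by
      have e : A = S - fun y => (traceL V (S y) * (1 / n)) • (1 : V →L[ℝ] V) := by
        funext w
        simp [hAdef, tracelessEnd, div_eq_mul_inv]
      rw [e]
      exact (hS z hz).diff_infty.hasFDerivAt.sub
        (((h0.hasFDerivAt).mul_const (1 / n)).smul_const (1 : V →L[ℝ] V))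
    rw [covEnd, covEnd, h1.fderiv, sub_apply, ContinuousLinearMap.smulRight_apply,
      smul_apply, h.fderiv_trace_ricci b hdiv hS hSr hz]
    simp [hAdef, tracelessEnd, mul_sub, sub_mul]
  have hC : ∀ z ∈ U, ∀ v w, covEnd Γ v A z w = covEnd Γ w A z v := fun z hz v w => by
    rw [hcov z hz, hcov z hz, h.ricci_codazzi b hdiv hS hSr hz]
  have htr : ∀ z ∈ U, traceL V (A z) = 0 := fun z hz => by
    simp only [hAdef, tracelessEnd, map_sub, map_smul, traceL_one b, ← hn, smul_eq_mul]
    field_simp; ring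
  have hEs : ∀ i j, E i j = E j i := fun i j => by rw [hE, hE, hAs y hy, hgs]
  have hEt : ∑ i, E i i = 0 := by
    rw [← htr y hy, traceL_apply, hb.trace]
    exact Finset.sum_congr rfl fun i _ => hE i i
  have hnorm : f y = ∑ i, ∑ j, E i j ^ 2 := by
    rw [hf y hy, traceL_apply, hb.trace]
    refine Finset.sum_congr rfl fun i _ => ?_
    change g y (A y (A y (b i))) (b i) = _
    rw [hAs y hy, hb.inner_eq_sum hgs]
    exact Finset.sum_congr rfl fun j _ => by rw [hE, sq]
  refine ⟨hnorm, ?_⟩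
  set T : ι → ι → ι → ℝ := fun k i j => g y (covEnd Γ (b k) A y (b i)) (b j) with hT
  have hf' : fderiv ℝ f y = fderiv ℝ (fun z => traceL V (A z * A z)) y :=
    fderiv_congr_of_eqOn h.isOpen hf hy
  have hdf : ∀ k, fderiv ℝ f y (b k) = 2 * ∑ i, ∑ j, E i j * T k i j := by
    intro k
    rw [hf', fderiv_normSq (Γ := Γ) (hA y hy), traceL_apply, hb.trace]
    congr 1
    refine Finset.sum_congr rfl fun i _ => ?_
    change g y (A y (covEnd Γ (b k) A y (b i))) (b i) = _
    rw [hAs y hy, hb.inner_eq_sum hgs]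
    exact Finset.sum_congr rfl fun j _ => by rw [hE, mul_comm]
  have hT1 : ∀ k i j, T k i j = T i k j := fun k i j => by simp only [hT]; rw [hC y hy]
  have hT2 : ∀ k i j, T k i j = T k j i := fun k i j => by
    simp only [hT]; rw [h.covEnd_symm hA hAs hy, hgs]
  have hTt : ∀ k, ∑ i, T k i i = 0 := fun k => by
    have : traceL V (covEnd Γ (b k) A y) = 0 := by
      rw [← fderiv_trace (hA y hy), fderiv_congr_of_eqOn h.isOpen htr hy]; simp
    rw [← this, traceL_apply, hb.trace]
    rfl
  have hN : ∀ k, traceL V (covEnd Γ (b k) A y * covEnd Γ (b k) A y) = ∑ i, ∑ j, T k i j ^ 2 := by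
    intro k
    rw [traceL_apply, hb.trace]
    refine Finset.sum_congr rfl fun i _ => ?_
    change g y (covEnd Γ (b k) A y (covEnd Γ (b k) A y (b i))) (b i) = _
    rw [h.covEnd_symm hA hAs hy, hb.inner_eq_sum hgs]
    exact Finset.sum_congr rfl fun j _ => by rw [sq]
  refine ⟨∑ k, ∑ i, ∑ j, T k i j ^ 2, Finset.sum_nonneg fun k _ => Finset.sum_nonneg fun i _ =>
    Finset.sum_nonneg fun j _ => sq_nonneg _, ?_, ?_⟩
  · have := refined_kato E hEs hEt T hT1 hT2 hTt (by omega)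
    rw [← hn, ← hnorm] at this
    simp only [hdf, mul_pow, ← Finset.mul_sum]
    linarith
  · have hhess : ∀ k, hess Γ f (b k) (b k) y = 2 * (∑ i, ∑ j, T k i j ^ 2)
        + 2 * traceL V (A y * covEnd₂ Γ (b k) (b k) A y) := by
      intro k
      rw [← hN, ← h.hess_normSq hA hy, hess, hess, hf']
      congr 2
      exact fderiv_congr_of_eqOn h.isOpen (fun z hz => by
        rw [fderiv_congr_of_eqOn h.isOpen hf hz]) hy
    have hric : ∀ i m, g y (S y (b i)) (b m) = E i m + s / n * (if i = m then 1 else 0) := by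
      intro i m
      rw [hE]
      simp only [hAdef, tracelessEnd, sub_apply, smul_apply, map_sub, map_smul,
        one_apply_eq_self, hb.apply, smul_eq_mul, hs]
      ring
    have hlap : ∑ k, traceL V (A y * covEnd₂ Γ (b k) (b k) A y)
        = ∑ k, ∑ i, ∑ l, ∑ m, E l k * E m i * curvComp g Γ y (b k) (b i) (b m) (b l)
        + ∑ i, ∑ m, ∑ p, (E i m + s / n * (if i = m then 1 else 0)) * (E m p * E p i) := by
      rw [h.laplacian_codazzi hA hAs hC htr hy b hb]
      have e1 : ∀ k i, g y (curvEnd Γ (b k) (b i) y (A y (b k))) (A y (b i))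
          = ∑ l, ∑ m, E l k * E m i * curvComp g Γ y (b k) (b i) (b m) (b l) := by
        intro k i
        have hx : A y (b k) = ∑ l, E l k • b l := by
          rw [← hb.sum_eq (A y (b k))]
          exact Finset.sum_congr rfl fun l _ => by rw [← hE, hEs]
        have hx' : A y (b i) = ∑ m, E m i • b m := by
          rw [← hb.sum_eq (A y (b i))]
          exact Finset.sum_congr rfl fun l _ => by rw [← hE, hEs]
        rw [hx, hx']
        simp only [map_sum, map_smul, sum_apply, smul_apply, smul_eq_mul, Finset.mul_sum]
        rw [Finset.sum_comm]
        exact Finset.sum_congr rfl fun l _ => Finset.sum_congr rfl fun m _ => by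
          simp only [curvComp]; ring
      have e2 : ∑ k, ∑ i, g y (A y (curvEnd Γ (b k) (b i) y (b k))) (A y (b i))
          = - ∑ i, ∑ m, ∑ p, (E i m + s / n * (if i = m then 1 else 0)) * (E m p * E p i) := by
        rw [Finset.sum_comm, ← Finset.sum_neg_distrib]
        refine Finset.sum_congr rfl fun i _ => ?_
        have e3 : A y (A y (b i)) = ∑ m, (∑ p, E m p * E p i) • b m := by
          rw [← hb.sum_eq (A y (A y (b i)))]
          refine Finset.sum_congr rfl fun m _ => ?_
          rw [hAs y hy, hb.inner_eq_sum hgs]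
          congr 1
          exact Finset.sum_congr rfl fun p _ => by rw [← hE, ← hE, hEs i p]; ring
        have e4 : ∀ m, ∑ k, g y (curvEnd Γ (b k) (b i) y (b k)) (b m)
            = - (E i m + s / n * (if i = m then 1 else 0)) := by
          intro m
          rw [← hric, hSr y hy, ricciForm, hb.trace, ← Finset.sum_neg_distrib]
          exact Finset.sum_congr rfl fun k _ => h.curv_skew hy _ _ _ _
        have e5 : ∀ k, g y (A y (curvEnd Γ (b k) (b i) y (b k))) (A y (b i))
            = ∑ m, g y (curvEnd Γ (b k) (b i) y (b k)) (b m) * (∑ p, E m p * E p i) := by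
          intro k
          rw [hAs y hy, e3]
          simp only [map_sum, map_smul, smul_eq_mul]
          exact Finset.sum_congr rfl fun m _ => mul_comm _ _
        simp only [e5]
        rw [Finset.sum_comm, ← Finset.sum_neg_distrib]
        refine Finset.sum_congr rfl fun m _ => ?_
        rw [← Finset.sum_mul, e4, neg_mul, Finset.mul_sum]
      simp only [sub_apply, mul_apply_eq_comp, map_sub, Finset.sum_sub_distrib, e1]
      rw [e2, sub_neg_eq_add]
    have hsplit := bochner_term_eq E hEs hEt
      (fun i j k l => curvComp g Γ y (b i) (b j) (b k) (b l)) W (s / n) (1 / (n - 2))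
      (s / (n * (n - 1))) (fun i j k l => by rw [hW]; ring)
    rw [← hlap] at hsplit
    simp only [hhess, Finset.sum_add_distrib, ← Finset.mul_sum]
    rw [hsplit]
    have b1 := (abs_le.1 (abs_weyl_term_le E W)).1
    have b2 := (abs_le.1 (abs_cubic_term_le E)).1
    rw [← hnorm] at b1 b2 ⊢
    have c1 : 1 + 2 * (1 / (n - 2)) = n / (n - 2) := by
      have : n - 2 ≠ 0 := by linarith
      field_simp; ring
    have c2 : s / n + s / (n * (n - 1)) = s / (n - 1) := by
      have : n - 1 ≠ 0 := by linarith
      field_simp; ring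
    rw [c1, c2]
    have c3 : 0 ≤ n / (n - 2) := div_nonneg (by linarith) (by linarith)
    have b3 := mul_le_mul_of_nonneg_left b2 c3
    linarith

end IsLeviCivita

end Bochner

/-! ### Change of coordinates -/

section Transform

variable {V : Type*} [NormedAddCommGroup V] [NormedSpace ℝ V] [FiniteDimensional ℝ V]
  {ι : Type*} [Fintype ι]
  {U U' O : Set V} {g g' : V → V →L[ℝ] V →L[ℝ] ℝ} {Γ Γ' : V → V →L[ℝ] V →L[ℝ] V}
  {φ : V → V} {y : V}

/-- `φ` is a smooth local isometry from the metric `g` on `O` to the metric `g'` on `U'`. -/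
structure IsLocalIsom (O U' : Set V) (g g' : V → V →L[ℝ] V →L[ℝ] ℝ) (φ : V → V) : Prop where
  isOpen : IsOpen O
  contDiff : ∀ z ∈ O, ContDiffAt ℝ ∞ φ z
  maps : ∀ z ∈ O, φ z ∈ U'
  isom : ∀ z ∈ O, ∀ u v, g z u v = g' (φ z) (fderiv ℝ φ z u) (fderiv ℝ φ z v)

namespace IsLocalIsom

lemma surjective (hφ : IsLocalIsom O U' g g' φ) (hpos : ∀ y ∈ O, ∀ v, v ≠ 0 → 0 < g y v v)
    (hy : y ∈ O) : Function.Surjective (fderiv ℝ φ y) := by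
  have hinj : Function.Injective (fderiv ℝ φ y : V →ₗ[ℝ] V) := by
    rw [← LinearMap.ker_eq_bot, LinearMap.ker_eq_bot']
    intro v hv
    by_contra hne
    have h1 := hpos y hy v hne
    have h2 : fderiv ℝ φ y v = 0 := hv
    rw [hφ.isom y hy, h2] at h1
    simp at h1
  exact LinearMap.injective_iff_surjective.1 hinj

lemma fderiv_comp_apply {W : Type*} [NormedAddCommGroup W] [NormedSpace ℝ W]
    {c : V → W} (hc : DifferentiableAt ℝ c (φ y)) (hφ : DifferentiableAt ℝ φ y) (a : V) :
    fderiv ℝ (fun z => c (φ z)) y a = fderiv ℝ c (φ y) (fderiv ℝ φ y a) := by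
  have := fderiv_comp y hc hφ
  simp only [Function.comp_def] at this
  rw [this]; rfl

/-- The transformation law of the Christoffel symbols. The difference of the two sides, paired with
`dφ`, is symmetric in one pair of its three arguments and skew in another, hence zero. -/
lemma conn (hφ : IsLocalIsom O U' g g' φ) (h : IsLeviCivita U g Γ) (h' : IsLeviCivita U' g' Γ')
    (hOU : O ⊆ U) (hy : y ∈ O) (u v : V) :
    fderiv ℝ φ y (Γ y u v) = Γ' (φ y) (fderiv ℝ φ y u) (fderiv ℝ φ y v)
      + fderiv ℝ (fderiv ℝ φ) y u v := by
  have hyU := hOU hy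
  have hy' := hφ.maps y hy
  have hs := hφ.contDiff y hy
  have hg' := h'.contDiff_metric _ hy'
  set L := fderiv ℝ φ y with hL
  set H := fderiv ℝ (fderiv ℝ φ) y with hH
  have hHs : ∀ u v, H u v = H v u := fderiv_fderiv_symm hs
  have key : ∀ w u v, g' (φ y) (L (Γ y w u) - H w u - Γ' (φ y) (L w) (L u)) (L v)
      = - g' (φ y) (L (Γ y w v) - H w v - Γ' (φ y) (L w) (L v)) (L u) := by
    intro w u v
    have h1 := fderiv_congr_of_eqOn hφ.isOpen (fun z hz => hφ.isom z hz u v) hy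
    have h2 := congrArg (fun F => F w) h1
    have hg := h.contDiff_metric y hyU
    rw [fderiv_clm_apply_const (hg.clm_apply_const u).diff_infty,
      fderiv_clm_apply_const hg.diff_infty, h.compat y hyU, hφ.isom y hy, hφ.isom y hy] at h2
    have d1 : DifferentiableAt ℝ (fun z => g' (φ z)) y := hg'.diff_infty.comp y hs.diff_infty
    have d2 := (hs.fderiv_infty.clm_apply_const u).diff_infty
    have d3 := (hs.fderiv_infty.clm_apply_const v).diff_infty
    rw [fderiv_clm_apply (d1.clm_apply d2) d3] at h2
    simp only [add_apply, ContinuousLinearMap.comp_apply, ContinuousLinearMap.flip_apply] at h2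
    rw [fderiv_clm_apply d1 d2] at h2
    simp only [add_apply, ContinuousLinearMap.comp_apply, ContinuousLinearMap.flip_apply] at h2
    rw [fderiv_comp_apply hg'.diff_infty hs.diff_infty, h'.compat _ hy',
      fderiv_clm_apply_const hs.fderiv_infty.diff_infty,
      fderiv_clm_apply_const hs.fderiv_infty.diff_infty] at h2
    simp only [← hL, ← hH] at h2
    rw [h'.symm _ hy' (L (Γ y w v) - H w v - Γ' (φ y) (L w) (L v)) (L u)]
    simp only [map_sub, sub_apply]
    linarith
  have hsym : ∀ u v, L (Γ y u v) - H u v - Γ' (φ y) (L u) (L v)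
      = L (Γ y v u) - H v u - Γ' (φ y) (L v) (L u) := fun u v => by
    rw [h.torsion y hyU u v, hHs u v, h'.torsion _ hy' (L u)]
  have hz : ∀ w u v, g' (φ y) (L (Γ y w u) - H w u - Γ' (φ y) (L w) (L u)) (L v) = 0 := by
    intro w u v
    have k1 := key w u v
    have k2 := key v w u
    have k3 := key u v w
    rw [hsym w v] at k1
    rw [hsym v u] at k2
    rw [hsym u w] at k3
    linarith
  have hzero : L (Γ y u v) - H u v - Γ' (φ y) (L u) (L v) = 0 := by
    by_contra hne
    obtain ⟨x, hx⟩ := hφ.surjective (fun y hy => h.pos y (hOU hy)) hy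
      (L (Γ y u v) - H u v - Γ' (φ y) (L u) (L v))
    have h1 := h'.pos _ hy' _ hne
    have h2 := hz u v x
    rw [hx] at h2
    exact h1.ne' h2
  rw [sub_sub, sub_eq_zero] at hzero
  rw [hzero, add_comm]

/-- The curvature is a tensor: differentiate the transformation law of the Christoffel symbols. -/
lemma curv (hφ : IsLocalIsom O U' g g' φ) (h : IsLeviCivita U g Γ) (h' : IsLeviCivita U' g' Γ')
    (hOU : O ⊆ U) (hy : y ∈ O) (a b c : V) :
    fderiv ℝ φ y (curvEnd Γ a b y c)
      = curvEnd Γ' (fderiv ℝ φ y a) (fderiv ℝ φ y b) (φ y) (fderiv ℝ φ y c) := by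
  have hyU := hOU hy
  have hy' := hφ.maps y hy
  have hs := hφ.contDiff y hy
  have hΓ := h.contDiff_conn y hyU
  have hΓ' := h'.contDiff_conn _ hy'
  have key : ∀ a b, fderiv ℝ φ y (fderiv ℝ Γ y a b c) =
      fderiv ℝ Γ' (φ y) (fderiv ℝ φ y a) (fderiv ℝ φ y b) (fderiv ℝ φ y c)
      + Γ' (φ y) (fderiv ℝ (fderiv ℝ φ) y a b) (fderiv ℝ φ y c)
      + Γ' (φ y) (fderiv ℝ φ y b) (fderiv ℝ (fderiv ℝ φ) y a c)
      + fderiv ℝ (fderiv ℝ (fderiv ℝ φ)) y a b c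
      - fderiv ℝ (fderiv ℝ φ) y a (Γ y b c) := by
    intro a b
    have h1 := fderiv_congr_of_eqOn hφ.isOpen (fun z hz => hφ.conn h h' hOU hz b c) hy
    have h2 := congrArg (fun F => F a) h1
    have c0 := hs.fderiv_infty
    have c1 := ((hΓ.clm_apply_const b).clm_apply_const c)
    have d1 : DifferentiableAt ℝ (fun z => Γ' (φ z)) y := hΓ'.diff_infty.comp y hs.diff_infty
    have d2 := (c0.clm_apply_const b).diff_infty
    have d3 := (c0.clm_apply_const c).diff_infty
    have d4 := ((c0.fderiv_infty.clm_apply_const b).clm_apply_const c).diff_infty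
    rw [fderiv_clm_apply c0.diff_infty c1.diff_infty,
      fderiv_fun_add ((d1.clm_apply d2).clm_apply d3) d4,
      fderiv_clm_apply (d1.clm_apply d2) d3] at h2
    simp only [add_apply, ContinuousLinearMap.comp_apply, ContinuousLinearMap.flip_apply] at h2
    rw [fderiv_clm_apply d1 d2, fderiv_clm_apply_const (hΓ.clm_apply_const b).diff_infty,
      fderiv_clm_apply_const hΓ.diff_infty,
      fderiv_clm_apply_const (c0.fderiv_infty.clm_apply_const b).diff_infty,
      fderiv_clm_apply_const c0.fderiv_infty.diff_infty,
      fderiv_clm_apply_const c0.diff_infty] at h2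
    simp only [add_apply, ContinuousLinearMap.comp_apply, ContinuousLinearMap.flip_apply] at h2
    rw [fderiv_comp_apply hΓ'.diff_infty hs.diff_infty,
      fderiv_clm_apply_const c0.diff_infty] at h2
    rw [eq_sub_iff_add_eq, h2]
    abel
  have hc := fun u v => hφ.conn h h' hOU hy u v
  have s3 : fderiv ℝ (fderiv ℝ (fderiv ℝ φ)) y a b c
      = fderiv ℝ (fderiv ℝ (fderiv ℝ φ)) y b a c := by
    rw [fderiv_fderiv_symm hs.fderiv_infty]
  have s2 : fderiv ℝ (fderiv ℝ φ) y a b = fderiv ℝ (fderiv ℝ φ) y b a := fderiv_fderiv_symm hs a b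
  simp only [curvEnd, add_apply, sub_apply, mul_apply_eq_comp, map_add, map_sub, key]
  rw [hc a (Γ y b c), hc b (Γ y a c), hc b c, hc a c]
  simp only [map_add]
  rw [s3, s2]
  abel

lemma curvComp_eq (hφ : IsLocalIsom O U' g g' φ) (h : IsLeviCivita U g Γ)
    (h' : IsLeviCivita U' g' Γ') (hOU : O ⊆ U) (hy : y ∈ O) (a b c d : V) :
    curvComp g Γ y a b c d = curvComp g' Γ' (φ y) (fderiv ℝ φ y a) (fderiv ℝ φ y b)
      (fderiv ℝ φ y c) (fderiv ℝ φ y d) := by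
  rw [curvComp, curvComp, ← hφ.curv h h' hOU hy, ← hφ.isom y hy]

/-- The image of a basis under the differential of a local isometry. -/
noncomputable def mapBasis (hφ : IsLocalIsom O U' g g' φ)
    (hpos : ∀ y ∈ O, ∀ v, v ≠ 0 → 0 < g y v v) (hy : y ∈ O) (b : Module.Basis ι ℝ V) :
    Module.Basis ι ℝ V :=
  b.map (LinearEquiv.ofBijective (fderiv ℝ φ y : V →ₗ[ℝ] V)
    ⟨LinearMap.injective_iff_surjective.2 (hφ.surjective hpos hy), hφ.surjective hpos hy⟩)

lemma mapBasis_apply (hφ : IsLocalIsom O U' g g' φ)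
    (hpos : ∀ y ∈ O, ∀ v, v ≠ 0 → 0 < g y v v) (hy : y ∈ O) (b : Module.Basis ι ℝ V) (i : ι) :
    hφ.mapBasis hpos hy b i = fderiv ℝ φ y (b i) := rfl

lemma mapBasis_ortho (hφ : IsLocalIsom O U' g g' φ)
    (hpos : ∀ y ∈ O, ∀ v, v ≠ 0 → 0 < g y v v) (hy : y ∈ O) {b : Module.Basis ι ℝ V}
    (hb : IsOrthoBasis (g y) b) : IsOrthoBasis (g' (φ y)) (hφ.mapBasis hpos hy b) := by
  refine ⟨fun i => ?_, fun i j hij => ?_⟩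
  · rw [mapBasis_apply, ← hφ.isom y hy, hb.1]
  · rw [mapBasis_apply, mapBasis_apply, ← hφ.isom y hy, hb.2 i j hij]

lemma ricci_eq (hφ : IsLocalIsom O U' g g' φ) (h : IsLeviCivita U g Γ)
    (h' : IsLeviCivita U' g' Γ') (hOU : O ⊆ U) (hy : y ∈ O) (u v : V) :
    ricciForm Γ u v y = ricciForm Γ' (fderiv ℝ φ y u) (fderiv ℝ φ y v) (φ y) := by
  have hpos := fun y hy => h.pos y (hOU hy)
  obtain ⟨b, hb⟩ := exists_isOrthoBasis (Module.finBasis ℝ V) (g y) (h.symm y (hOU hy))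
    (h.pos y (hOU hy))
  rw [ricciForm, ricciForm, hb.trace, (hφ.mapBasis_ortho hpos hy hb).trace]
  exact Finset.sum_congr rfl fun i _ => hφ.curvComp_eq h h' hOU hy (b i) u (b i) v

end IsLocalIsom

end Transform

/-! ### Index notation and the invariant calculus -/

section Index

variable {n : ℕ}

/-- `G` is the smooth matrix of a Riemannian metric on the open set `U`. -/
structure IsMetricOn (U : Set (Coord n)) (G : Coord n → Matrix (Fin n) (Fin n) ℝ) : Prop where
  isOpen : IsOpen U
  contDiff : ∀ y ∈ U, ∀ i j, ContDiffAt ℝ ∞ (fun z => G z i j) y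
  posDef : ∀ y ∈ U, (G y).PosDef

/-- The standard basis vector `∂_i`. -/
noncomputable abbrev stdVec (i : Fin n) : Coord n := EuclideanSpace.single i (1 : ℝ)

/-- The standard basis of the model space. -/
noncomputable def stdBasis (n : ℕ) : Module.Basis (Fin n) ℝ (Coord n) :=
  (EuclideanSpace.basisFun (Fin n) ℝ).toBasis

lemma stdBasis_apply (i : Fin n) : stdBasis n i = stdVec i := by
  simp [stdBasis]

lemma stdBasis_coord (i : Fin n) (v : Coord n) : (stdBasis n).coord i v = v i := by
  simp [stdBasis]

/-- The coordinate form `dx_i`. -/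
noncomputable abbrev dCoord (i : Fin n) : Coord n →L[ℝ] ℝ := EuclideanSpace.proj i

lemma sum_smul_stdVec (v : Coord n) : ∑ i, v i • stdVec i = v := by
  conv_rhs => rw [← (stdBasis n).sum_repr v]
  exact Finset.sum_congr rfl fun i _ => by rw [stdBasis_apply]; congr 1

lemma sum_mul_linear {F : Coord n → ℝ} (hF : IsLinearMap ℝ F) (v : Coord n) :
    ∑ i, v i * F (stdVec i) = F v := by
  have h1 := map_sum (hF.mk' F) (fun i => v i • stdVec i) Finset.univ
  rw [sum_smul_stdVec] at h1
  refine Eq.trans (Finset.sum_congr rfl fun i _ => ?_) h1.symm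
  exact (hF.map_smul _ _).symm

/-- The metric as a field of bilinear forms. -/
noncomputable def metricForm (G : Coord n → Matrix (Fin n) (Fin n) ℝ) (y : Coord n) :
    Coord n →L[ℝ] Coord n →L[ℝ] ℝ :=
  ∑ i, ∑ j, G y i j • (dCoord i).smulRight (dCoord j)

/-- The Christoffel symbols as a field of bilinear maps. -/
noncomputable def connForm (G : Coord n → Matrix (Fin n) (Fin n) ℝ) (y : Coord n) :
    Coord n →L[ℝ] Coord n →L[ℝ] Coord n :=
  ∑ k, ∑ i, ∑ j, christoffel G k i j y • (dCoord i).smulRight ((dCoord j).smulRight (stdVec k))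

/-- The Ricci tensor as a field of endomorphisms. -/
noncomputable def ricciEnd (G : Coord n → Matrix (Fin n) (Fin n) ℝ) (y : Coord n) :
    Coord n →L[ℝ] Coord n :=
  ∑ i, ∑ j, (∑ k, (G y)⁻¹ i k * ric G k j y) • (dCoord j).smulRight (stdVec i)

lemma metricForm_apply (G : Coord n → Matrix (Fin n) (Fin n) ℝ) (y u v : Coord n) :
    metricForm G y u v = ∑ i, ∑ j, G y i j * (u i * v j) := by
  simp [metricForm, sum_apply]

lemma metricForm_std (G : Coord n → Matrix (Fin n) (Fin n) ℝ) (y : Coord n) (i j : Fin n) :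
    metricForm G y (stdVec i) (stdVec j) = G y i j := by
  simp [metricForm_apply]

lemma metricForm_std_left (G : Coord n → Matrix (Fin n) (Fin n) ℝ) (y w : Coord n) (i : Fin n) :
    metricForm G y (stdVec i) w = ∑ j, G y i j * w j := by
  simp [metricForm_apply]

lemma connForm_std (G : Coord n → Matrix (Fin n) (Fin n) ℝ) (y : Coord n) (i j k : Fin n) :
    connForm G y (stdVec i) (stdVec j) k = christoffel G k i j y := by
  simp [connForm, sum_apply, Pi.single_apply]

lemma ricciEnd_std (G : Coord n → Matrix (Fin n) (Fin n) ℝ) (y : Coord n) (i j : Fin n) :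
    ricciEnd G y (stdVec j) i = ∑ k, (G y)⁻¹ i k * ric G k j y := by
  simp [ricciEnd, sum_apply, Pi.single_apply]

/-- A linear function which vanishes on the standard basis is zero. It is stated for functions
with explicit additivity, so that it applies to each slot of a multilinear expression. -/
lemma eq_zero_of_basis {F : Coord n → ℝ} (ha : ∀ u v, F (u + v) = F u + F v)
    (hs : ∀ (r : ℝ) u, F (r • u) = r * F u) (h0 : ∀ i, F (stdVec i) = 0) (v : Coord n) :
    F v = 0 := by
  rw [← sum_mul_linear (F := F) ⟨ha, fun r u => by rw [hs, smul_eq_mul]⟩ v]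
  simp [h0]

namespace IsMetricOn

variable {U : Set (Coord n)} {G : Coord n → Matrix (Fin n) (Fin n) ℝ} {y : Coord n}

lemma mul_inv (h : IsMetricOn U G) (hy : y ∈ U) : G y * (G y)⁻¹ = 1 :=
  Matrix.mul_nonsing_inv _ (h.posDef y hy).det_pos.ne'.isUnit

lemma inv_mul (h : IsMetricOn U G) (hy : y ∈ U) : (G y)⁻¹ * G y = 1 :=
  Matrix.nonsing_inv_mul _ (h.posDef y hy).det_pos.ne'.isUnit

lemma symm (h : IsMetricOn U G) (hy : y ∈ U) (i j : Fin n) : G y i j = G y j i := by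
  have := (h.posDef y hy).isHermitian.apply i j
  simpa using this.symm

lemma contDiff_det (h : IsMetricOn U G) (hy : y ∈ U) : ContDiffAt ℝ ∞ (fun z => (G z).det) y := by
  simp only [Matrix.det_apply]
  exact ContDiffAt.sum fun σ _ => (contDiffAt_prod fun i _ => h.contDiff y hy _ _).const_smul _

lemma contDiff_inv (h : IsMetricOn U G) (hy : y ∈ U) (i j : Fin n) :
    ContDiffAt ℝ ∞ (fun z => (G z)⁻¹ i j) y := by
  have e : ∀ z, (G z)⁻¹ i j = ((G z).det)⁻¹ * (G z).adjugate i j := by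
    intro z; rw [Matrix.inv_def]; simp
  simp only [e]
  refine ((h.contDiff_det hy).inv (h.posDef y hy).det_pos.ne').mul ?_
  simp only [Matrix.adjugate_apply, Matrix.det_apply]
  refine ContDiffAt.sum fun σ _ => ContDiffAt.const_smul _ (contDiffAt_prod fun k _ => ?_)
  simp only [Matrix.updateRow_apply]
  split_ifs
  · exact contDiffAt_const
  · exact h.contDiff y hy _ _

lemma contDiff_pd {F : Coord n → ℝ} (hF : ContDiffAt ℝ ∞ F y) (i : Fin n) :
    ContDiffAt ℝ ∞ (pd F i) y := hF.fderiv_infty.clm_apply_const _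

lemma contDiff_christoffel (h : IsMetricOn U G) (hy : y ∈ U) (k i j : Fin n) :
    ContDiffAt ℝ ∞ (christoffel G k i j) y :=
  contDiffAt_const.mul (ContDiffAt.sum fun l _ => (h.contDiff_inv hy k l).mul
    (((contDiff_pd (h.contDiff y hy _ _) i).add (contDiff_pd (h.contDiff y hy _ _) j)).sub
      (contDiff_pd (h.contDiff y hy _ _) l)))

lemma contDiff_conn (h : IsMetricOn U G) (hy : y ∈ U) : ContDiffAt ℝ ∞ (connForm G) y :=
  ContDiffAt.sum fun k _ => ContDiffAt.sum fun i _ => ContDiffAt.sum fun j _ =>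
    (h.contDiff_christoffel hy k i j).smul contDiffAt_const

lemma contDiff_metricForm (h : IsMetricOn U G) (hy : y ∈ U) : ContDiffAt ℝ ∞ (metricForm G) y :=
  ContDiffAt.sum fun i _ => ContDiffAt.sum fun j _ => (h.contDiff y hy i j).smul contDiffAt_const

lemma pd_symm (h : IsMetricOn U G) (hy : y ∈ U) (i j l : Fin n) :
    pd (fun z => G z i j) l y = pd (fun z => G z j i) l y := by
  rw [pd, pd, fderiv_congr_of_eqOn h.isOpen (fun z hz => h.symm hz i j) hy]

/-- Lowering the index of the Christoffel symbols. -/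
lemma sum_christoffel (h : IsMetricOn U G) (hy : y ∈ U) (m i j : Fin n) :
    ∑ k, G y m k * christoffel G k i j y = (1 / 2) * (pd (fun z => G z j m) i y
      + pd (fun z => G z i m) j y - pd (fun z => G z i j) m y) := by
  have e : ∀ k, G y m k * christoffel G k i j y = ∑ l, (G y m k * (G y)⁻¹ k l) *
      ((1 / 2) * (pd (fun z => G z j l) i y + pd (fun z => G z i l) j y
        - pd (fun z => G z i j) l y)) := by
    intro k
    rw [christoffel, Finset.mul_sum, Finset.mul_sum]
    exact Finset.sum_congr rfl fun l _ => by ring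
  simp only [e]
  rw [Finset.sum_comm]
  simp only [← Finset.sum_mul]
  have e2 : ∀ l, ∑ k, G y m k * (G y)⁻¹ k l = if m = l then 1 else 0 := by
    intro l
    rw [← Matrix.mul_apply, h.mul_inv hy, Matrix.one_apply]
  simp only [e2, ite_mul, one_mul, zero_mul, Finset.sum_ite_eq, Finset.mem_univ, if_true]

lemma metricForm_conn (h : IsMetricOn U G) (hy : y ∈ U) (m i j : Fin n) :
    metricForm G y (stdVec m) (connForm G y (stdVec i) (stdVec j))
      = (1 / 2) * (pd (fun z => G z j m) i y
      + pd (fun z => G z i m) j y - pd (fun z => G z i j) m y) := by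
  rw [← h.sum_christoffel hy, metricForm_apply]
  simp [connForm_std]

/-- The Christoffel symbols given by indices define the Levi-Civita connection. -/
lemma isLeviCivita (h : IsMetricOn U G) : IsLeviCivita U (metricForm G) (connForm G) := by
  have hsym : ∀ y ∈ U, ∀ u v, metricForm G y u v = metricForm G y v u := by
    intro y hy u v
    rw [metricForm_apply, metricForm_apply, Finset.sum_comm]
    exact Finset.sum_congr rfl fun i _ => Finset.sum_congr rfl fun j _ => by
      rw [h.symm hy i j]; ring
  refine ⟨h.isOpen, fun y hy => h.contDiff_metricForm hy, fun y hy => h.contDiff_conn hy,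
    hsym, ?_, ?_, ?_⟩
  · intro y hy v hv
    have := (h.posDef y hy).dotProduct_mulVec_pos (x := v.ofLp) (by simpa using hv)
    rw [metricForm_apply]
    refine this.trans_eq ?_
    simp only [dotProduct, Matrix.mulVec, Finset.mul_sum, star_trivial]
    refine Finset.sum_congr rfl fun i _ => Finset.sum_congr rfl fun j _ => ?_
    change v i * (G y i j * v j) = G y i j * (v i * v j)
    ring
  · intro y hy u v
    have hc : ∀ k i j, christoffel G k i j y = christoffel G k j i y := by
      intro k i j
      rw [christoffel, christoffel]
      congr 1
      exact Finset.sum_congr rfl fun l _ => by rw [h.pd_symm hy i j l]; ring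
    simp only [connForm]
    simp only [sum_apply, smul_apply, ContinuousLinearMap.smulRight_apply]
    refine Finset.sum_congr rfl fun k _ => ?_
    rw [Finset.sum_comm]
    refine Finset.sum_congr rfl fun i _ => Finset.sum_congr rfl fun j _ => ?_
    rw [hc k j i, smul_smul, smul_smul, smul_smul, smul_smul]
    congr 1
    ring
  · intro y hy w u v
    have hg := h.contDiff_metricForm hy
    have hbase : ∀ l i j, fderiv ℝ (metricForm G) y (stdVec l) (stdVec i) (stdVec j)
        = metricForm G y (connForm G y (stdVec l) (stdVec i)) (stdVec j)
          + metricForm G y (stdVec i) (connForm G y (stdVec l) (stdVec j)) := by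
      intro l i j
      rw [hsym y hy _ (stdVec j), h.metricForm_conn hy, h.metricForm_conn hy,
        ← fderiv_clm_apply_const hg.diff_infty,
        ← fderiv_clm_apply_const (hg.clm_apply_const _).diff_infty]
      simp only [metricForm_std]
      rw [h.pd_symm hy j i l, h.pd_symm hy l i j, h.pd_symm hy l j i]
      simp only [pd]
      ring
    rw [← sub_eq_zero]
    refine eq_zero_of_basis (F := fun w => fderiv ℝ (metricForm G) y w u v -
      (metricForm G y (connForm G y w u) v + metricForm G y u (connForm G y w v)))
      (fun a b => by simp only [map_add, add_apply]; ring)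
      (fun r a => by simp only [map_smul, smul_apply, smul_eq_mul]; ring) (fun l => ?_) w
    refine eq_zero_of_basis (F := fun u => fderiv ℝ (metricForm G) y (stdVec l) u v -
      (metricForm G y (connForm G y (stdVec l) u) v + metricForm G y u (connForm G y (stdVec l) v)))
      (fun a b => by simp only [map_add, add_apply]; ring)
      (fun r a => by simp only [map_smul, smul_apply, smul_eq_mul]; ring) (fun i => ?_) u
    refine eq_zero_of_basis (F := fun v => fderiv ℝ (metricForm G) y (stdVec l) (stdVec i) v -
      (metricForm G y (connForm G y (stdVec l) (stdVec i)) v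
        + metricForm G y (stdVec i) (connForm G y (stdVec l) v)))
      (fun a b => by simp only [map_add]; ring)
      (fun r a => by simp only [map_smul, smul_eq_mul]; ring) (fun j => ?_) v
    simp only [hbase, sub_self]

lemma coord_fderiv {F : Coord n → Coord n} (hF : DifferentiableAt ℝ F y) (a : Coord n)
    (l : Fin n) : fderiv ℝ F y a l = fderiv ℝ (fun z => F z l) y a := by
  have : HasFDerivAt (fun z => dCoord l (F z)) ((dCoord l).comp (fderiv ℝ F y)) y :=
    (dCoord l).hasFDerivAt.comp y hF.hasFDerivAt
  change _ = fderiv ℝ (fun z => dCoord l (F z)) y a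
  rw [this.fderiv]; rfl

lemma curvUp_eq (h : IsMetricOn U G) (hy : y ∈ U) (l i j k : Fin n) :
    curvUp G l i j k y = curvEnd (connForm G) (stdVec i) (stdVec j) y (stdVec k) l := by
  have hΓ := h.contDiff_conn hy
  have hd : ∀ i j k l, fderiv ℝ (connForm G) y (stdVec i) (stdVec j) (stdVec k) l
      = pd (christoffel G l j k) i y := by
    intro i j k l
    rw [← fderiv_clm_apply_const hΓ.diff_infty,
      ← fderiv_clm_apply_const (hΓ.clm_apply_const _).diff_infty,
      coord_fderiv ((hΓ.clm_apply_const _).clm_apply_const _).diff_infty]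
    simp only [connForm_std]
    rfl
  have hcc : ∀ i (v : Coord n) l, connForm G y (stdVec i) v l
      = ∑ m, v m * christoffel G l i m y := by
    intro i v l
    conv_lhs => rw [← sum_smul_stdVec v]
    simp [map_sum, connForm_std]
  rw [curvUp, curvEnd]
  simp only [add_apply, sub_apply, mul_apply_eq_comp, PiLp.add_apply, PiLp.sub_apply, hd]
  rw [hcc, hcc, Finset.sum_sub_distrib]
  simp only [connForm_std]

lemma riem_eq (h : IsMetricOn U G) (hy : y ∈ U) (i j k l : Fin n) :
    riem G i j k l y = curvComp (metricForm G) (connForm G) y (stdVec i) (stdVec j) (stdVec k)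
      (stdVec l) := by
  rw [riem, curvComp, h.isLeviCivita.symm y hy, metricForm_apply]
  simp [h.curvUp_eq hy]

lemma ric_eq (h : IsMetricOn U G) (hy : y ∈ U) (j l : Fin n) :
    ric G j l y = ricciForm (connForm G) (stdVec j) (stdVec l) y := by
  rw [ric, ricciForm, trace_eq_sum_coord (stdBasis n)]
  refine Finset.sum_congr rfl fun i _ => ?_
  rw [stdBasis_coord, stdBasis_apply]
  change _ = curvEnd (connForm G) (stdVec i) (stdVec j) y (stdVec l) i
  rw [← h.curvUp_eq hy]
  have e : ∀ k, (G y)⁻¹ i k * riem G i j k l y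
      = ∑ m, ((G y)⁻¹ i k * G y k m) * curvUp G m i j l y := by
    intro k; rw [riem, Finset.mul_sum]; exact Finset.sum_congr rfl fun m _ => by ring
  simp only [e]
  rw [Finset.sum_comm]
  simp only [← Finset.sum_mul]
  have e2 : ∀ m, ∑ k, (G y)⁻¹ i k * G y k m = if i = m then 1 else 0 := by
    intro l
    rw [← Matrix.mul_apply, h.inv_mul hy, Matrix.one_apply]
  simp [e2]

lemma ricciForm_linear_right (Γ : Coord n → Coord n →L[ℝ] Coord n →L[ℝ] Coord n) (u y : Coord n) :
    IsLinearMap ℝ (fun v => ricciForm Γ u v y) := by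
  constructor
  · intro v w
    rw [ricciForm, ricciForm, ricciForm, ← map_add]; congr 1; ext a : 1; simp [curvSlot]
  · intro r v
    rw [ricciForm, ricciForm, ← map_smul]; congr 1; ext a : 1; simp [curvSlot]

lemma ricciForm_linear_left (Γ : Coord n → Coord n →L[ℝ] Coord n →L[ℝ] Coord n) (v y : Coord n) :
    IsLinearMap ℝ (fun u => ricciForm Γ u v y) := by
  constructor
  · intro u w
    rw [ricciForm, ricciForm, ricciForm, ← map_add]; congr 1; ext a : 1
    simp [curvSlot, curvEnd_add_right]
  · intro r v
    rw [ricciForm, ricciForm, ← map_smul]; congr 1; ext a : 1; simp [curvSlot, curvEnd_smul_right]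

lemma metricForm_ricciEnd (h : IsMetricOn U G) (hy : y ∈ U) (u v : Coord n) :
    metricForm G y (ricciEnd G y u) v = ricciForm (connForm G) u v y := by
  have hbase : ∀ j l, metricForm G y (ricciEnd G y (stdVec j)) (stdVec l)
      = ricciForm (connForm G) (stdVec j) (stdVec l) y := by
    intro j l
    rw [h.isLeviCivita.symm y hy, metricForm_std_left, h.isLeviCivita.ricci_symm hy, ← h.ric_eq hy]
    simp only [ricciEnd_std]
    have e : ∀ i, G y l i * ∑ k, (G y)⁻¹ i k * ric G k j y
        = ∑ k, (G y l i * (G y)⁻¹ i k) * ric G k j y := by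
      intro i; rw [Finset.mul_sum]; exact Finset.sum_congr rfl fun m _ => by ring
    have e2 : ∀ m, ∑ k, G y l k * (G y)⁻¹ k m = if l = m then 1 else 0 := by
      intro m
      rw [← Matrix.mul_apply, h.mul_inv hy, Matrix.one_apply]
    simp only [e]
    rw [Finset.sum_comm]
    simp [← Finset.sum_mul, e2]
  have h1 := ricciForm_linear_left (connForm G) (y := y)
  have h2 := ricciForm_linear_right (connForm G) (y := y)
  rw [← sub_eq_zero]
  refine eq_zero_of_basis (F := fun u => metricForm G y (ricciEnd G y u) v
    - ricciForm (connForm G) u v y) (fun a b => ?_) (fun r a => ?_) (fun l => ?_) u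
  · simp only [map_add, add_apply, (h1 v).map_add]; ring
  · simp only [map_smul, smul_apply, smul_eq_mul, (h1 v).map_smul]; ring
  refine eq_zero_of_basis (F := fun v => metricForm G y (ricciEnd G y (stdVec l)) v
    - ricciForm (connForm G) (stdVec l) v y) (fun a b => ?_) (fun r a => ?_) (fun j => ?_) v
  · simp only [map_add, (h2 _).map_add]; ring
  · simp only [map_smul, smul_eq_mul, (h2 _).map_smul]; ring
  simp only [hbase, sub_self]

lemma contDiff_riem (h : IsMetricOn U G) (hy : y ∈ U) (i j k l : Fin n) :
    ContDiffAt ℝ ∞ (riem G i j k l) y :=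
  ContDiffAt.sum fun m _ => (h.contDiff y hy k m).mul
    (((contDiff_pd (h.contDiff_christoffel hy _ _ _) _).sub
      (contDiff_pd (h.contDiff_christoffel hy _ _ _) _)).add
      (ContDiffAt.sum fun _ _ => ((h.contDiff_christoffel hy _ _ _).mul
        (h.contDiff_christoffel hy _ _ _)).sub ((h.contDiff_christoffel hy _ _ _).mul
        (h.contDiff_christoffel hy _ _ _))))

lemma contDiff_ric (h : IsMetricOn U G) (hy : y ∈ U) (j l : Fin n) :
    ContDiffAt ℝ ∞ (ric G j l) y :=
  ContDiffAt.sum fun i _ => ContDiffAt.sum fun k _ => (h.contDiff_inv hy i k).mul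
    (h.contDiff_riem hy _ _ _ _)

lemma contDiff_scal (h : IsMetricOn U G) (hy : y ∈ U) : ContDiffAt ℝ ∞ (scal G) y :=
  ContDiffAt.sum fun i _ => ContDiffAt.sum fun k _ => (h.contDiff_inv hy i k).mul
    (h.contDiff_ric hy _ _)

lemma contDiff_tracelessRic (h : IsMetricOn U G) (hy : y ∈ U) (i j : Fin n) :
    ContDiffAt ℝ ∞ (tracelessRic G i j) y :=
  (h.contDiff_ric hy i j).sub (((h.contDiff_scal hy).div_const _).mul (h.contDiff y hy i j))

lemma contDiff_weyl (h : IsMetricOn U G) (hy : y ∈ U) (i j k l : Fin n) :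
    ContDiffAt ℝ ∞ (weyl G i j k l) y := by
  have hE := h.contDiff_tracelessRic hy
  have hG := h.contDiff y hy
  exact ((h.contDiff_riem hy i j k l).sub (contDiffAt_const.mul
    (((((hE i k).mul (hG j l)).add ((hE j l).mul (hG i k))).sub ((hE i l).mul (hG j k))).sub
      ((hE j k).mul (hG i l))))).sub (((h.contDiff_scal hy).div_const _).mul
      (((hG i k).mul (hG j l)).sub ((hG i l).mul (hG j k))))

lemma contDiff_ricciEnd (h : IsMetricOn U G) (hy : y ∈ U) : ContDiffAt ℝ ∞ (ricciEnd G) y :=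
  ContDiffAt.sum fun i _ => ContDiffAt.sum fun j _ =>
    (ContDiffAt.sum fun k _ => (h.contDiff_inv hy i k).mul (h.contDiff_ric hy k j)).smul
      contDiffAt_const

lemma ric_symm (h : IsMetricOn U G) (hy : y ∈ U) (i j : Fin n) : ric G i j y = ric G j i y := by
  rw [h.ric_eq hy, h.ric_eq hy, h.isLeviCivita.ricci_symm hy]

lemma traceL_ricciEnd (h : IsMetricOn U G) (hy : y ∈ U) :
    traceL (Coord n) (ricciEnd G y) = scal G y := by
  rw [traceL_apply, trace_eq_sum_coord (stdBasis n), scal]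
  refine Finset.sum_congr rfl fun i _ => ?_
  rw [stdBasis_coord, stdBasis_apply]
  refine (ricciEnd_std G y i i).trans ?_
  exact Finset.sum_congr rfl fun k _ => by rw [h.ric_symm hy]

end IsMetricOn

end Index

/-! ### Norms of tensors in an orthonormal basis -/

section Contraction

variable {n : ℕ} {U : Set (Coord n)} {G : Coord n → Matrix (Fin n) (Fin n) ℝ} {y : Coord n}
  {b : Module.Basis (Fin n) ℝ (Coord n)}

/-- Contraction with `H = Bᵀ B` is the scalar product of the components with respect to `B`. It is
used for products of inverse metrics, with pairs and quadruples of indices as the index type `κ`. -/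
lemma sum_contract {κ : Type*} [Fintype κ] (H B : κ → κ → ℝ)
    (hH : ∀ x x', H x x' = ∑ p, B p x * B p x') (X Y : κ → ℝ) :
    ∑ x, ∑ x', H x x' * (X x * Y x') = ∑ p, (∑ x, B p x * X x) * (∑ x, B p x * Y x) := by
  have e : ∀ x x', H x x' * (X x * Y x') = ∑ p, (B p x * X x) * (B p x' * Y x') := by
    intro x x'; rw [hH, Finset.sum_mul]; exact Finset.sum_congr rfl fun p _ => by ring
  have e2 : ∀ x, ∑ x', ∑ p, (B p x * X x) * (B p x' * Y x')
      = ∑ p, (B p x * X x) * ∑ x', B p x' * Y x' := by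
    intro x; rw [Finset.sum_comm]; simp only [Finset.mul_sum]
  simp only [e, e2]
  rw [Finset.sum_comm]
  simp only [Finset.sum_mul]

/-- The traceless Ricci tensor as a bilinear form; its values on the standard basis are
`tracelessRic`. -/
noncomputable def tracelessForm (G : Coord n → Matrix (Fin n) (Fin n) ℝ) (y u v : Coord n) : ℝ :=
  ricciForm (connForm G) u v y - scal G y / n * metricForm G y u v

/-- The Weyl tensor as a multilinear form; its values on the standard basis are `weyl`. -/
noncomputable def weylForm (G : Coord n → Matrix (Fin n) (Fin n) ℝ) (y u v w x : Coord n) : ℝ :=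
  curvComp (metricForm G) (connForm G) y u v w x
    - (1 / ((n : ℝ) - 2)) *
        (tracelessForm G y u w * metricForm G y v x + tracelessForm G y v x * metricForm G y u w
          - tracelessForm G y u x * metricForm G y v w
          - tracelessForm G y v w * metricForm G y u x)
    - scal G y / ((n : ℝ) * ((n : ℝ) - 1)) * (metricForm G y u w * metricForm G y v x
      - metricForm G y u x * metricForm G y v w)

lemma tracelessForm_linear_right (y u : Coord n) :
    IsLinearMap ℝ (fun v => tracelessForm G y u v) := by
  have h := IsMetricOn.ricciForm_linear_right (connForm G) u y
  constructor
  · intro v w; simp only [tracelessForm, h.map_add, map_add]; ring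
  · intro r v; simp only [tracelessForm, h.map_smul, map_smul, smul_eq_mul]; ring

lemma tracelessForm_linear_left (y v : Coord n) :
    IsLinearMap ℝ (fun u => tracelessForm G y u v) := by
  have h := IsMetricOn.ricciForm_linear_left (connForm G) v y
  constructor
  · intro u w; simp only [tracelessForm, h.map_add, map_add, add_apply]; ring
  · intro r u; simp only [tracelessForm, h.map_smul, map_smul, smul_apply, smul_eq_mul]; ring

lemma weylForm_linear (y u v w x : Coord n) :
    IsLinearMap ℝ (fun u => weylForm G y u v w x) ∧ IsLinearMap ℝ (fun v => weylForm G y u v w x) ∧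
    IsLinearMap ℝ (fun w => weylForm G y u v w x) ∧
    IsLinearMap ℝ (fun x => weylForm G y u v w x) := by
  have h1 := fun u => (tracelessForm_linear_right (G := G) y u)
  have h2 := fun u => (tracelessForm_linear_left (G := G) y u)
  refine ⟨⟨fun a b => ?_, fun r a => ?_⟩, ⟨fun a b => ?_, fun r a => ?_⟩,
    ⟨fun a b => ?_, fun r a => ?_⟩, ⟨fun a b => ?_, fun r a => ?_⟩⟩ <;>
  · simp only [weylForm, curvComp, (h1 _).map_add, (h1 _).map_smul, (h2 _).map_add,
      (h2 _).map_smul, map_add, map_smul, add_apply, smul_apply, smul_eq_mul, curvEnd_add_left,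
      curvEnd_add_right, curvEnd_smul_left, curvEnd_smul_right]
    ring

namespace IsMetricOn

/-- The inverse metric is `∑ b_a ⊗ b_a` for every orthonormal basis `b`. -/
lemma inv_eq_sum (hb : IsOrthoBasis (metricForm G y) b)
    (i k : Fin n) : (G y)⁻¹ i k = ∑ a, b a i * b a k := by
  let B : Matrix (Fin n) (Fin n) ℝ := Matrix.of fun i a => b a i
  have h1 : (B.transpose * G y) * B = 1 := by
    ext a c
    rw [Matrix.one_apply, ← hb.apply, metricForm_apply, Matrix.mul_apply]
    simp only [Matrix.mul_apply, Finset.sum_mul]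
    rw [Finset.sum_comm]
    exact Finset.sum_congr rfl fun i _ => Finset.sum_congr rfl fun j _ => by
      simp only [B, Matrix.transpose_apply, Matrix.of_apply]; ring
  have h2 : (B * B.transpose) * G y = 1 := by
    rw [Matrix.mul_assoc]; exact mul_eq_one_comm.1 h1
  rw [Matrix.inv_eq_left_inv h2, Matrix.mul_apply]
  rfl

lemma weyl_std (h : IsMetricOn U G) (hy : y ∈ U) (i j k l : Fin n) :
    weyl G i j k l y = weylForm G y (stdVec i) (stdVec j) (stdVec k) (stdVec l) := by
  simp only [weyl, weylForm, tracelessRic, tracelessForm, h.riem_eq hy, h.ric_eq hy, metricForm_std]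

lemma tracelessRic_std (h : IsMetricOn U G) (hy : y ∈ U) (i j : Fin n) :
    tracelessRic G i j y = tracelessForm G y (stdVec i) (stdVec j) := by
  simp only [tracelessRic, tracelessForm, h.ric_eq hy, metricForm_std]

lemma sum_inv_mul (hb : IsOrthoBasis (metricForm G y) b)
    {F H : Coord n → ℝ} (hF : IsLinearMap ℝ F) (hH : IsLinearMap ℝ H) :
    ∑ i, ∑ j, (G y)⁻¹ i j * (F (stdVec i) * H (stdVec j)) = ∑ a, F (b a) * H (b a) := by
  rw [sum_contract _ (fun a i => b a i) (IsMetricOn.inv_eq_sum hb)]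
  simp only [sum_mul_linear hF, sum_mul_linear hH]

/-- Contraction of a bilinear form. -/
lemma sum_inv_bilin (hb : IsOrthoBasis (metricForm G y) b)
    {F : Coord n → Coord n → ℝ} (hF : ∀ v, IsLinearMap ℝ (fun u => F u v))
    (hF' : ∀ u, IsLinearMap ℝ (F u)) :
    ∑ i, ∑ j, (G y)⁻¹ i j * F (stdVec i) (stdVec j) = ∑ a, F (b a) (b a) := by
  simp only [IsMetricOn.inv_eq_sum hb, Finset.sum_mul]
  have e : ∀ i, ∑ j, ∑ a, b a i * b a j * F (stdVec i) (stdVec j)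
      = ∑ a, b a i * F (stdVec i) (b a) := by
    intro i
    rw [Finset.sum_comm]
    refine Finset.sum_congr rfl fun a _ => ?_
    rw [← sum_mul_linear (hF' (stdVec i)), Finset.mul_sum]
    exact Finset.sum_congr rfl fun j _ => by ring
  simp only [e]
  rw [Finset.sum_comm]
  exact Finset.sum_congr rfl fun a _ => sum_mul_linear (hF (b a)) (b a)

lemma scal_eq_sum (h : IsMetricOn U G) (hy : y ∈ U) (hb : IsOrthoBasis (metricForm G y) b) :
    scal G y = ∑ a, ricciForm (connForm G) (b a) (b a) y := by
  rw [scal]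
  simp only [h.ric_eq hy]
  exact IsMetricOn.sum_inv_bilin hb (F := fun u v => ricciForm (connForm G) u v y)
    (fun v => ricciForm_linear_left _ v y) (fun u => ricciForm_linear_right _ u y)

lemma gradSq_eq_sum (hb : IsOrthoBasis (metricForm G y) b)
    (F : Coord n → ℝ) : gradSq G F y = ∑ a, fderiv ℝ F y (b a) ^ 2 := by
  have hl : IsLinearMap ℝ (fun v => fderiv ℝ F y v) := (fderiv ℝ F y : Coord n →ₗ[ℝ] ℝ).isLinear
  rw [gradSq]
  simp only [mul_assoc, sq]
  exact IsMetricOn.sum_inv_mul hb hl hl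

lemma normTracelessRic_sq (h : IsMetricOn U G) (hy : y ∈ U)
    (hb : IsOrthoBasis (metricForm G y) b) :
    (∑ i, ∑ j, ∑ a, ∑ c, (G y)⁻¹ i a * (G y)⁻¹ j c * tracelessRic G i j y * tracelessRic G a c y)
      = ∑ p, ∑ q, tracelessForm G y (b p) (b q) ^ 2 := by
  have := sum_contract (κ := Fin n × Fin n) (fun x x' => (G y)⁻¹ x.1 x'.1 * (G y)⁻¹ x.2 x'.2)
    (fun p x => b p.1 x.1 * b p.2 x.2) (fun x x' => by
      rw [IsMetricOn.inv_eq_sum hb, IsMetricOn.inv_eq_sum hb, Finset.sum_mul_sum,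
        Fintype.sum_prod_type]
      exact Finset.sum_congr rfl fun i _ => Finset.sum_congr rfl fun j _ => by ring)
    (fun x => tracelessRic G x.1 x.2 y) (fun x => tracelessRic G x.1 x.2 y)
  simp only [Fintype.sum_prod_type] at this
  simp only [mul_assoc] at this ⊢
  rw [this]
  refine Finset.sum_congr rfl fun p _ => Finset.sum_congr rfl fun q _ => ?_
  have e : ∑ i, ∑ j, b p i * (b q j * tracelessRic G i j y) = tracelessForm G y (b p) (b q) := by
    simp only [h.tracelessRic_std hy, ← Finset.mul_sum,
      sum_mul_linear (tracelessForm_linear_right y _)]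
    exact sum_mul_linear (tracelessForm_linear_left y _) _
  rw [e, sq]

lemma normWeyl_sq (h : IsMetricOn U G) (hy : y ∈ U)
    (hb : IsOrthoBasis (metricForm G y) b) :
    (∑ i, ∑ j, ∑ k, ∑ l, ∑ a, ∑ b, ∑ c, ∑ d,
      (G y)⁻¹ i a * (G y)⁻¹ j b * (G y)⁻¹ k c * (G y)⁻¹ l d * weyl G i j k l y * weyl G a b c d y)
      = ∑ p, ∑ q, ∑ r, ∑ s, weylForm G y (b p) (b q) (b r) (b s) ^ 2 := by
  have := sum_contract (κ := Fin n × Fin n × Fin n × Fin n)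
    (fun x x' => (G y)⁻¹ x.1 x'.1 * (G y)⁻¹ x.2.1 x'.2.1 * (G y)⁻¹ x.2.2.1 x'.2.2.1
      * (G y)⁻¹ x.2.2.2 x'.2.2.2)
    (fun p x => b p.1 x.1 * b p.2.1 x.2.1 * b p.2.2.1 x.2.2.1 * b p.2.2.2 x.2.2.2)
    (fun x x' => by
      have e : ∀ p q r s, (b p x.1 * b q x.2.1 * b r x.2.2.1 * b s x.2.2.2) *
          (b p x'.1 * b q x'.2.1 * b r x'.2.2.1 * b s x'.2.2.2) = (b p x.1 * b p x'.1) *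
          ((b q x.2.1 * b q x'.2.1) * ((b r x.2.2.1 * b r x'.2.2.1) *
          (b s x.2.2.2 * b s x'.2.2.2))) := by intros; ring
      simp only [Fintype.sum_prod_type, e, ← Finset.mul_sum, ← Finset.sum_mul,
        ← IsMetricOn.inv_eq_sum hb]
      ring)
    (fun x => weyl G x.1 x.2.1 x.2.2.1 x.2.2.2 y) (fun x => weyl G x.1 x.2.1 x.2.2.1 x.2.2.2 y)
  simp only [Fintype.sum_prod_type] at this
  simp only [mul_assoc] at this ⊢
  rw [this]
  refine Finset.sum_congr rfl fun p _ => Finset.sum_congr rfl fun q _ =>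
    Finset.sum_congr rfl fun r _ => Finset.sum_congr rfl fun s _ => ?_
  have e : ∑ i, ∑ j, ∑ k, ∑ l, b p i * (b q j * (b r k * (b s l * weyl G i j k l y)))
      = weylForm G y (b p) (b q) (b r) (b s) := by
    simp only [h.weyl_std hy, ← Finset.mul_sum,
      sum_mul_linear (weylForm_linear (G := G) y _ _ _ 0).2.2.2,
      sum_mul_linear (weylForm_linear (G := G) y _ _ 0 _).2.2.1,
      sum_mul_linear (weylForm_linear (G := G) y _ 0 _ _).2.1,
      sum_mul_linear (weylForm_linear (G := G) y 0 _ _ _).1]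
  rw [e, sq]

/-- The components `∇_p R_ijkl` are the values of `covCurv` on the coordinate fields. -/
lemma nablaRiem_eq (h : IsMetricOn U G) (hy : y ∈ U) (p i j k l : Fin n) :
    nablaRiem G p i j k l y = metricForm G y (covCurv (connForm G) (stdVec p) (stdVec i)
      (stdVec j) y (stdVec l)) (stdVec k) := by
  have hL := h.isLeviCivita
  rw [hL.covCurv_apply hy, nablaRiem, pd,
    fderiv_congr_of_eqOn h.isOpen (fun z hz => h.riem_eq hz i j k l) hy]
  have hexp : ∀ i, connForm G y (stdVec p) (stdVec i) = ∑ a, christoffel G a p i y • stdVec a := by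
    intro i
    rw [← sum_smul_stdVec (connForm G y (stdVec p) (stdVec i))]
    simp only [connForm_std]
  have l1 : IsLinearMap ℝ (fun u => metricForm G y (curvEnd (connForm G) u (stdVec j) y
      (stdVec l)) (stdVec k)) := ⟨fun a b => by simp [curvEnd_add_left],
        fun r a => by simp [curvEnd_smul_left]⟩
  have l2 : IsLinearMap ℝ (fun u => metricForm G y (curvEnd (connForm G) (stdVec i) u y
      (stdVec l)) (stdVec k)) := ⟨fun a b => by simp [curvEnd_add_right],
        fun r a => by simp [curvEnd_smul_right]⟩
  have l3 : IsLinearMap ℝ (fun u => metricForm G y (curvEnd (connForm G) (stdVec i) (stdVec j) y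
      u) (stdVec k)) := ⟨fun a b => by simp, fun r a => by simp⟩
  have l4 : IsLinearMap ℝ (fun u => metricForm G y (curvEnd (connForm G) (stdVec i) (stdVec j) y
      (stdVec l)) u) := ⟨fun a b => by simp, fun r a => by simp⟩
  rw [← sum_mul_linear l1, ← sum_mul_linear l2, ← sum_mul_linear l3, ← sum_mul_linear l4]
  simp only [connForm_std, h.riem_eq hy, Finset.sum_add_distrib]
  simp only [curvComp]
  ring

lemma divFree (h : IsMetricOn U G) (hd : ∀ y ∈ U, ∀ j k l, divRiem G j k l y = 0) :
    IsLeviCivita.DivFree (Fin n) U (metricForm G) (connForm G) := by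
  intro y hy b hb u v w
  have lp : ∀ a u v w : Coord n, IsLinearMap ℝ (fun p => metricForm G y
      (covCurv (connForm G) p a u y w) v) := fun a u v w => by
    constructor
    · intro p q
      simp only [covCurv, covEnd_add_dir, map_add, add_apply, sub_apply, map_sub, curvEnd_add_left,
        curvEnd_add_right]; ring
    · intro r p
      simp only [covCurv, covEnd_smul_dir, map_smul, smul_apply, sub_apply, map_sub,
        curvEnd_smul_left, curvEnd_smul_right, smul_eq_mul]; ring
  have l4 : ∀ p a u w : Coord n, IsLinearMap ℝ (fun v => metricForm G y
      (covCurv (connForm G) p a u y w) v) := fun p a u w => ⟨by simp, by simp⟩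
  have l3 : ∀ p a u v : Coord n, IsLinearMap ℝ (fun w => metricForm G y
      (covCurv (connForm G) p a u y w) v) := fun p a u v => ⟨by simp, by simp⟩
  -- linearity in the first two curvature slots follows from the pair symmetry
  have l1 : ∀ p u v w : Coord n, IsLinearMap ℝ (fun a => metricForm G y
      (covCurv (connForm G) p a u y w) v) := fun p u v w => by
    simp only [fun a => h.isLeviCivita.covCurv_pair hy p a u w v]
    exact l3 p w v u
  have l2 : ∀ p a v w : Coord n, IsLinearMap ℝ (fun u => metricForm G y
      (covCurv (connForm G) p a u y w) v) := fun p a v w => by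
    simp only [fun u => h.isLeviCivita.covCurv_pair hy p a u w v]
    exact l4 p w v a
  have hbase : ∀ j k l, ∑ i, metricForm G y (covCurv (connForm G) (b i) (b i) (stdVec j) y
      (stdVec l)) (stdVec k) = 0 := by
    intro j k l
    rw [← hd y hy j k l, divRiem]
    simp only [h.nablaRiem_eq hy]
    exact (IsMetricOn.sum_inv_bilin hb (F := fun p a => metricForm G y (covCurv (connForm G) p a
      (stdVec j) y (stdVec l)) (stdVec k)) (fun a => lp _ _ _ _) (fun p => l1 _ _ _ _)).symm
  refine eq_zero_of_basis (F := fun u => ∑ i, metricForm G y (covCurv (connForm G) (b i) (b i) u y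
    w) v) (fun a c => ?_) (fun r a => ?_) (fun j => ?_) u
  · simp only [(l2 _ _ _ _).map_add, Finset.sum_add_distrib]
  · simp only [(l2 _ _ _ _).map_smul, smul_eq_mul, Finset.mul_sum]
  refine eq_zero_of_basis (F := fun v => ∑ i, metricForm G y (covCurv (connForm G) (b i) (b i)
    (stdVec j) y w) v) (fun a c => ?_) (fun r a => ?_) (fun k => ?_) v
  · simp only [(l4 _ _ _ _).map_add, Finset.sum_add_distrib]
  · simp only [(l4 _ _ _ _).map_smul, smul_eq_mul, Finset.mul_sum]
  refine eq_zero_of_basis (F := fun w => ∑ i, metricForm G y (covCurv (connForm G) (b i) (b i)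
    (stdVec j) y w) (stdVec k)) (fun a c => ?_) (fun r a => ?_) (fun l => ?_) w
  · simp only [(l3 _ _ _ _).map_add, Finset.sum_add_distrib]
  · simp only [(l3 _ _ _ _).map_smul, smul_eq_mul, Finset.mul_sum]
  exact hbase j k l

lemma exists_ortho (h : IsMetricOn U G) (hy : y ∈ U) :
    ∃ b : Module.Basis (Fin n) ℝ (Coord n), IsOrthoBasis (metricForm G y) b :=
  exists_isOrthoBasis (stdBasis n) _ (h.isLeviCivita.symm y hy) (h.isLeviCivita.pos y hy)

lemma tracelessForm_eq (h : IsMetricOn U G) (hy : y ∈ U) (u v : Coord n) :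
    tracelessForm G y u v = metricForm G y (tracelessEnd (ricciEnd G) n y u) v := by
  simp only [tracelessForm, tracelessEnd, sub_apply, smul_apply, map_sub, map_smul,
    one_apply_eq_self, smul_eq_mul, h.metricForm_ricciEnd hy, h.traceL_ricciEnd hy]

lemma normTracelessRic_sq_eq (h : IsMetricOn U G) (hy : y ∈ U)
    (hb : IsOrthoBasis (metricForm G y) b) :
    normTracelessRic G y ^ 2 = ∑ p, ∑ q, tracelessForm G y (b p) (b q) ^ 2 := by
  rw [normTracelessRic, h.normTracelessRic_sq hy hb, Real.sq_sqrt]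
  exact Finset.sum_nonneg fun i _ => Finset.sum_nonneg fun j _ => sq_nonneg _

/-- `|E|²` as a trace, which shows that it is smooth although `|E|` need not be. -/
lemma normTracelessRic_sq_trace (h : IsMetricOn U G) (hy : y ∈ U) :
    normTracelessRic G y ^ 2 = traceL (Coord n) (tracelessEnd (ricciEnd G) n y *
      tracelessEnd (ricciEnd G) n y) := by
  obtain ⟨b, hb⟩ := h.exists_ortho hy
  have hgs := h.isLeviCivita.symm y hy
  rw [h.normTracelessRic_sq_eq hy hb, traceL_apply, hb.trace]
  refine Finset.sum_congr rfl fun i _ => ?_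
  change _ = metricForm G y (tracelessEnd (ricciEnd G) n y (tracelessEnd (ricciEnd G) n y (b i)))
    (b i)
  rw [← h.tracelessForm_eq hy, tracelessForm, h.isLeviCivita.ricci_symm hy, hgs, ← tracelessForm,
    h.tracelessForm_eq hy, hb.inner_eq_sum hgs]
  exact Finset.sum_congr rfl fun j _ => by rw [h.tracelessForm_eq hy, sq]

lemma contDiff_normSq (h : IsMetricOn U G) (hy : y ∈ U) :
    ContDiffAt ℝ ∞ (fun z => normTracelessRic G z ^ 2) y := by
  have h1 : ContDiffAt ℝ ∞ (tracelessEnd (ricciEnd G) n) y :=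
    (h.contDiff_ricciEnd hy).sub ((((traceL (Coord n)).contDiff.contDiffAt.comp y
      (h.contDiff_ricciEnd hy)).div_const _).smul contDiffAt_const)
  refine ContDiffAt.congr_of_eventuallyEq (f := fun z => traceL (Coord n)
    (tracelessEnd (ricciEnd G) n z * tracelessEnd (ricciEnd G) n z)) ?_ ?_
  · exact (traceL (Coord n)).contDiff.contDiffAt.comp y (h1.mul h1)
  · exact Filter.eventually_of_mem (h.isOpen.mem_nhds hy)
      fun z hz => h.normTracelessRic_sq_trace hz

lemma normWeyl_eq (h : IsMetricOn U G) (hy : y ∈ U)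
    (hb : IsOrthoBasis (metricForm G y) b) :
    normWeyl G y = √(∑ p, ∑ q, ∑ r, ∑ s, weylForm G y (b p) (b q) (b r) (b s) ^ 2) := by
  rw [normWeyl, h.normWeyl_sq hy hb]

/-- The pointwise Bochner inequality in a chart. -/
theorem bochner_chart (h : IsMetricOn U G) (hd : ∀ y ∈ U, ∀ j k l, divRiem G j k l y = 0)
    (hn : 3 ≤ n) (hy : y ∈ U) (hb : IsOrthoBasis (metricForm G y) b) :
    ∃ N : ℝ, 0 ≤ N ∧
      ((n : ℝ) + 2) * gradSq G (fun z => normTracelessRic G z ^ 2) y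
        ≤ 4 * n * (normTracelessRic G y ^ 2 * N) ∧
      N - (normWeyl G y + (n : ℝ) / (n - 2) * normTracelessRic G y) * normTracelessRic G y ^ 2
        + scal G y / ((n : ℝ) - 1) * normTracelessRic G y ^ 2
        ≤ 1 / 2 * ∑ k, hess (connForm G) (fun z => normTracelessRic G z ^ 2) (b k) (b k) y := by
  obtain ⟨-, N, hN0, hN1, hN2⟩ := h.isLeviCivita.bochner (h.divFree hd)
    (fun z hz => h.contDiff_ricciEnd hz) (fun z hz => h.metricForm_ricciEnd hz) hy b hb n
    (by simp) (by simpa using hn) (fun i j => tracelessForm G y (b i) (b j))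
    (fun i j k l => weylForm G y (b i) (b j) (b k) (b l)) (scal G y)
    (fun z => normTracelessRic G z ^ 2) (fun i j => h.tracelessForm_eq hy _ _)
    (h.traceL_ricciEnd hy).symm (fun i j k l => by simp only [weylForm, hb.apply])
    (fun z hz => h.normTracelessRic_sq_trace hz)
  refine ⟨N, hN0, ?_, ?_⟩
  · rwa [IsMetricOn.gradSq_eq_sum hb]
  · rw [Real.sqrt_sq (show 0 ≤ normTracelessRic G y from Real.sqrt_nonneg _)] at hN2
    rwa [h.normWeyl_eq hy hb]

lemma fderiv_scal (h : IsMetricOn U G) (hd : ∀ y ∈ U, ∀ j k l, divRiem G j k l y = 0)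
    (hy : y ∈ U) : fderiv ℝ (scal G) y = 0 := by
  ext u
  rw [← fderiv_congr_of_eqOn h.isOpen (fun z hz => h.traceL_ricciEnd hz) hy]
  exact h.isLeviCivita.fderiv_trace_ricci (stdBasis n) (h.divFree hd)
    (fun z hz => h.contDiff_ricciEnd hz) (fun z hz => h.metricForm_ricciEnd hz) hy u

end IsMetricOn

/-! ### Invariance of the scalar quantities -/

section Invariance

variable {U' O : Set (Coord n)} {G' : Coord n → Matrix (Fin n) (Fin n) ℝ}
  {φ : Coord n → Coord n}

lemma IsLocalIsom.scal_eq (hφ : IsLocalIsom O U' (metricForm G) (metricForm G') φ)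
    (h : IsMetricOn U G) (h' : IsMetricOn U' G') (hOU : O ⊆ U) (hy : y ∈ O) :
    scal G y = scal G' (φ y) := by
  obtain ⟨b, hb⟩ := h.exists_ortho (hOU hy)
  have hpos := fun y hy => h.isLeviCivita.pos y (hOU hy)
  rw [h.scal_eq_sum (hOU hy) hb, h'.scal_eq_sum (hφ.maps y hy) (hφ.mapBasis_ortho hpos hy hb)]
  exact Finset.sum_congr rfl fun a _ => hφ.ricci_eq h.isLeviCivita h'.isLeviCivita hOU hy _ _

lemma IsLocalIsom.tracelessForm_eq (hφ : IsLocalIsom O U' (metricForm G) (metricForm G') φ)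
    (h : IsMetricOn U G) (h' : IsMetricOn U' G') (hOU : O ⊆ U) (hy : y ∈ O) (u v : Coord n) :
    tracelessForm G y u v = tracelessForm G' (φ y) (fderiv ℝ φ y u) (fderiv ℝ φ y v) := by
  rw [tracelessForm, tracelessForm, hφ.ricci_eq h.isLeviCivita h'.isLeviCivita hOU hy,
    hφ.scal_eq h h' hOU hy, hφ.isom y hy]

lemma IsLocalIsom.normTracelessRic_eq (hφ : IsLocalIsom O U' (metricForm G) (metricForm G') φ)
    (h : IsMetricOn U G) (h' : IsMetricOn U' G') (hOU : O ⊆ U) (hy : y ∈ O) :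
    normTracelessRic G y = normTracelessRic G' (φ y) := by
  obtain ⟨b, hb⟩ := h.exists_ortho (hOU hy)
  have hpos := fun y hy => h.isLeviCivita.pos y (hOU hy)
  rw [normTracelessRic, normTracelessRic, h.normTracelessRic_sq (hOU hy) hb,
    h'.normTracelessRic_sq (hφ.maps y hy) (hφ.mapBasis_ortho hpos hy hb)]
  congr 1
  exact Finset.sum_congr rfl fun a _ => Finset.sum_congr rfl fun c _ => by
    rw [hφ.tracelessForm_eq h h' hOU hy]; rfl

lemma IsLocalIsom.weylForm_eq (hφ : IsLocalIsom O U' (metricForm G) (metricForm G') φ)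
    (h : IsMetricOn U G) (h' : IsMetricOn U' G') (hOU : O ⊆ U) (hy : y ∈ O) (u v w x : Coord n) :
    weylForm G y u v w x = weylForm G' (φ y) (fderiv ℝ φ y u) (fderiv ℝ φ y v)
      (fderiv ℝ φ y w) (fderiv ℝ φ y x) := by
  simp only [weylForm]
  rw [hφ.curvComp_eq h.isLeviCivita h'.isLeviCivita hOU hy, hφ.scal_eq h h' hOU hy]
  simp only [hφ.tracelessForm_eq h h' hOU hy, hφ.isom y hy]

lemma IsLocalIsom.normWeyl_eq (hφ : IsLocalIsom O U' (metricForm G) (metricForm G') φ)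
    (h : IsMetricOn U G) (h' : IsMetricOn U' G') (hOU : O ⊆ U) (hy : y ∈ O) :
    normWeyl G y = normWeyl G' (φ y) := by
  obtain ⟨b, hb⟩ := h.exists_ortho (hOU hy)
  have hpos := fun y hy => h.isLeviCivita.pos y (hOU hy)
  rw [h.normWeyl_eq (hOU hy) hb, h'.normWeyl_eq (hφ.maps y hy) (hφ.mapBasis_ortho hpos hy hb)]
  refine congrArg Real.sqrt ?_
  refine Finset.sum_congr rfl fun p _ => Finset.sum_congr rfl fun q _ =>
    Finset.sum_congr rfl fun r _ => Finset.sum_congr rfl fun s _ => ?_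
  rw [hφ.weylForm_eq h h' hOU hy]
  simp only [IsLocalIsom.mapBasis_apply]

end Invariance

end Contraction

/-! ### Integration by parts in a chart -/

section LocalParts

variable {n : ℕ}

/-- `⟨∇F, ∇H⟩ = g^{ij} ∂_i F ∂_j H`. -/
noncomputable def gradIn (G : Coord n → Matrix (Fin n) (Fin n) ℝ) (F H : Coord n → ℝ)
    (y : Coord n) : ℝ :=
  ∑ i, ∑ j, (G y)⁻¹ i j * (pd F i y * pd H j y)

/-- The Laplacian `g^{ij} ∇_i ∇_j F`. -/
noncomputable def lap (G : Coord n → Matrix (Fin n) (Fin n) ℝ) (F : Coord n → ℝ)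
    (y : Coord n) : ℝ :=
  ∑ i, ∑ j, (G y)⁻¹ i j * hess (connForm G) F (stdVec i) (stdVec j) y

/-- The gradient vector field `g^{ij} ∂_j F ∂_i`. -/
noncomputable def gradField (G : Coord n → Matrix (Fin n) (Fin n) ℝ) (F : Coord n → ℝ)
    (y : Coord n) : Coord n :=
  ∑ i, (∑ j, (G y)⁻¹ i j * pd F j y) • stdVec i

/-- Jacobi's formula for the derivative of a determinant. -/
lemma fderiv_det {V : Type*} [NormedAddCommGroup V] [NormedSpace ℝ V]
    {A : V → Matrix (Fin n) (Fin n) ℝ} {y : V}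
    (hA : ∀ i j, DifferentiableAt ℝ (fun z => A z i j) y) (u : V) :
    fderiv ℝ (fun z => (A z).det) y u
      = ∑ i, ∑ r, (A y).adjugate i r * fderiv ℝ (fun z => A z r i) y u := by
  classical
  have h1 : ∀ i, ∑ r, (A y).adjugate i r * fderiv ℝ (fun z => A z r i) y u
      = ((A y).updateCol i (fun r => fderiv ℝ (fun z => A z r i) y u)).det := by
    intro i
    rw [← Matrix.cramer_apply, Matrix.cramer_eq_adjugate_mulVec]; rfl
  have h2 : ∀ σ : Equiv.Perm (Fin n), HasFDerivAt (fun z => ∏ i, A z (σ i) i)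
      (∑ i, (∏ j ∈ Finset.univ.erase i, A y (σ j) j) • fderiv ℝ (fun z => A z (σ i) i) y) y :=
    fun σ => HasFDerivAt.finsetProd fun i _ => (hA _ _).hasFDerivAt
  have h3 : HasFDerivAt (fun z => (A z).det) (∑ σ : Equiv.Perm (Fin n),
      ((Equiv.Perm.sign σ : ℤ) : ℝ) • (∑ i, (∏ j ∈ Finset.univ.erase i, A y (σ j) j) •
        fderiv ℝ (fun z => A z (σ i) i) y)) y := by
    simp only [Matrix.det_apply']
    exact HasFDerivAt.fun_sum fun σ _ => (h2 σ).const_mul _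
  rw [h3.fderiv]
  simp only [h1, Matrix.det_apply', sum_apply, smul_apply, smul_eq_mul]
  rw [Finset.sum_comm]
  refine Finset.sum_congr rfl fun σ _ => ?_
  rw [Finset.mul_sum]
  refine Finset.sum_congr rfl fun i _ => ?_
  rw [← Finset.mul_prod_erase Finset.univ _ (Finset.mem_univ i), Matrix.updateCol_self,
    mul_comm (fderiv ℝ _ y u)]
  congr 2
  exact Finset.prod_congr rfl fun j hj => by
    rw [Matrix.updateCol_ne (Finset.ne_of_mem_erase hj)]

namespace IsMetricOn

variable {U : Set (Coord n)} {G : Coord n → Matrix (Fin n) (Fin n) ℝ} {y : Coord n}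
  {b : Module.Basis (Fin n) ℝ (Coord n)} {F H : Coord n → ℝ}

lemma gradIn_eq_sum (hb : IsOrthoBasis (metricForm G y) b)
    (F H : Coord n → ℝ) :
    gradIn G F H y = ∑ a, fderiv ℝ F y (b a) * fderiv ℝ H y (b a) :=
  IsMetricOn.sum_inv_mul hb (F := fun v => fderiv ℝ F y v) (H := fun v => fderiv ℝ H y v)
    (fderiv ℝ F y : Coord n →ₗ[ℝ] ℝ).isLinear (fderiv ℝ H y : Coord n →ₗ[ℝ] ℝ).isLinear

lemma lap_eq_sum (hb : IsOrthoBasis (metricForm G y) b)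
    (hF : ContDiffAt ℝ ∞ F y) :
    lap G F y = ∑ a, hess (connForm G) F (b a) (b a) y := by
  have e : ∀ u v, hess (connForm G) F u v y
      = fderiv ℝ (fderiv ℝ F) y u v - fderiv ℝ F y (connForm G y u v) := fun u v => by
    rw [hess, fderiv_clm_apply_const hF.fderiv_infty.diff_infty]
  simp only [lap, e]
  refine IsMetricOn.sum_inv_bilin hb (F := fun u v => fderiv ℝ (fderiv ℝ F) y u v
    - fderiv ℝ F y (connForm G y u v)) (fun v => ⟨fun a c => ?_, fun r a => ?_⟩)
    (fun v => ⟨fun a c => ?_, fun r a => ?_⟩)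
  all_goals simp only [map_add, map_smul, add_apply, smul_apply, smul_eq_mul]; ring

lemma contDiff_gradField (h : IsMetricOn U G) (hy : y ∈ U) (hF : ContDiffAt ℝ ∞ F y) :
    ContDiffAt ℝ ∞ (gradField G F) y :=
  ContDiffAt.sum fun i _ => (ContDiffAt.sum fun j _ =>
    (h.contDiff_inv hy i j).mul (contDiff_pd hF j)).smul contDiffAt_const

lemma gradField_coord (i : Fin n) : gradField G F y i = ∑ j, (G y)⁻¹ i j * pd F j y := by
  simp [gradField, Pi.single_apply]

lemma metricForm_gradField (h : IsMetricOn U G) (hy : y ∈ U) (v : Coord n) :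
    metricForm G y (gradField G F y) v = fderiv ℝ F y v := by
  rw [← sub_eq_zero]
  refine eq_zero_of_basis (F := fun v => metricForm G y (gradField G F y) v - fderiv ℝ F y v)
    (fun a b => by simp only [map_add]; ring)
    (fun r a => by simp only [map_smul, smul_eq_mul]; ring) (fun l => ?_) v
  rw [h.isLeviCivita.symm y hy, metricForm_std_left]
  simp only [gradField_coord, Finset.mul_sum, ← mul_assoc]
  rw [Finset.sum_comm]
  simp only [← Finset.sum_mul, ← Matrix.mul_apply, h.mul_inv hy, Matrix.one_apply]
  simp [pd]

lemma fderiv_gradField (h : IsMetricOn U G) (hy : y ∈ U) (hF : ContDiffAt ℝ ∞ F y)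
    (u v : Coord n) :
    metricForm G y (fderiv ℝ (gradField G F) y u + connForm G y u (gradField G F y)) v
      = hess (connForm G) F u v y := by
  have hX := (h.contDiff_gradField hy hF).diff_infty
  have hg := (h.contDiff_metricForm hy).diff_infty
  have h1 : HasFDerivAt (fun z => metricForm G z (gradField G F z))
      _ y := hg.hasFDerivAt.clm_apply hX.hasFDerivAt
  have h2 : fderiv ℝ (fun z => metricForm G z (gradField G F z) v) y u
      = metricForm G y (fderiv ℝ (gradField G F) y u) v
        + fderiv ℝ (metricForm G) y u (gradField G F y) v := by
    rw [fderiv_clm_apply_const h1.differentiableAt, h1.fderiv]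
    simp [add_apply]
  rw [fderiv_congr_of_eqOn h.isOpen (fun z hz => h.metricForm_gradField hz v) hy,
    h.isLeviCivita.compat y hy, h.metricForm_gradField hy] at h2
  rw [hess, h2, map_add, add_apply]
  ring

lemma trace_fderiv_gradField (h : IsMetricOn U G) (hy : y ∈ U)
    (hFU : ∀ z ∈ U, ContDiffAt ℝ ∞ F z) :
    ∑ i, pd (fun z => gradField G F z i) i y + traceL (Coord n) (connForm G y (gradField G F y))
      = lap G F y := by
  obtain ⟨b, hb⟩ := h.exists_ortho hy
  have hX := (h.contDiff_gradField hy (hFU y hy)).diff_infty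
  have h1 : ∑ i, pd (fun z => gradField G F z i) i y
      = traceL (Coord n) (fderiv ℝ (gradField G F) y) := by
    rw [traceL_apply, trace_eq_sum_coord (stdBasis n)]
    refine Finset.sum_congr rfl fun i _ => ?_
    rw [stdBasis_apply, stdBasis_coord, pd, ← coord_fderiv hX]
    rfl
  rw [h1, IsMetricOn.lap_eq_sum hb (hFU y hy), ← map_add, traceL_apply, hb.trace]
  refine Finset.sum_congr rfl fun a _ => ?_
  rw [← h.fderiv_gradField hy (hFU y hy), h.isLeviCivita.torsion y hy (b a)]
  rfl

lemma adjugate_eq (h : IsMetricOn U G) (hy : y ∈ U) (i j : Fin n) :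
    (G y).adjugate i j = (G y).det * (G y)⁻¹ i j := by
  have hd := (h.posDef y hy).det_pos.ne'
  rw [Matrix.inv_def, Matrix.smul_apply, Ring.inverse_eq_inv', smul_eq_mul, ← mul_assoc,
    mul_inv_cancel₀ hd, one_mul]

lemma fderiv_sqrt_det (h : IsMetricOn U G) (hy : y ∈ U) (u : Coord n) :
    fderiv ℝ (fun z => √(G z).det) y u = √(G y).det * traceL (Coord n) (connForm G y u) := by
  obtain ⟨b, hb⟩ := h.exists_ortho hy
  have hd := (h.posDef y hy).det_pos
  have h1 : fderiv ℝ (fun z => (G z).det) y u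
      = 2 * (G y).det * traceL (Coord n) (connForm G y u) := by
    rw [fderiv_det (fun i j => (h.contDiff y hy i j).diff_infty)]
    simp only [h.adjugate_eq hy, mul_assoc, ← Finset.mul_sum]
    have e : ∀ r i, fderiv ℝ (fun z => G z r i) y u
        = fderiv ℝ (metricForm G) y u (stdVec r) (stdVec i) := by
      intro r i
      have hg := h.contDiff_metricForm hy
      rw [← fderiv_clm_apply_const hg.diff_infty,
        ← fderiv_clm_apply_const (hg.clm_apply_const _).diff_infty]
      simp only [metricForm_std]
    simp only [e]
    rw [IsMetricOn.sum_inv_bilin hb (F := fun v w => fderiv ℝ (metricForm G) y u w v)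
      (fun v => ⟨fun a c => map_add (fderiv ℝ (metricForm G) y u v) a c,
        fun r a => map_smul (fderiv ℝ (metricForm G) y u v) r a⟩)
      (fun v => ⟨fun a c => by simp only [map_add, add_apply],
        fun r a => by simp only [map_smul, smul_apply]⟩), traceL_apply, hb.trace,
      mul_left_comm 2]
    refine congrArg ((G y).det * ·) ?_
    rw [Finset.mul_sum]
    refine Finset.sum_congr rfl fun a _ => ?_
    rw [h.isLeviCivita.compat y hy, h.isLeviCivita.symm y hy (b a)]
    change _ = 2 * metricForm G y (connForm G y u (b a)) (b a)
    ring
  have h2 := ((h.contDiff_det hy).diff_infty.hasFDerivAt.sqrt hd.ne').fderiv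
  rw [h2, smul_apply, smul_eq_mul, h1]
  have h3 := Real.sq_sqrt hd.le
  have h4 := Real.sqrt_pos.2 hd
  field_simp
  rw [h3]

lemma contDiff_sqrt_det (h : IsMetricOn U G) (hy : y ∈ U) :
    ContDiffAt ℝ ∞ (fun z => √(G z).det) y :=
  (h.contDiff_det hy).sqrt (h.posDef y hy).det_pos.ne'

lemma gradIn_eq_gradField (G : Coord n → Matrix (Fin n) (Fin n) ℝ) (F H : Coord n → ℝ)
    (y : Coord n) :
    gradIn G H F y = fderiv ℝ H y (gradField G F y) := by
  simp only [gradField, map_sum, map_smul, smul_eq_mul, gradIn, Finset.sum_mul]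
  refine Finset.sum_congr rfl fun i _ => Finset.sum_congr rfl fun j _ => ?_
  change _ = _ * pd H i y
  ring

/-- The divergence formula `∂_i(√g η X^i) = √g (⟨∇η, ∇F⟩ + η ΔF)` for `X = ∇F`. -/
lemma divergence_eq (h : IsMetricOn U G) (hy : y ∈ U) {η : Coord n → ℝ}
    (hη : ContDiffAt ℝ ∞ η y) (hFU : ∀ z ∈ U, ContDiffAt ℝ ∞ F z) :
    ∑ i, pd (fun z => √(G z).det * η z * gradField G F z i) i y
      = √(G y).det * (gradIn G η F y + η y * lap G F y) := by
  have hX := h.contDiff_gradField hy (hFU y hy)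
  have hXi : ∀ i, DifferentiableAt ℝ (fun z => gradField G F z i) y := fun i =>
    ((dCoord i).differentiableAt.comp y hX.diff_infty)
  have hs := (h.contDiff_sqrt_det hy).diff_infty
  have e : ∀ i, pd (fun z => √(G z).det * η z * gradField G F z i) i y
      = gradField G F y i * (fderiv ℝ (fun z => √(G z).det) y (stdVec i)) * η y
        + √(G y).det * (gradField G F y i * fderiv ℝ η y (stdVec i))
        + √(G y).det * η y * pd (fun z => gradField G F z i) i y := by
    intro i
    have h1 := ((hs.hasFDerivAt.mul hη.diff_infty.hasFDerivAt).mul (hXi i).hasFDerivAt).fderiv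
    have h2 : pd (fun z => √(G z).det * η z * gradField G F z i) i y = _ :=
      congrArg (fun L => L (stdVec i)) h1
    rw [h2]
    simp only [add_apply, smul_apply, smul_eq_mul, Pi.mul_apply, pd]
    ring
  simp only [e, Finset.sum_add_distrib, ← Finset.mul_sum, ← Finset.sum_mul]
  rw [sum_mul_linear (F := fun v => fderiv ℝ (fun z => √(G z).det) y v)
      (fderiv ℝ (fun z => √(G z).det) y : Coord n →ₗ[ℝ] ℝ).isLinear,
    sum_mul_linear (F := fun v => fderiv ℝ η y v) (fderiv ℝ η y : Coord n →ₗ[ℝ] ℝ).isLinear,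
    h.fderiv_sqrt_det hy, gradIn_eq_gradField G F η y, ← h.trace_fderiv_gradField hy hFU]
  ring

end IsMetricOn

lemma integral_pd_eq_zero {F : Coord n → ℝ} (hF : ContDiff ℝ ∞ F) (hc : HasCompactSupport F)
    (i : Fin n) : ∫ y, pd F i y = 0 := by
  have hi : Integrable (fun y => fderiv ℝ F y (stdVec i)) volume :=
    ((hF.continuous_fderiv (by simp)).clm_apply continuous_const).integrable_of_hasCompactSupport
      ((hc.fderiv ℝ).comp_left (g := fun L : Coord n →L[ℝ] ℝ => L (stdVec i)) rfl)
  have := integral_mul_fderiv_eq_neg_fderiv_mul_of_integrable (μ := (volume : Measure (Coord n)))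
    (f := fun _ => (1 : ℝ)) (g := F) (v := stdVec i) (by simp) (by simpa using hi)
    (by simpa using hF.continuous.integrable_of_hasCompactSupport hc)
    (fun _ _ => differentiableAt_const _) (fun y _ => hF.contDiffAt.diff_infty)
  simpa [pd] using this

/-- A function which is smooth on an open set and vanishes off a compact subset is smooth. -/
lemma contDiff_of_zero_off {U K : Set (Coord n)} {F : Coord n → ℝ} (hK : IsCompact K) (hKU : K ⊆ U)
    (hF : ∀ y ∈ U, ContDiffAt ℝ ∞ F y) (h0 : ∀ y ∉ K, F y = 0) : ContDiff ℝ ∞ F := by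
  rw [contDiff_iff_contDiffAt]
  intro y
  by_cases hy : y ∈ U
  · exact hF y hy
  · refine contDiffAt_const (c := (0 : ℝ)) |>.congr_of_eventuallyEq ?_
    exact Filter.eventually_of_mem (hK.isClosed.isOpen_compl.mem_nhds fun hk => hy (hKU hk)) h0

/-- Integration by parts in a chart, for a function `η` with compact support. -/
theorem IsMetricOn.integral_parts {U K : Set (Coord n)} {G : Coord n → Matrix (Fin n) (Fin n) ℝ}
    {F η : Coord n → ℝ} (h : IsMetricOn U G) (hK : IsCompact K) (hKU : K ⊆ U)
    (hFU : ∀ z ∈ U, ContDiffAt ℝ ∞ F z) (hη : ∀ z ∈ U, ContDiffAt ℝ ∞ η z)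
    (h0 : ∀ z ∉ K, η z = 0) :
    ∫ y in U, √(G y).det * (gradIn G η F y + η y * lap G F y) = 0 := by
  have hs : ∀ i, ContDiff ℝ ∞ (fun z => √(G z).det * η z * gradField G F z i) := fun i =>
    contDiff_of_zero_off hK hKU (fun y hy => ((h.contDiff_sqrt_det hy).mul (hη y hy)).mul
      ((dCoord i).contDiff.contDiffAt.comp y (h.contDiff_gradField hy (hFU y hy))))
      (fun y hy => by rw [h0 y hy]; ring)
  have hcs : ∀ i, HasCompactSupport (fun z => √(G z).det * η z * gradField G F z i) := fun i =>
    HasCompactSupport.intro hK fun y hy => by rw [h0 y hy]; ring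
  have hpi : ∀ i, Integrable (pd (fun z => √(G z).det * η z * gradField G F z i) i) volume :=
    fun i => (((hs i).continuous_fderiv (by simp)).clm_apply
      continuous_const).integrable_of_hasCompactSupport
      (((hcs i).fderiv ℝ).comp_left (g := fun L : Coord n →L[ℝ] ℝ => L (stdVec i)) rfl)
  rw [setIntegral_congr_fun h.isOpen.measurableSet
    (fun y hy => (h.divergence_eq hy (hη y hy) hFU).symm)]
  rw [setIntegral_eq_integral_of_forall_compl_eq_zero, integral_finsetSum _ fun i _ => hpi i]
  · exact Finset.sum_eq_zero fun i _ => integral_pd_eq_zero (hs i) (hcs i) i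
  · intro y hy
    refine Finset.sum_eq_zero fun i _ => ?_
    have : (fun z => √(G z).det * η z * gradField G F z i) =ᶠ[nhds y] fun _ => (0 : ℝ) :=
      Filter.eventually_of_mem (hK.isClosed.isOpen_compl.mem_nhds fun hk => hy (hKU hk))
        fun z hz => by simp [h0 z hz]
    rw [pd, this.fderiv_eq]; simp

end LocalParts

/-! ### Charts of a Riemannian manifold -/

section Charts

variable {n : ℕ} {M : Type*} [TopologicalSpace M] [ChartedSpace (Coord n) M]
  [RiemannianBundle (fun x : M => TangentSpace (𝓡 n) x)] [IsManifold (𝓡 n) ∞ M]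
  [IsContMDiffRiemannianBundle (𝓡 n) ∞ (Coord n) (fun x : M => TangentSpace (𝓡 n) x)]
  {e e' : OpenPartialHomeomorph M (Coord n)} {x : M} {y : Coord n}

lemma contMDiffOn_chart (he : e ∈ atlas (Coord n) M) :
    ContMDiffOn (𝓡 n) (𝓡 n) ∞ e e.source :=
  contMDiffOn_of_mem_maximalAtlas (IsManifold.subset_maximalAtlas he)

lemma contMDiffOn_chart_symm (he : e ∈ atlas (Coord n) M) :
    ContMDiffOn (𝓡 n) (𝓡 n) ∞ e.symm e.target :=
  contMDiffOn_symm_of_mem_maximalAtlas (IsManifold.subset_maximalAtlas he)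

lemma mdiff_chart (he : e ∈ atlas (Coord n) M) (hx : x ∈ e.source) :
    MDifferentiableAt (𝓡 n) (𝓡 n) e x :=
  ((contMDiffOn_chart he).contMDiffAt (e.open_source.mem_nhds hx)).mdifferentiableAt (by simp)

lemma mdiff_chart_symm (he : e ∈ atlas (Coord n) M) (hy : y ∈ e.target) :
    MDifferentiableAt (𝓡 n) (𝓡 n) e.symm y :=
  ((contMDiffOn_chart_symm he).contMDiffAt (e.open_target.mem_nhds hy)).mdifferentiableAt (by simp)

lemma metricForm_metricInChart (e : OpenPartialHomeomorph M (Coord n)) (y u v : Coord n) :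
    metricForm (metricInChart e) y u v
      = inner ℝ (mfderiv (𝓡 n) (𝓡 n) e.symm y u) (mfderiv (𝓡 n) (𝓡 n) e.symm y v) := by
  let L : Coord n →L[ℝ] TangentSpace (𝓡 n) (e.symm y) := mfderiv (𝓡 n) (𝓡 n) e.symm y
  change _ = inner ℝ (L u) (L v)
  have hL : ∀ w : Coord n, L w = ∑ i, w i • L (stdVec i) := fun w => by
    conv_lhs => rw [← sum_smul_stdVec w]
    rw [map_sum]
    exact Finset.sum_congr rfl fun i _ => map_smul L _ _
  rw [hL u, hL v, sum_inner, metricForm_apply]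
  refine Finset.sum_congr rfl fun i _ => ?_
  rw [inner_sum]
  refine Finset.sum_congr rfl fun j _ => ?_
  rw [real_inner_smul_left, real_inner_smul_right]
  change inner ℝ (L (stdVec i)) (L (stdVec j)) * _ = _
  ring

lemma mfderiv_chart_symm_injective (he : e ∈ atlas (Coord n) M) (hy : y ∈ e.target) :
    Function.Injective (mfderiv (𝓡 n) (𝓡 n) e.symm y) := by
  have h1 : e ∘ e.symm =ᶠ[nhds y] id :=
    Filter.eventually_of_mem (e.open_target.mem_nhds hy) fun z hz => e.right_inv hz
  have h2 := mfderiv_comp y (mdiff_chart he (e.map_target hy)) (mdiff_chart_symm he hy)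
  rw [h1.mfderiv_eq, mfderiv_id] at h2
  intro u v huv
  have h3 := DFunLike.congr_fun h2 u
  have h4 := DFunLike.congr_fun h2 v
  simp only [ContinuousLinearMap.comp_apply, huv] at h3 h4
  exact h3.trans h4.symm

/-- The coordinate vector field of a chart is a smooth section of the tangent bundle. -/
lemma contMDiffOn_coordField (he : e ∈ atlas (Coord n) M) (v : Coord n) :
    ContMDiffOn (𝓡 n) (𝓡 n).tangent ∞
      (fun y : Coord n => (⟨e.symm y, mfderiv (𝓡 n) (𝓡 n) e.symm y v⟩ : TangentBundle (𝓡 n) M))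
      e.target := by
  have h1 : ContMDiffOn (𝓡 n).tangent (𝓡 n).tangent ∞
      (tangentMapWithin (𝓡 n) (𝓡 n) e.symm e.target) _ :=
    (contMDiffOn_chart_symm he).contMDiffOn_tangentMapWithin (m := ∞) (by simp)
      e.open_target.uniqueMDiffOn
  have h2 : ContMDiff (𝓡 n) (𝓡 n).tangent ∞
      (fun y : Coord n => (⟨y, v⟩ : TangentBundle (𝓡 n) (Coord n))) := by
    exact contMDiff_vectorSpace_iff_contDiff (V := fun _ => v).2 contDiff_const
  refine (h1.comp (t := _) h2.contMDiffOn (fun y hy => hy)).congr fun y hy => ?_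
  simp only [Function.comp_apply, tangentMapWithin]
  rw [mfderivWithin_of_isOpen e.open_target hy]

/-- The coefficients of the metric in a chart are smooth and positive definite. -/
theorem isMetricOn_metricInChart (he : e ∈ atlas (Coord n) M) :
    IsMetricOn e.target (metricInChart e) := by
  refine ⟨e.open_target, fun y hy i j => ?_, fun y hy => ?_⟩
  · have h := (contMDiffOn_coordField he (stdVec i)).inner_bundle
      (contMDiffOn_coordField he (stdVec j))
    exact (contMDiffOn_iff_contDiffOn.1 h).contDiffAt (e.open_target.mem_nhds hy)
  · refine Matrix.PosDef.of_dotProduct_mulVec_pos ?_ fun v hv => ?_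
    · ext i j
      exact real_inner_comm (F := TangentSpace (𝓡 n) (e.symm y)) _ _
    · have h1 := metricForm_metricInChart e y (WithLp.toLp 2 v) (WithLp.toLp 2 v)
      have h2 : mfderiv (𝓡 n) (𝓡 n) e.symm y (WithLp.toLp 2 v) ≠ 0 := by
        intro h0
        refine hv ?_
        have := mfderiv_chart_symm_injective he hy (h0.trans (map_zero _).symm)
        exact congrArg WithLp.ofLp this
      refine (real_inner_self_pos.2 h2).trans_eq (h1.symm.trans ?_)
      rw [metricForm_apply]
      simp only [dotProduct, Matrix.mulVec, Finset.mul_sum, star_trivial]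
      refine Finset.sum_congr rfl fun i _ => Finset.sum_congr rfl fun j _ => ?_
      change _ * (v i * v j) = v i * (_ * v j)
      ring

lemma inner_tangent_congr {p q : M} (h : p = q) (u v : Coord n) :
    @inner ℝ (TangentSpace (𝓡 n) p) _ u v = @inner ℝ (TangentSpace (𝓡 n) q) _ u v := by
  subst h; rfl

/-- The domain of the transition from the chart `e` to the chart `e'`. -/
def overlap (e e' : OpenPartialHomeomorph M (Coord n)) : Set (Coord n) :=
  e.target ∩ e.symm ⁻¹' e'.source

lemma isOpen_overlap : IsOpen (overlap e e') :=
  e.symm.continuousOn.isOpen_inter_preimage e.open_target e'.open_source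

/-- Transition maps are isometries of the metrics in the charts. -/
theorem isLocalIsom_transition (he : e ∈ atlas (Coord n) M) (he' : e' ∈ atlas (Coord n) M) :
    IsLocalIsom (overlap e e') e'.target (metricForm (metricInChart e))
      (metricForm (metricInChart e')) (fun z => e' (e.symm z)) := by
  refine ⟨isOpen_overlap, fun z hz => ?_, fun z hz => e'.map_source hz.2, fun z hz u v => ?_⟩
  · have h1 : ContMDiffAt (𝓡 n) (𝓡 n) ∞ (e' ∘ e.symm) z :=
      ((contMDiffOn_chart he').contMDiffAt (e'.open_source.mem_nhds hz.2)).comp z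
        ((contMDiffOn_chart_symm he).contMDiffAt (e.open_target.mem_nhds hz.1))
    exact contMDiffAt_iff_contDiffAt.1 h1
  · have hz' : e' (e.symm z) ∈ e'.target := e'.map_source hz.2
    have h1 : e'.symm ∘ (fun z => e' (e.symm z)) =ᶠ[nhds z] e.symm :=
      Filter.eventually_of_mem (isOpen_overlap.mem_nhds hz) fun w hw => e'.left_inv hw.2
    have hd : MDifferentiableAt (𝓡 n) (𝓡 n) (fun z => e' (e.symm z)) z :=
      (mdiff_chart he' hz.2).comp z (mdiff_chart_symm he hz.1)
    have h2 := mfderiv_comp z (mdiff_chart_symm he' hz') hd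
    rw [h1.mfderiv_eq, mfderiv_eq_fderiv] at h2
    rw [metricForm_metricInChart, metricForm_metricInChart]
    refine (inner_tangent_congr (e'.left_inv hz.2).symm _ _).trans ?_
    exact congrArg₂ (fun p q : Coord n =>
      @inner ℝ (TangentSpace (𝓡 n) (e'.symm (e' (e.symm z)))) _ p q)
      (DFunLike.congr_fun h2 u) (DFunLike.congr_fun h2 v)

end Charts

/-! ### Scalar invariants and gradients on a manifold -/

lemma IsLocalIsom.gradIn_eq {n : ℕ} {U U' O : Set (Coord n)}
    {G G' : Coord n → Matrix (Fin n) (Fin n) ℝ} {φ : Coord n → Coord n} {y : Coord n}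
    (hφ : IsLocalIsom O U' (metricForm G) (metricForm G') φ)
    (h : IsMetricOn U G) (hOU : O ⊆ U) (hy : y ∈ O) {F H : Coord n → ℝ}
    (hF : DifferentiableAt ℝ F (φ y)) (hH : DifferentiableAt ℝ H (φ y)) :
    gradIn G (fun z => F (φ z)) (fun z => H (φ z)) y = gradIn G' F H (φ y) := by
  obtain ⟨b, hb⟩ := h.exists_ortho (hOU hy)
  have hpos := fun y hy => h.isLeviCivita.pos y (hOU hy)
  rw [IsMetricOn.gradIn_eq_sum hb,
    IsMetricOn.gradIn_eq_sum (hφ.mapBasis_ortho hpos hy hb)]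
  exact Finset.sum_congr rfl fun a _ => by
    rw [IsLocalIsom.fderiv_comp_apply hF (hφ.contDiff y hy).diff_infty,
      IsLocalIsom.fderiv_comp_apply hH (hφ.contDiff y hy).diff_infty]; rfl

lemma gradSq_eq_gradIn {n : ℕ} (G : Coord n → Matrix (Fin n) (Fin n) ℝ) (F : Coord n → ℝ)
    (y : Coord n) : gradSq G F y = gradIn G F F y := by
  simp only [gradSq, gradIn, mul_assoc]

lemma gradIn_congr {n : ℕ} {G : Coord n → Matrix (Fin n) (Fin n) ℝ} {F F' H H' : Coord n → ℝ}
    {y : Coord n} (hF : F =ᶠ[nhds y] F') (hH : H =ᶠ[nhds y] H') :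
    gradIn G F H y = gradIn G F' H' y := by
  simp only [gradIn, pd, hF.fderiv_eq, hH.fderiv_eq]

section Invariants

variable {n : ℕ} {M : Type*} [TopologicalSpace M] [ChartedSpace (Coord n) M]
  [RiemannianBundle (fun x : M => TangentSpace (𝓡 n) x)] [IsManifold (𝓡 n) ∞ M]
  [IsContMDiffRiemannianBundle (𝓡 n) ∞ (Coord n) (fun x : M => TangentSpace (𝓡 n) x)]
  {e : OpenPartialHomeomorph M (Coord n)} {x : M} {y : Coord n} {u v w : M → ℝ}

/-- The inner product `⟨∇u, ∇v⟩` of two gradients at `x`, computed in the preferred chart at `x`; by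
`gradInner_eq` any other chart gives the same value. -/
noncomputable def gradInner (n : ℕ) {M : Type*} [TopologicalSpace M] [ChartedSpace (Coord n) M]
    [RiemannianBundle (fun x : M => TangentSpace (𝓡 n) x)] (u v : M → ℝ) (x : M) : ℝ :=
  gradIn (metricInChart (chartAt (Coord n) x)) (u ∘ (chartAt (Coord n) x).symm)
    (v ∘ (chartAt (Coord n) x).symm) (chartAt (Coord n) x x)

/-- The differential of `u` at `x`, as a linear form on the model space by means of the preferred
chart at `x`. -/
noncomputable def chartDeriv (n : ℕ) {M : Type*} [TopologicalSpace M] [ChartedSpace (Coord n) M]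
    (u : M → ℝ) (x : M) : Coord n →L[ℝ] ℝ :=
  fderiv ℝ (u ∘ (chartAt (Coord n) x).symm) (chartAt (Coord n) x x)

lemma normGradSq_eq_gradInner (u : M → ℝ) (x : M) :
    normGradSq (n := n) u x = gradInner n u u x := gradSq_eq_gradIn _ _ _

lemma mem_overlap_chartAt (hx : x ∈ e.source) :
    chartAt (Coord n) x x ∈ overlap (chartAt (Coord n) x) e :=
  ⟨mem_chart_target _ x, by
    rw [mem_preimage, (chartAt (Coord n) x).left_inv (mem_chart_source _ x)]; exact hx⟩

lemma overlap_subset {e e' : OpenPartialHomeomorph M (Coord n)} : overlap e e' ⊆ e.target :=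
  inter_subset_left

lemma chart_symm_chartAt : e ((chartAt (Coord n) x).symm (chartAt (Coord n) x x)) = e x := by
  rw [(chartAt (Coord n) x).left_inv (mem_chart_source _ x)]

lemma scalarCurvature_eq (he : e ∈ atlas (Coord n) M) (hx : x ∈ e.source) :
    scalarCurvature (n := n) x = scal (metricInChart e) (e x) := by
  have := (isLocalIsom_transition (chart_mem_atlas (Coord n) x) he).scal_eq
    (isMetricOn_metricInChart (chart_mem_atlas _ x)) (isMetricOn_metricInChart he)
    overlap_subset (mem_overlap_chartAt hx)
  rwa [chart_symm_chartAt] at this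

lemma normE_eq (he : e ∈ atlas (Coord n) M) (hx : x ∈ e.source) :
    normE (n := n) x = normTracelessRic (metricInChart e) (e x) := by
  have := (isLocalIsom_transition (chart_mem_atlas (Coord n) x) he).normTracelessRic_eq
    (isMetricOn_metricInChart (chart_mem_atlas _ x)) (isMetricOn_metricInChart he)
    overlap_subset (mem_overlap_chartAt hx)
  rwa [chart_symm_chartAt] at this

lemma normW_eq (he : e ∈ atlas (Coord n) M) (hx : x ∈ e.source) :
    normW (n := n) x = normWeyl (metricInChart e) (e x) := by
  have := (isLocalIsom_transition (chart_mem_atlas (Coord n) x) he).normWeyl_eq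
    (isMetricOn_metricInChart (chart_mem_atlas _ x)) (isMetricOn_metricInChart he)
    overlap_subset (mem_overlap_chartAt hx)
  rwa [chart_symm_chartAt] at this

lemma contDiffAt_comp_symm (hu : ContMDiff (𝓡 n) 𝓘(ℝ, ℝ) ∞ u) (he : e ∈ atlas (Coord n) M)
    (hy : y ∈ e.target) : ContDiffAt ℝ ∞ (u ∘ e.symm) y :=
  contMDiffAt_iff_contDiffAt.1 ((hu _).comp y
    ((contMDiffOn_chart_symm he).contMDiffAt (e.open_target.mem_nhds hy)))

lemma contMDiff_of_chart (hu : ∀ e ∈ atlas (Coord n) M, ∀ y ∈ e.target,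
    ContDiffAt ℝ ∞ (u ∘ e.symm) y) : ContMDiff (𝓡 n) 𝓘(ℝ, ℝ) ∞ u := by
  intro x
  have hx := mem_chart_source (Coord n) x
  have h1 : ContMDiffAt (𝓡 n) 𝓘(ℝ, ℝ) ∞
      ((u ∘ (chartAt (Coord n) x).symm) ∘ chartAt (Coord n) x) x :=
    (hu _ (chart_mem_atlas _ x) _ (mem_chart_target _ x)).contMDiffAt.comp x
      ((contMDiffOn_chart (chart_mem_atlas _ x)).contMDiffAt
        ((chartAt (Coord n) x).open_source.mem_nhds hx))
  refine h1.congr_of_eventuallyEq ?_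
  exact Filter.eventually_of_mem ((chartAt (Coord n) x).open_source.mem_nhds hx) fun z hz => by
    simp only [Function.comp_apply, (chartAt (Coord n) x).left_inv hz]

lemma continuous_of_chart {u : M → ℝ} (hu : ∀ e ∈ atlas (Coord n) M, ∀ y ∈ e.target,
    ContinuousAt (u ∘ e.symm) y) : Continuous u := by
  rw [continuous_iff_continuousAt]
  intro x
  have hx := mem_chart_source (Coord n) x
  have h1 : ContinuousAt ((u ∘ (chartAt (Coord n) x).symm) ∘ chartAt (Coord n) x) x :=
    ContinuousAt.comp (hu _ (chart_mem_atlas _ x) _ (mem_chart_target _ x))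
      ((chartAt (Coord n) x).continuousAt hx)
  refine h1.congr ?_
  exact Filter.eventually_of_mem ((chartAt (Coord n) x).open_source.mem_nhds hx) fun z hz => by
    simp only [Function.comp_apply, (chartAt (Coord n) x).left_inv hz]

lemma gradInner_eq_of_diff {u v : M → ℝ} (he : e ∈ atlas (Coord n) M) (hx : x ∈ e.source)
    (hu : DifferentiableAt ℝ (u ∘ e.symm) (e x)) (hv : DifferentiableAt ℝ (v ∘ e.symm) (e x)) :
    gradInner n u v x = gradIn (metricInChart e) (u ∘ e.symm) (v ∘ e.symm) (e x) := by
  have hy := mem_overlap_chartAt hx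
  have h1 := (isLocalIsom_transition (chart_mem_atlas (Coord n) x) he).gradIn_eq
    (isMetricOn_metricInChart (chart_mem_atlas _ x))
    overlap_subset hy (F := u ∘ e.symm) (H := v ∘ e.symm)
    (by rwa [chart_symm_chartAt]) (by rwa [chart_symm_chartAt])
  rw [chart_symm_chartAt] at h1
  rw [← h1]
  have h2 : ∀ u : M → ℝ, u ∘ (chartAt (Coord n) x).symm =ᶠ[nhds (chartAt (Coord n) x x)]
      fun z => (u ∘ e.symm) (e ((chartAt (Coord n) x).symm z)) := fun u =>
    Filter.eventually_of_mem (isOpen_overlap.mem_nhds hy) fun z hz => by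
      simp only [Function.comp_apply, e.left_inv hz.2]
  exact gradIn_congr (h2 u) (h2 v)

lemma gradInner_eq (hu : ContMDiff (𝓡 n) 𝓘(ℝ, ℝ) ∞ u) (hv : ContMDiff (𝓡 n) 𝓘(ℝ, ℝ) ∞ v)
    (he : e ∈ atlas (Coord n) M) (hx : x ∈ e.source) :
    gradInner n u v x = gradIn (metricInChart e) (u ∘ e.symm) (v ∘ e.symm) (e x) :=
  gradInner_eq_of_diff he hx (contDiffAt_comp_symm hu he (e.map_source hx)).diff_infty
    (contDiffAt_comp_symm hv he (e.map_source hx)).diff_infty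

lemma contMDiff_normE_sq : ContMDiff (𝓡 n) 𝓘(ℝ, ℝ) ∞ (fun x : M => normE (n := n) x ^ 2) :=
  contMDiff_of_chart fun e he y hy =>
    ((isMetricOn_metricInChart he).contDiff_normSq hy).congr_of_eventuallyEq
      (Filter.eventually_of_mem (e.open_target.mem_nhds hy) fun z hz => by
        simp only [Function.comp_apply]
        rw [normE_eq he (e.map_target hz), e.right_inv hz])

lemma normE_nonneg (x : M) : 0 ≤ normE (n := n) x := Real.sqrt_nonneg _

lemma normW_nonneg (x : M) : 0 ≤ normW (n := n) x := Real.sqrt_nonneg _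

lemma continuous_normE : Continuous (fun x : M => normE (n := n) x) := by
  have := (contMDiff_normE_sq (n := n) (M := M)).continuous.sqrt
  simpa only [Real.sqrt_sq (normE_nonneg _)] using this

lemma continuous_normW : Continuous (fun x : M => normW (n := n) x) := by
  refine continuous_of_chart (n := n) fun e he y hy => ?_
  have h := isMetricOn_metricInChart he
  have h1 : ContinuousAt (normWeyl (metricInChart e)) y := by
    refine ContinuousAt.sqrt (ContDiffAt.continuousAt (n := ∞) (𝕜 := ℝ) ?_)
    exact ContDiffAt.sum fun i _ => ContDiffAt.sum fun j _ => ContDiffAt.sum fun k _ =>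
      ContDiffAt.sum fun l _ => ContDiffAt.sum fun a _ => ContDiffAt.sum fun b _ =>
      ContDiffAt.sum fun c _ => ContDiffAt.sum fun d _ =>
      (((((h.contDiff_inv hy i a).mul (h.contDiff_inv hy j b)).mul (h.contDiff_inv hy k c)).mul
        (h.contDiff_inv hy l d)).mul (h.contDiff_weyl hy i j k l)).mul (h.contDiff_weyl hy a b c d)
  refine h1.congr (Filter.eventually_of_mem (e.open_target.mem_nhds hy) fun z hz => ?_)
  simp only [Function.comp_apply]
  rw [normW_eq he (e.map_target hz), e.right_inv hz]

lemma continuous_gradInner (hu : ContMDiff (𝓡 n) 𝓘(ℝ, ℝ) ∞ u)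
    (hv : ContMDiff (𝓡 n) 𝓘(ℝ, ℝ) ∞ v) : Continuous (gradInner n u v) := by
  refine continuous_of_chart (n := n) fun e he y hy => ?_
  have h := isMetricOn_metricInChart he
  have h1 : ContDiffAt ℝ ∞ (gradIn (metricInChart e) (u ∘ e.symm) (v ∘ e.symm)) y :=
    ContDiffAt.sum fun i _ => ContDiffAt.sum fun j _ => (h.contDiff_inv hy i j).mul
      ((IsMetricOn.contDiff_pd (contDiffAt_comp_symm hu he hy) i).mul
        (IsMetricOn.contDiff_pd (contDiffAt_comp_symm hv he hy) j))
  refine h1.continuousAt.congr (Filter.eventually_of_mem (e.open_target.mem_nhds hy)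
    fun z hz => ?_)
  simp only [Function.comp_apply]
  rw [gradInner_eq hu hv he (e.map_target hz), e.right_inv hz]

/-- Harmonic curvature makes the scalar curvature constant. -/
lemma scalarCurvature_const [PreconnectedSpace M] (hM : HasHarmonicCurvature n M) (x x' : M) :
    scalarCurvature (n := n) x = scalarCurvature (n := n) x' := by
  have h1 : IsLocallyConstant (fun x : M => scalarCurvature (n := n) x) := by
    rw [IsLocallyConstant.iff_eventually_eq]
    intro x
    set e := chartAt (Coord n) x with hee
    have he : e ∈ atlas (Coord n) M := chart_mem_atlas _ x
    have h := isMetricOn_metricInChart he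
    obtain ⟨r, hr, hball⟩ := Metric.isOpen_iff.1 e.open_target (e x) (mem_chart_target _ x)
    have h2 : ∀ z ∈ Metric.ball (e x) r, scal (metricInChart e) z = scal (metricInChart e) (e x) :=
      fun z hz => (convex_ball (e x) r).is_const_of_fderivWithin_eq_zero
        (fun w hw => (h.contDiff_scal (hball hw)).diff_infty.differentiableWithinAt)
        (fun w hw => by
          rw [fderivWithin_of_isOpen Metric.isOpen_ball hw, h.fderiv_scal (hM e he) (hball hw)])
        hz (Metric.mem_ball_self hr)
    have h3 : e.source ∩ e ⁻¹' Metric.ball (e x) r ∈ nhds x :=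
      Filter.inter_mem (e.open_source.mem_nhds (mem_chart_source _ x))
        ((e.continuousAt (mem_chart_source _ x)).preimage_mem_nhds (Metric.ball_mem_nhds _ hr))
    refine Filter.eventually_of_mem h3 fun z hz => ?_
    rw [scalarCurvature_eq he hz.1, scalarCurvature_eq he (mem_chart_source _ x), h2 _ hz.2]
  exact h1.apply_eq_of_isPreconnected isPreconnected_univ (mem_univ x) (mem_univ x')

/-- A manifold with harmonic curvature and `E = 0` is Einstein. The constant is global because the
scalar curvature is. -/
lemma isEinstein_of_normE [PreconnectedSpace M] [Nonempty M] (hM : HasHarmonicCurvature n M)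
    (h0 : ∀ x : M, normE (n := n) x = 0) : IsEinstein n M := by
  obtain ⟨x₀⟩ := ‹Nonempty M›
  refine ⟨scalarCurvature (n := n) x₀ / n, fun e he y hy i j => ?_⟩
  have h := isMetricOn_metricInChart he
  obtain ⟨b, hb⟩ := h.exists_ortho hy
  have h1 := h.normTracelessRic_sq_eq hy hb
  have h2 := normE_eq he (e.map_target hy)
  rw [e.right_inv hy, h0] at h2
  have h3 := scalarCurvature_eq he (e.map_target hy)
  rw [e.right_inv hy, scalarCurvature_const hM _ x₀] at h3
  rw [← h2] at h1
  have h4 : ∀ p q, tracelessForm (metricInChart e) y (b p) (b q) = 0 := by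
    intro p q
    have h5 : ∑ p, ∑ q, tracelessForm (metricInChart e) y (b p) (b q) ^ 2 = 0 := by
      rw [← h1]; simp
    rw [Finset.sum_eq_zero_iff_of_nonneg
      (fun i _ => Finset.sum_nonneg fun j _ => sq_nonneg _)] at h5
    have h6 := h5 p (Finset.mem_univ _)
    rw [Finset.sum_eq_zero_iff_of_nonneg (fun j _ => sq_nonneg _)] at h6
    exact pow_eq_zero_iff two_ne_zero |>.1 (h6 q (Finset.mem_univ _))
  have h5 : ∀ u v, tracelessForm (metricInChart e) y u v = 0 := by
    intro u v
    have e1 := (tracelessForm_linear_left (G := metricInChart e) y v)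
    have e2 := fun u => (tracelessForm_linear_right (G := metricInChart e) y u)
    have e3 : ∀ p, e1.mk' _ (b p) = 0 := fun p => by
      have : (e2 (b p)).mk' _ = 0 := b.ext fun q => h4 p q
      exact DFunLike.congr_fun this v
    have e4 : e1.mk' _ = 0 := b.ext e3
    exact DFunLike.congr_fun e4 u
  have h6 := h.tracelessRic_std hy i j
  rw [h5, tracelessRic, sub_eq_zero] at h6
  rw [h6, ← h3]

/-! ### Calculus of gradients -/

/-- An orthonormal frame at `x` reduces identities between gradients to identities between
differentials. -/
lemma exists_frame (x : M) : ∃ b : Fin n → Coord n, ∀ u v : M → ℝ,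
    gradInner n u v x = ∑ a, chartDeriv n u x (b a) * chartDeriv n v x (b a) := by
  have h := isMetricOn_metricInChart (chart_mem_atlas (Coord n) x)
  obtain ⟨b, hb⟩ := h.exists_ortho (mem_chart_target _ x)
  exact ⟨b, fun u v => IsMetricOn.gradIn_eq_sum hb _ _⟩

lemma diff_comp_chartAt_of_contMDiffAt (hu : ContMDiffAt (𝓡 n) 𝓘(ℝ, ℝ) ∞ u x) :
    DifferentiableAt ℝ (u ∘ (chartAt (Coord n) x).symm) (chartAt (Coord n) x x) := by
  have hx := (chartAt (Coord n) x).left_inv (mem_chart_source _ x)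
  rw [← hx] at hu
  exact (contMDiffAt_iff_contDiffAt.1 (hu.comp _
    ((contMDiffOn_chart_symm (chart_mem_atlas _ x)).contMDiffAt
      ((chartAt (Coord n) x).open_target.mem_nhds (mem_chart_target _ x))))).diff_infty

lemma diff_comp_chartAt (hu : ContMDiff (𝓡 n) 𝓘(ℝ, ℝ) ∞ u) (x : M) :
    DifferentiableAt ℝ (u ∘ (chartAt (Coord n) x).symm) (chartAt (Coord n) x x) :=
  diff_comp_chartAt_of_contMDiffAt hu.contMDiffAt

lemma chartDeriv_mul_at (hu : ContMDiffAt (𝓡 n) 𝓘(ℝ, ℝ) ∞ u x)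
    (hv : ContMDiffAt (𝓡 n) 𝓘(ℝ, ℝ) ∞ v x) : chartDeriv n (fun z => u z * v z) x
      = u x • chartDeriv n v x + v x • chartDeriv n u x := by
  have := ((diff_comp_chartAt_of_contMDiffAt hu).hasFDerivAt.mul
    (diff_comp_chartAt_of_contMDiffAt hv).hasFDerivAt).fderiv
  simp only [Function.comp_apply, (chartAt (Coord n) x).left_inv (mem_chart_source _ x)] at this
  exact this

lemma chartDeriv_mul (hu : ContMDiff (𝓡 n) 𝓘(ℝ, ℝ) ∞ u) (hv : ContMDiff (𝓡 n) 𝓘(ℝ, ℝ) ∞ v)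
    (x : M) : chartDeriv n (fun z => u z * v z) x
      = u x • chartDeriv n v x + v x • chartDeriv n u x :=
  chartDeriv_mul_at hu.contMDiffAt hv.contMDiffAt

lemma chartDeriv_comp (hu : ContMDiff (𝓡 n) 𝓘(ℝ, ℝ) ∞ u) {F : ℝ → ℝ} {F' : ℝ} {x : M}
    (hF : HasDerivAt F F' (u x)) : chartDeriv n (fun z => F (u z)) x = F' • chartDeriv n u x := by
  have hx := (chartAt (Coord n) x).left_inv (mem_chart_source _ x)
  have h1 : HasDerivAt F F' ((u ∘ (chartAt (Coord n) x).symm) (chartAt (Coord n) x x)) := by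
    rwa [Function.comp_apply, hx]
  exact (h1.comp_hasFDerivAt _ (diff_comp_chartAt hu x).hasFDerivAt).fderiv

lemma chartDeriv_sum {ι : Type*} (s : Finset ι) {u : ι → M → ℝ}
    (hu : ∀ i ∈ s, ContMDiff (𝓡 n) 𝓘(ℝ, ℝ) ∞ (u i)) (x : M) :
    chartDeriv n (fun z => ∑ i ∈ s, u i z) x = ∑ i ∈ s, chartDeriv n (u i) x :=
  (HasFDerivAt.fun_sum fun i hi => (diff_comp_chartAt (hu i hi) x).hasFDerivAt).fderiv

lemma chartDeriv_congr (h : u =ᶠ[nhds x] v) : chartDeriv n u x = chartDeriv n v x := by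
  have hx := mem_chart_target (Coord n) x
  have h1 : Filter.Tendsto (chartAt (Coord n) x).symm (nhds (chartAt (Coord n) x x)) (nhds x) := by
    have := (chartAt (Coord n) x).continuousAt_symm hx
    rwa [ContinuousAt, (chartAt (Coord n) x).left_inv (mem_chart_source _ x)] at this
  exact Filter.EventuallyEq.fderiv_eq (h1.eventually h)

lemma gradInner_comm (u v : M → ℝ) (x : M) : gradInner n u v x = gradInner n v u x := by
  obtain ⟨b, hb⟩ := exists_frame (n := n) x
  rw [hb, hb]
  exact Finset.sum_congr rfl fun a _ => mul_comm _ _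

lemma gradInner_self_nonneg (u : M → ℝ) (x : M) : 0 ≤ gradInner n u u x := by
  obtain ⟨b, hb⟩ := exists_frame (n := n) x
  rw [hb]
  exact Finset.sum_nonneg fun a _ => mul_self_nonneg _

lemma gradInner_mul_left (hu : ContMDiff (𝓡 n) 𝓘(ℝ, ℝ) ∞ u) (hv : ContMDiff (𝓡 n) 𝓘(ℝ, ℝ) ∞ v)
    (w : M → ℝ) (x : M) : gradInner n (fun z => u z * v z) w x
      = u x * gradInner n v w x + v x * gradInner n u w x := by
  obtain ⟨b, hb⟩ := exists_frame (n := n) x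
  simp only [hb, chartDeriv_mul hu hv, Finset.mul_sum, ← Finset.sum_add_distrib]
  exact Finset.sum_congr rfl fun a _ => by
    simp only [add_apply, smul_apply, smul_eq_mul]; ring

lemma gradInner_comp_left (hu : ContMDiff (𝓡 n) 𝓘(ℝ, ℝ) ∞ u) {F : ℝ → ℝ} {F' : ℝ} {x : M}
    (hF : HasDerivAt F F' (u x)) (w : M → ℝ) :
    gradInner n (fun z => F (u z)) w x = F' * gradInner n u w x := by
  obtain ⟨b, hb⟩ := exists_frame (n := n) x
  simp only [hb, chartDeriv_comp hu hF, Finset.mul_sum]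
  exact Finset.sum_congr rfl fun a _ => by
    simp only [smul_apply, smul_eq_mul]; ring

lemma gradInner_sum_left {ι : Type*} (s : Finset ι) {u : ι → M → ℝ}
    (hu : ∀ i ∈ s, ContMDiff (𝓡 n) 𝓘(ℝ, ℝ) ∞ (u i)) (w : M → ℝ) (x : M) :
    gradInner n (fun z => ∑ i ∈ s, u i z) w x = ∑ i ∈ s, gradInner n (u i) w x := by
  obtain ⟨b, hb⟩ := exists_frame (n := n) x
  simp only [hb, chartDeriv_sum s hu, sum_apply, Finset.sum_mul]
  exact Finset.sum_comm

lemma gradInner_eq_zero (h : x ∉ tsupport u) (w : M → ℝ) : gradInner n u w x = 0 := by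
  have h1 : u =ᶠ[nhds x] fun _ => (0 : ℝ) := notMem_tsupport_iff_eventuallyEq.1 h
  obtain ⟨b, hb⟩ := exists_frame (n := n) x
  have h2 : chartDeriv n (fun _ : M => (0 : ℝ)) x = 0 := by
    rw [chartDeriv]; exact fderiv_const_apply 0
  rw [hb, chartDeriv_congr h1, h2]
  simp

lemma gradInner_sq_le (u v : M → ℝ) (x : M) :
    gradInner n u v x ^ 2 ≤ gradInner n u u x * gradInner n v v x := by
  obtain ⟨b, hb⟩ := exists_frame (n := n) x
  simp only [hb, ← sq]
  exact Finset.sum_mul_sq_le_sq_mul_sq _ _ _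

lemma abs_gradInner_le (u v : M → ℝ) (x : M) :
    |gradInner n u v x| ≤ √(gradInner n u u x) * √(gradInner n v v x) := by
  rw [← Real.sqrt_mul (gradInner_self_nonneg u x)]
  exact Real.abs_le_sqrt (gradInner_sq_le u v x)

end Invariants

/-! ### The Riemannian volume in a chart -/

/-- The change of the volume density under a local isometry. -/
lemma IsLocalIsom.sqrt_det_eq {n : ℕ} {U' O : Set (Coord n)}
    {G G' : Coord n → Matrix (Fin n) (Fin n) ℝ} {φ : Coord n → Coord n} {y : Coord n}
    (hφ : IsLocalIsom O U' (metricForm G) (metricForm G') φ) (hy : y ∈ O) :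
    √(G y).det = |(fderiv ℝ φ y).det| * √(G' (φ y)).det := by
  set J : Matrix (Fin n) (Fin n) ℝ :=
    LinearMap.toMatrix (stdBasis n) (stdBasis n) (fderiv ℝ φ y : Coord n →ₗ[ℝ] Coord n) with hJ
  have hJa : ∀ i k, fderiv ℝ φ y (stdVec i) k = J k i := by
    intro i k
    rw [hJ, LinearMap.toMatrix_apply, stdBasis_apply, ← stdBasis_coord]
    rfl
  have h1 : G y = J.transpose * G' (φ y) * J := by
    ext i j
    rw [← metricForm_std G, hφ.isom y hy, metricForm_apply]
    simp only [hJa, Matrix.mul_apply, Finset.sum_mul, Matrix.transpose_apply]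
    rw [Finset.sum_comm]
    exact Finset.sum_congr rfl fun a _ => Finset.sum_congr rfl fun c _ => by ring
  have h2 : J.det = (fderiv ℝ φ y).det := LinearMap.det_toMatrix _ _
  rw [h1, Matrix.det_mul, Matrix.det_mul, Matrix.det_transpose, h2,
    show (fderiv ℝ φ y).det * (G' (φ y)).det * (fderiv ℝ φ y).det
      = (fderiv ℝ φ y).det ^ 2 * (G' (φ y)).det by ring, Real.sqrt_mul (sq_nonneg _),
    Real.sqrt_sq_eq_abs]

section Volume

variable {n : ℕ} {M : Type*} [TopologicalSpace M] [ChartedSpace (Coord n) M]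
  [RiemannianBundle (fun x : M => TangentSpace (𝓡 n) x)] [IsManifold (𝓡 n) ∞ M]
  [IsContMDiffRiemannianBundle (𝓡 n) ∞ (Coord n) (fun x : M => TangentSpace (𝓡 n) x)]
  [SecondCountableTopology M] [Nonempty M] [MeasurableSpace M] [BorelSpace M]
  {e e' : OpenPartialHomeomorph M (Coord n)} {x : M} {y : Coord n} {u v w : M → ℝ}

/-- The volume density `√(det g_ij)` in a chart. -/
noncomputable def chartDensity (e : OpenPartialHomeomorph M (Coord n)) (y : Coord n) : ℝ≥0∞ :=
  ENNReal.ofReal √(metricInChart e y).det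

lemma measurableSet_chart_preimage (e : OpenPartialHomeomorph M (Coord n)) {B : Set M}
    (hB : MeasurableSet B) : MeasurableSet (e.target ∩ e.symm ⁻¹' B) := by
  classical
  obtain ⟨x₀⟩ := ‹Nonempty M›
  have h1 : Measurable (e.target.piecewise e.symm (fun _ => x₀)) :=
    e.continuousOn_symm.measurable_piecewise continuousOn_const e.open_target.measurableSet
  have h2 : e.target ∩ e.symm ⁻¹' B
      = e.target ∩ (e.target.piecewise e.symm (fun _ => x₀)) ⁻¹' B := by
    ext z
    simp only [mem_inter_iff, mem_preimage, and_congr_right_iff]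
    intro hz
    rw [piecewise_eq_of_mem _ _ _ hz]
  rw [h2]
  exact e.open_target.measurableSet.inter (h1 hB)

/-- The change of variables formula for the Riemannian volume densities of two charts. -/
lemma lintegral_chart_change (he : e ∈ atlas (Coord n) M) (he' : e' ∈ atlas (Coord n) M)
    {B : Set M} (hB : MeasurableSet B) (h1 : B ⊆ e.source) (h2 : B ⊆ e'.source) :
    ∫⁻ y in e.target ∩ e.symm ⁻¹' B, chartDensity e y
      = ∫⁻ y in e'.target ∩ e'.symm ⁻¹' B, chartDensity e' y := by
  have hφ := isLocalIsom_transition he he'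
  have hsub : e.target ∩ e.symm ⁻¹' B ⊆ overlap e e' := fun z hz => ⟨hz.1, h2 hz.2⟩
  have himg : (fun z => e' (e.symm z)) '' (e.target ∩ e.symm ⁻¹' B)
      = e'.target ∩ e'.symm ⁻¹' B := by
    ext z
    constructor
    · rintro ⟨w, hw, rfl⟩
      refine ⟨e'.map_source (h2 hw.2), ?_⟩
      rw [mem_preimage, e'.left_inv (h2 hw.2)]
      exact hw.2
    · intro hz
      refine ⟨e (e'.symm z), ⟨e.map_source (h1 hz.2), ?_⟩, ?_⟩
      · rw [mem_preimage, e.left_inv (h1 hz.2)]; exact hz.2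
      · simp only
        rw [e.left_inv (h1 hz.2), e'.right_inv hz.1]
  rw [← himg, lintegral_image_eq_lintegral_abs_det_fderiv_mul volume
    (measurableSet_chart_preimage e hB)
    (fun z hz => (hφ.contDiff z (hsub hz)).diff_infty.hasFDerivAt.hasFDerivWithinAt)]
  · refine setLIntegral_congr_fun (measurableSet_chart_preimage e hB) fun z hz => ?_
    simp only [chartDensity]
    rw [← ENNReal.ofReal_mul (abs_nonneg _), hφ.sqrt_det_eq (hsub hz)]
  · intro z hz w hw hzw
    have h3 : e.symm z = e.symm w := e'.injOn (h2 hz.2) (h2 hw.2) hzw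
    exact e.symm.injOn hz.1 hw.1 h3

lemma map_chart_apply (e : OpenPartialHomeomorph M (Coord n)) {T : Set (Coord n)}
    (hT : MeasurableSet T) (hTe : T ⊆ e.target) {A : Set M} (hA : MeasurableSet A) :
    (((volume.restrict T).withDensity (chartDensity e)).map e.symm) A
      = ∫⁻ y in T ∩ e.symm ⁻¹' A, chartDensity e y := by
  have hm : AEMeasurable e.symm ((volume.restrict T).withDensity (chartDensity e)) :=
    ((e.continuousOn_symm.mono hTe).aemeasurable hT).mono_ac (withDensity_absolutelyContinuous _ _)
  rw [Measure.map_apply_of_aemeasurable hm hA, withDensity_apply',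
    Measure.restrict_restrict' hT, inter_comm]

lemma riemannianVolume_apply {A : Set M} (hA : MeasurableSet A) :
    riemannianVolume n M A = ∑' k, ∫⁻ y in (chartAt (Coord n) (chartSeq n M k)).target ∩
      (chartAt (Coord n) (chartSeq n M k)).symm ⁻¹'
        (disjointed (fun j => (chartAt (Coord n) (chartSeq n M j)).source) k ∩ A),
      chartDensity (chartAt (Coord n) (chartSeq n M k)) y := by
  rw [riemannianVolume, Measure.sum_apply _ hA]
  refine tsum_congr fun k => ?_
  have hD : MeasurableSet (disjointed (fun j => (chartAt (Coord n) (chartSeq n M j)).source) k) :=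
    MeasurableSet.disjointed
      (fun j => (chartAt (Coord n) (chartSeq n M j)).open_source.measurableSet) k
  refine (map_chart_apply (chartAt (Coord n) (chartSeq n M k))
    (measurableSet_chart_preimage _ hD) inter_subset_left hA).trans ?_
  rw [preimage_inter, inter_assoc]

/-- In every chart the Riemannian volume has density `√(det g_ij)`. -/
theorem riemannianVolume_eq_of_subset (he : e ∈ atlas (Coord n) M) {A : Set M}
    (hA : MeasurableSet A) (hAe : A ⊆ e.source) :
    riemannianVolume n M A = ∫⁻ y in e.target ∩ e.symm ⁻¹' A, chartDensity e y := by
  set S : ℕ → Set M := fun j => (chartAt (Coord n) (chartSeq n M j)).source with hS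
  have hD : ∀ k, MeasurableSet (disjointed S k) := fun k =>
    MeasurableSet.disjointed
      (fun j => (chartAt (Coord n) (chartSeq n M j)).open_source.measurableSet) k
  have hU : ⋃ k, disjointed S k = univ := by
    rw [iUnion_disjointed]; exact (exists_seq_charts n M).choose_spec
  rw [riemannianVolume_apply hA]
  have h1 : e.target ∩ e.symm ⁻¹' A = ⋃ k, e.target ∩ e.symm ⁻¹' (disjointed S k ∩ A) := by
    rw [← inter_iUnion, ← preimage_iUnion, ← iUnion_inter, hU, univ_inter]
  rw [h1, lintegral_iUnion (fun k => measurableSet_chart_preimage e ((hD k).inter hA))]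
  · refine tsum_congr fun k => ?_
    exact lintegral_chart_change (chart_mem_atlas _ _) he ((hD k).inter hA)
      (fun z hz => disjointed_subset S k hz.1) (fun z hz => hAe hz.2)
  · intro i j hij
    refine Disjoint.mono inter_subset_right inter_subset_right ?_
    refine Disjoint.preimage _ ?_
    exact (disjoint_disjointed S hij).mono inter_subset_left inter_subset_left

/-- The Riemannian volume on a chart domain, as a push-forward. -/
theorem restrict_riemannianVolume (he : e ∈ atlas (Coord n) M) :
    (riemannianVolume n M).restrict e.source
      = ((volume.restrict e.target).withDensity (chartDensity e)).map e.symm := by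
  ext A hA
  rw [map_chart_apply e e.open_target.measurableSet Subset.rfl hA, Measure.restrict_apply hA,
    riemannianVolume_eq_of_subset he (hA.inter e.open_source.measurableSet) inter_subset_right]
  have : e.target ∩ e.symm ⁻¹' (A ∩ e.source) = e.target ∩ e.symm ⁻¹' A := by
    ext z
    simp only [mem_inter_iff, mem_preimage, and_congr_right_iff, and_iff_left_iff_imp]
    exact fun hz _ => e.map_target hz
  rw [this]

lemma continuousOn_sqrt_det (he : e ∈ atlas (Coord n) M) :
    ContinuousOn (fun y => √(metricInChart e y).det) e.target := fun _ hy =>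
  ((isMetricOn_metricInChart he).contDiff_sqrt_det hy).continuousAt.continuousWithinAt

/-- Integrals over a chart domain. -/
theorem integral_eq_chart (he : e ∈ atlas (Coord n) M) {F : M → ℝ} (hF : Continuous F)
    (h0 : ∀ x ∉ e.source, F x = 0) :
    ∫ x, F x ∂riemannianVolume n M
      = ∫ y in e.target, √(metricInChart e y).det * F (e.symm y) := by
  rw [← setIntegral_eq_integral_of_forall_compl_eq_zero (s := e.source) h0,
    restrict_riemannianVolume he]
  have hm : AEMeasurable e.symm ((volume.restrict e.target).withDensity (chartDensity e)) :=
    (e.continuousOn_symm.aemeasurable e.open_target.measurableSet).mono_ac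
      (withDensity_absolutelyContinuous _ _)
  have hd : AEMeasurable (chartDensity e) (volume.restrict e.target) :=
    ((continuousOn_sqrt_det he).aemeasurable e.open_target.measurableSet).ennreal_ofReal
  rw [integral_map hm hF.aestronglyMeasurable,
    integral_withDensity_eq_integral_toReal_smul₀ hd (by simp [chartDensity])]
  refine integral_congr_ae (Filter.Eventually.of_forall fun y => ?_)
  simp only [chartDensity, ENNReal.toReal_ofReal (Real.sqrt_nonneg _), smul_eq_mul]

/-- The density `√(det g_ij)` is continuous, hence locally bounded. -/
instance : IsLocallyFiniteMeasure (riemannianVolume n M) := by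
  refine ⟨fun x => ?_⟩
  set e := chartAt (Coord n) x with hee
  have he : e ∈ atlas (Coord n) M := chart_mem_atlas _ x
  have hx : x ∈ e.source := mem_chart_source _ x
  obtain ⟨r, hr, hball⟩ := Metric.nhds_basis_closedBall.mem_iff.1
    (e.open_target.mem_nhds (mem_chart_target (Coord n) x))
  obtain ⟨C, hC⟩ := (isCompact_closedBall (e x) r).exists_bound_of_continuousOn
    ((continuousOn_sqrt_det he).mono hball)
  have hop : IsOpen (e.source ∩ e ⁻¹' Metric.ball (e x) r) :=
    e.continuousOn.isOpen_inter_preimage e.open_source Metric.isOpen_ball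
  refine ⟨e.source ∩ e ⁻¹' Metric.ball (e x) r, hop.mem_nhds ⟨hx, Metric.mem_ball_self hr⟩, ?_⟩
  rw [riemannianVolume_eq_of_subset he hop.measurableSet inter_subset_left]
  have hsub : e.target ∩ e.symm ⁻¹' (e.source ∩ e ⁻¹' Metric.ball (e x) r)
      ⊆ Metric.closedBall (e x) r := by
    intro z hz
    have := hz.2.2
    rw [mem_preimage, e.right_inv hz.1] at this
    exact Metric.ball_subset_closedBall this
  calc _ ≤ ∫⁻ y in Metric.closedBall (e x) r, chartDensity e y := lintegral_mono_set hsub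
    _ ≤ ∫⁻ y in Metric.closedBall (e x) r, ENNReal.ofReal C :=
        setLIntegral_mono_ae' Metric.isClosed_closedBall.measurableSet
          (Filter.Eventually.of_forall fun y hy =>
            ENNReal.ofReal_le_ofReal ((le_abs_self _).trans (hC y hy)))
    _ < ⊤ := by
        rw [setLIntegral_const]
        exact ENNReal.mul_lt_top ENNReal.ofReal_lt_top measure_closedBall_lt_top

/-- The density `√(det g_ij)` is positive. -/
instance : (riemannianVolume n M).IsOpenPosMeasure := by
  refine ⟨fun V hV ⟨x, hx⟩ h0 => ?_⟩
  set e := chartAt (Coord n) x with hee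
  have he : e ∈ atlas (Coord n) M := chart_mem_atlas _ x
  have hxs : x ∈ e.source := mem_chart_source _ x
  have hop : IsOpen (V ∩ e.source) := hV.inter e.open_source
  have h1 : riemannianVolume n M (V ∩ e.source) = 0 := measure_mono_null inter_subset_left h0
  rw [riemannianVolume_eq_of_subset he hop.measurableSet inter_subset_right] at h1
  have hop' : IsOpen (e.target ∩ e.symm ⁻¹' (V ∩ e.source)) :=
    e.continuousOn_symm.isOpen_inter_preimage e.open_target hop
  have hne : (e.target ∩ e.symm ⁻¹' (V ∩ e.source)).Nonempty :=
    ⟨e x, e.map_source hxs, by rw [mem_preimage, e.left_inv hxs]; exact ⟨hx, hxs⟩⟩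
  have hd : AEMeasurable (chartDensity e)
      (volume.restrict (e.target ∩ e.symm ⁻¹' (V ∩ e.source))) :=
    (((continuousOn_sqrt_det he).mono inter_subset_left).aemeasurable
      hop'.measurableSet).ennreal_ofReal
  rw [lintegral_eq_zero_iff' hd, Filter.EventuallyEq, ae_restrict_iff' hop'.measurableSet] at h1
  have h2 : volume (e.target ∩ e.symm ⁻¹' (V ∩ e.source)) = 0 := by
    refine measure_mono_null (fun z hz => ?_) h1
    simp only [mem_compl_iff, mem_ofPred_eq, Classical.not_imp]
    refine ⟨hz, ?_⟩
    have := Real.sqrt_pos.2 ((isMetricOn_metricInChart he).posDef z hz.1).det_pos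
    simp [chartDensity, this]
  exact (hop'.measure_pos volume hne).ne' h2

end Volume

/-! ### The weak Bochner inequality -/

section Weak

variable {n : ℕ} {M : Type*} [TopologicalSpace M] [ChartedSpace (Coord n) M]
  [RiemannianBundle (fun x : M => TangentSpace (𝓡 n) x)] [IsManifold (𝓡 n) ∞ M]
  [IsContMDiffRiemannianBundle (𝓡 n) ∞ (Coord n) (fun x : M => TangentSpace (𝓡 n) x)]
  [SecondCountableTopology M] [T2Space M]
  {e e' : OpenPartialHomeomorph M (Coord n)} {x : M} {y : Coord n} {u v w : M → ℝ}

/-- A finite smooth partition of unity on a compact set by functions with compact support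
in chart domains. -/
theorem exists_finite_partition {K : Set M} (hK : IsCompact K) :
    ∃ (I : Finset M) (ρ : M → M → ℝ), (∀ i, ContMDiff (𝓡 n) 𝓘(ℝ, ℝ) ∞ (ρ i)) ∧
      (∀ i x, 0 ≤ ρ i x) ∧ (∀ i, tsupport (ρ i) ⊆ (chartAt (Coord n) i).source) ∧
      (∀ i, HasCompactSupport (ρ i)) ∧ (∀ x, ∑ i ∈ I, ρ i x ≤ 1) ∧
      ∀ x ∈ K, ∑ i ∈ I, ρ i x = 1 := by
  classical
  have : LocallyCompactSpace M := ChartedSpace.locallyCompactSpace (Coord n) M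
  have h1 : ∀ x : M, ∃ V : Set M, IsOpen V ∧ x ∈ V ∧ ∃ C : Set M, IsCompact C ∧ V ⊆ C ∧
      C ⊆ (chartAt (Coord n) x).source := by
    intro x
    obtain ⟨C, hC, hxC, hCs⟩ := exists_compact_subset (chartAt (Coord n) x).open_source
      (mem_chart_source (Coord n) x)
    exact ⟨interior C, isOpen_interior, hxC, C, hC, interior_subset, hCs⟩
  choose V hVo hxV C hC hVC hCs using h1
  obtain ⟨ρ, hρ⟩ := SmoothPartitionOfUnity.exists_isSubordinate (𝓡 n) (s := univ) isClosed_univ V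
    hVo (fun x _ => mem_iUnion.2 ⟨x, hxV x⟩)
  have hfin := ρ.locallyFinite.finite_nonempty_inter_compact hK
  refine ⟨hfin.toFinset, fun i => ρ i, fun i => (ρ i).contMDiff, fun i x => ρ.nonneg i x,
    fun i => (hρ i).trans ((hVC i).trans (hCs i)),
    fun i => (hC i).of_isClosed_subset (isClosed_tsupport _) ((hρ i).trans (hVC i)),
    fun x => ?_, fun x hx => ?_⟩
  · have hf : (Function.support fun i => ρ i x).Finite := ρ.locallyFinite.point_finite x
    calc ∑ i ∈ hfin.toFinset, ρ i x ≤ ∑ i ∈ hfin.toFinset ∪ hf.toFinset, ρ i x :=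
          Finset.sum_le_sum_of_subset_of_nonneg Finset.subset_union_left
            fun i _ _ => ρ.nonneg i x
      _ = ∑ᶠ i, ρ i x := (finsum_eq_sum_of_support_subset _ (by simp)).symm
      _ ≤ 1 := ρ.sum_le_one x
  · rw [← ρ.sum_eq_one (mem_univ x)]
    refine (finsum_eq_sum_of_support_subset _ fun i hi => ?_).symm
    rw [Finite.coe_toFinset]
    exact ⟨x, hi, hx⟩

lemma integrableOn_of_zero_off {U K : Set (Coord n)} (hU : MeasurableSet U) (hK : IsCompact K)
    (hKU : K ⊆ U) {F : Coord n → ℝ} (hF : ContinuousOn F U) (h0 : ∀ z ∈ U, z ∉ K → F z = 0) :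
    IntegrableOn F U :=
  ((hF.mono hKU).integrableOn_compact hK).of_forall_sdiff_eq_zero hU fun z hz => h0 z hz.1 hz.2

variable [Nonempty M] [MeasurableSpace M] [BorelSpace M]

lemma integrable_of_cont {F : M → ℝ} (hF : Continuous F) (hc : HasCompactSupport F) :
    Integrable F (riemannianVolume n M) := hF.integrable_of_hasCompactSupport hc

/-- `weak_laplacian` for test functions supported in one chart, by integration by parts there. -/
lemma weak_laplacian_chart {f L ψ : M → ℝ} (hf : ContMDiff (𝓡 n) 𝓘(ℝ, ℝ) ∞ f) (hL : Continuous L)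
    (hfL : ∀ e ∈ atlas (Coord n) M, ∀ y ∈ e.target,
      L (e.symm y) ≤ lap (metricInChart e) (f ∘ e.symm) y)
    (hψ : ContMDiff (𝓡 n) 𝓘(ℝ, ℝ) ∞ ψ) (hψ0 : ∀ x, 0 ≤ ψ x) (hψc : HasCompactSupport ψ)
    (he : e ∈ atlas (Coord n) M) (hψe : tsupport ψ ⊆ e.source) :
    ∫ x, (gradInner n ψ f x + ψ x * L x) ∂riemannianVolume n M ≤ 0 := by
  have h := isMetricOn_metricInChart he
  have hK : IsCompact (e '' tsupport ψ) := hψc.image_of_continuousOn (e.continuousOn.mono hψe)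
  have hKU : e '' tsupport ψ ⊆ e.target := by
    rintro _ ⟨z, hz, rfl⟩; exact e.map_source (hψe hz)
  have hoff : ∀ z ∈ e.target, z ∉ e '' tsupport ψ → e.symm z ∉ tsupport ψ := fun z hz hzK hm =>
    hzK ⟨_, hm, e.right_inv hz⟩
  -- `e.symm` is arbitrary off `e.target`, so the test function is cut off there
  set η : Coord n → ℝ := e.target.indicator (ψ ∘ e.symm) with hη
  have hηe : ∀ z ∈ e.target, η =ᶠ[nhds z] ψ ∘ e.symm := fun z hz =>
    Filter.eventually_of_mem (e.open_target.mem_nhds hz) fun w hw => indicator_of_mem hw _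
  have hηs : ∀ z ∈ e.target, ContDiffAt ℝ ∞ η z := fun z hz =>
    (contDiffAt_comp_symm hψ he hz).congr_of_eventuallyEq (hηe z hz)
  have hη0 : ∀ z ∉ e '' tsupport ψ, η z = 0 := by
    intro z hz
    by_cases hzt : z ∈ e.target
    · rw [(hηe z hzt).eq_of_nhds]
      exact image_eq_zero_of_notMem_tsupport (f := ψ) (hoff z hzt hz)
    · exact indicator_of_notMem hzt _
  have hfs : ∀ z ∈ e.target, ContDiffAt ℝ ∞ (f ∘ e.symm) z := fun z hz =>
    contDiffAt_comp_symm hf he hz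
  have hzero : ∀ x ∉ tsupport ψ, gradInner n ψ f x + ψ x * L x = 0 := fun x hx => by
    rw [gradInner_eq_zero hx, image_eq_zero_of_notMem_tsupport hx]; ring
  have hcont : Continuous fun x => gradInner n ψ f x + ψ x * L x :=
    (continuous_gradInner hψ hf).add (hψ.continuous.mul hL)
  rw [integral_eq_chart he hcont fun x hx => hzero x fun hm => hx (hψe hm),
    ← h.integral_parts hK hKU hfs hηs hη0]
  have hg : ∀ z ∈ e.target, gradInner n ψ f (e.symm z)
      = gradIn (metricInChart e) η (f ∘ e.symm) z := fun z hz => by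
    rw [gradInner_eq hψ hf he (e.map_target hz), e.right_inv hz]
    exact gradIn_congr (hηe z hz).symm Filter.EventuallyEq.rfl
  refine setIntegral_mono_on ?_ ?_ e.open_target.measurableSet fun z hz => ?_
  · refine integrableOn_of_zero_off e.open_target.measurableSet hK hKU
      ((continuousOn_sqrt_det he).mul (hcont.comp_continuousOn e.continuousOn_symm))
      fun z hz hzK => ?_
    rw [hzero _ (hoff z hz hzK), mul_zero]
  · refine integrableOn_of_zero_off e.open_target.measurableSet hK hKU (fun z hz => ?_)
      fun z hz hzK => ?_
    · refine ContDiffAt.continuousAt (𝕜 := ℝ) (n := ∞) ?_ |>.continuousWithinAt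
      have hlap : ContDiffAt ℝ ∞ (lap (metricInChart e) (f ∘ e.symm)) z := by
        refine ContDiffAt.sum fun i _ => ContDiffAt.sum fun j _ => (h.contDiff_inv hz i j).mul ?_
        refine ContDiffAt.sub ?_ ?_
        · exact ((((hfs z hz).fderiv_infty).clm_apply_const _).fderiv_infty).clm_apply_const _
        · exact (hfs z hz).fderiv_infty.clm_apply
            (((h.contDiff_conn hz).clm_apply_const _).clm_apply_const _)
      have hgr : ContDiffAt ℝ ∞ (gradIn (metricInChart e) η (f ∘ e.symm)) z :=
        ContDiffAt.sum fun i _ => ContDiffAt.sum fun j _ => (h.contDiff_inv hz i j).mul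
          ((IsMetricOn.contDiff_pd (hηs z hz) i).mul (IsMetricOn.contDiff_pd (hfs z hz) j))
      exact (h.contDiff_sqrt_det hz).mul (hgr.add ((hηs z hz).mul hlap))
    · rw [← hg z hz, hη0 z hzK, gradInner_eq_zero (hoff z hz hzK)]; ring
  · rw [hg z hz, (hηe z hz).eq_of_nhds]
    refine mul_le_mul_of_nonneg_left ?_ (Real.sqrt_nonneg _)
    exact add_le_add_right (mul_le_mul_of_nonneg_left (hfL e he z hz) (hψ0 _)) _

/-- A pointwise lower bound `L ≤ Δf` in the charts, integrated against a test function. -/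
theorem weak_laplacian {f L ψ : M → ℝ} (hf : ContMDiff (𝓡 n) 𝓘(ℝ, ℝ) ∞ f) (hL : Continuous L)
    (hfL : ∀ e ∈ atlas (Coord n) M, ∀ y ∈ e.target,
      L (e.symm y) ≤ lap (metricInChart e) (f ∘ e.symm) y)
    (hψ : ContMDiff (𝓡 n) 𝓘(ℝ, ℝ) ∞ ψ) (hψ0 : ∀ x, 0 ≤ ψ x) (hψc : HasCompactSupport ψ) :
    ∫ x, (gradInner n ψ f x + ψ x * L x) ∂riemannianVolume n M ≤ 0 := by
  obtain ⟨I, ρ, hρs, hρ0, hρe, hρc, -, hρ1⟩ := exists_finite_partition (n := n) hψc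
  have hs : ∀ i, ContMDiff (𝓡 n) 𝓘(ℝ, ℝ) ∞ (fun x => ρ i x * ψ x) := fun i => (hρs i).mul hψ
  have hcs : ∀ i, HasCompactSupport (fun x => ρ i x * ψ x) := fun i => hψc.mul_left
  have hsum : ψ = fun x => ∑ i ∈ I, ρ i x * ψ x := by
    ext x
    by_cases hx : x ∈ tsupport ψ
    · rw [← Finset.sum_mul, hρ1 x hx, one_mul]
    · simp [image_eq_zero_of_notMem_tsupport hx]
  have heq : ∀ x, gradInner n ψ f x + ψ x * L x
      = ∑ i ∈ I, (gradInner n (fun x => ρ i x * ψ x) f x + ρ i x * ψ x * L x) := by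
    intro x
    rw [Finset.sum_add_distrib, ← gradInner_sum_left I (fun i _ => hs i), ← Finset.sum_mul,
      ← hsum]
    rw [← congrFun hsum x]
  simp only [heq]
  rw [integral_finsetSum]
  · refine Finset.sum_nonpos fun i _ => ?_
    exact weak_laplacian_chart hf hL hfL (hs i) (fun x => mul_nonneg (hρ0 i x) (hψ0 x)) (hcs i)
      (chart_mem_atlas _ i) ((closure_mono (Function.support_mul_subset_left _ _)).trans (hρe i))
  · intro i _
    refine integrable_of_cont ((continuous_gradInner (hs i) hf).add
      ((hs i).continuous.mul hL)) ?_
    refine HasCompactSupport.intro (hcs i) fun x hx => ?_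
    rw [gradInner_eq_zero hx, image_eq_zero_of_notMem_tsupport (f := fun x => ρ i x * ψ x) hx]
    ring

/-- The weak Bochner inequality for `f = |E|²` on a manifold with harmonic curvature. By the
refined Kato inequality `|∇E|² ≥ (n + 2) / (4 n) |∇f|² / (f + ε)`, where `ε > 0` makes the bound
smooth across the zeros of `E`. -/
theorem weak_bochner (hM : HasHarmonicCurvature n M) (hn : 3 ≤ n) {ε R : ℝ} (hε : 0 < ε)
    (hR : ∀ x : M, scalarCurvature (n := n) x = R) {ψ : M → ℝ}
    (hψ : ContMDiff (𝓡 n) 𝓘(ℝ, ℝ) ∞ ψ) (hψ0 : ∀ x, 0 ≤ ψ x) (hψc : HasCompactSupport ψ) :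
    ∫ x, (gradInner n ψ (fun x => normE (n := n) x ^ 2) x + ψ x * (2 *
      (((n : ℝ) + 2) / (4 * n) * (gradInner n (fun x => normE (n := n) x ^ 2)
          (fun x => normE (n := n) x ^ 2) x / (normE (n := n) x ^ 2 + ε))
        - (normW (n := n) x + (n : ℝ) / (n - 2) * normE (n := n) x) * normE (n := n) x ^ 2
        + R / ((n : ℝ) - 1) * normE (n := n) x ^ 2))) ∂riemannianVolume n M ≤ 0 := by
  have hfs := contMDiff_normE_sq (n := n) (M := M)
  have hpos : ∀ x : M, 0 < normE (n := n) x ^ 2 + ε := fun x => by positivity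
  refine weak_laplacian hfs ?_ ?_ hψ hψ0 hψc
  · refine continuous_const.mul (((continuous_const.mul
      ((continuous_gradInner hfs hfs).div (hfs.continuous.add continuous_const)
        fun x => (hpos x).ne')).sub (((continuous_normW (n := n)).add
          (continuous_const.mul (continuous_normE (n := n)))).mul hfs.continuous)).add
            (continuous_const.mul hfs.continuous))
  · intro e he y hy
    have h := isMetricOn_metricInChart he
    have hx := e.map_target hy
    obtain ⟨b, hb⟩ := h.exists_ortho hy
    obtain ⟨N, hN0, hN1, hN2⟩ := h.bochner_chart (hM e he) hn hy hb
    have hfe : (fun x : M => normE (n := n) x ^ 2) ∘ e.symm =ᶠ[nhds y]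
        fun z => normTracelessRic (metricInChart e) z ^ 2 :=
      Filter.eventually_of_mem (e.open_target.mem_nhds hy) fun z hz => by
        simp only [Function.comp_apply]
        rw [normE_eq he (e.map_target hz), e.right_inv hz]
    have hE : normE (n := n) (e.symm y) = normTracelessRic (metricInChart e) y := by
      rw [normE_eq he hx, e.right_inv hy]
    have hW : normW (n := n) (e.symm y) = normWeyl (metricInChart e) y := by
      rw [normW_eq he hx, e.right_inv hy]
    have hS : scal (metricInChart e) y = R := by
      rw [← hR (e.symm y), scalarCurvature_eq he hx, e.right_inv hy]
    have hG : gradInner n (fun x : M => normE (n := n) x ^ 2) (fun x => normE (n := n) x ^ 2)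
        (e.symm y) = gradSq (metricInChart e)
          (fun z => normTracelessRic (metricInChart e) z ^ 2) y := by
      rw [gradInner_eq hfs hfs he hx, gradSq_eq_gradIn, e.right_inv hy]
      exact gradIn_congr hfe hfe
    have hLap : lap (metricInChart e) ((fun x : M => normE (n := n) x ^ 2) ∘ e.symm) y
        = ∑ k, hess (connForm (metricInChart e))
          (fun z => normTracelessRic (metricInChart e) z ^ 2) (b k) (b k) y := by
      rw [IsMetricOn.lap_eq_sum hb (contDiffAt_comp_symm hfs he hy)]
      refine Finset.sum_congr rfl fun k _ => ?_
      have h3 : ∀ v, (fun z => fderiv ℝ ((fun x : M => normE (n := n) x ^ 2) ∘ e.symm) z v)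
          =ᶠ[nhds y] fun z => fderiv ℝ (fun z => normTracelessRic (metricInChart e) z ^ 2) z v :=
        fun v => (hfe.fderiv (𝕜 := ℝ)).mono fun z hz => congrArg (fun T => T v) hz
      rw [hess, hess, (h3 (b k)).fderiv_eq, hfe.fderiv_eq]
    rw [hLap, hE, hW, hG]
    rw [hS] at hN2
    have hn0 : (0 : ℝ) < n := by exact_mod_cast (by omega : 0 < n)
    have hf0 : 0 ≤ normTracelessRic (metricInChart e) y ^ 2 := sq_nonneg _
    have h4 : ((n : ℝ) + 2) / (4 * n) * (gradSq (metricInChart e)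
        (fun z => normTracelessRic (metricInChart e) z ^ 2) y
          / (normTracelessRic (metricInChart e) y ^ 2 + ε)) ≤ N := by
      rw [div_mul_div_comm, div_le_iff₀ (by positivity)]
      nlinarith [mul_nonneg (mul_nonneg hn0.le hN0) hε.le]
    linarith

end Weak

/-! ### Compactness of closed balls -/

section HopfRinow

variable {M : Type*} [EMetricSpace M]

/-- In a complete locally compact space in which points at distance less than `a + b` have a
point between them, closed balls of finite radius are compact. As in the theorem of Hopf and Rinow,
the set of radii with compact ball is closed and open: a compact ball has a compact neighbourhood,
which contains a larger ball; and a ball is totally bounded if all smaller ones are compact, since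
its points are close to points of a smaller ball. -/
theorem isCompact_closedEBall_of_between [CompleteSpace M] [LocallyCompactSpace M]
    (hlen : ∀ x y : M, ∀ a b : ℝ≥0∞, 0 < b → edist x y < a + b → ∃ z, edist x z ≤ a ∧ edist z y < b)
    (x : M) (r : ℝ) : IsCompact (Metric.closedEBall x (ENNReal.ofReal r)) := by
  have hext : ∀ s : ℝ, 0 ≤ s → IsCompact (Metric.closedEBall x (ENNReal.ofReal s)) →
      ∃ δ > 0, IsCompact (Metric.closedEBall x (ENNReal.ofReal (s + δ))) := by
    intro s hs hc
    obtain ⟨N, hN, hsub⟩ := exists_compact_superset hc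
    obtain ⟨δ, hδ, hth⟩ := hc.exists_thickening_subset_open isOpen_interior hsub
    refine ⟨δ / 2, by positivity, hN.of_isClosed_subset Metric.isClosed_closedEBall ?_⟩
    intro y hy
    rw [Metric.mem_closedEBall, edist_comm] at hy
    have h1 : edist x y < ENNReal.ofReal s + ENNReal.ofReal δ := by
      rw [← ENNReal.ofReal_add hs hδ.le]
      exact hy.trans_lt ((ENNReal.ofReal_lt_ofReal_iff (by positivity)).2 (by linarith))
    obtain ⟨z, hz1, hz2⟩ := hlen x y _ _ (by simpa using by assumption) h1
    refine interior_subset (hth ?_)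
    rw [Metric.mem_thickening_iff_exists_edist_lt]
    exact ⟨z, by rwa [Metric.mem_closedEBall, edist_comm], by rwa [edist_comm]⟩
  have hlim : ∀ s : ℝ, 0 ≤ s → (∀ t, 0 ≤ t → t < s →
      IsCompact (Metric.closedEBall x (ENNReal.ofReal t))) →
      IsCompact (Metric.closedEBall x (ENNReal.ofReal s)) := by
    intro s hs hc
    rcases hs.eq_or_lt with rfl | hs
    · rw [ENNReal.ofReal_zero]
      have : Metric.closedEBall x 0 = {x} := by ext y; simp
      rw [this]; exact isCompact_singleton
    refine isCompact_iff_totallyBounded_isComplete.2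
      ⟨?_, Metric.isClosed_closedEBall.isComplete⟩
    rw [EMetric.totallyBounded_iff]
    intro ε hε
    obtain ⟨η, hη0, hη⟩ : ∃ η : ℝ, 0 < η ∧ ENNReal.ofReal (2 * η) < ε ∧ η < s := by
      obtain ⟨q, hq0, hq⟩ := ENNReal.lt_iff_exists_nnreal_btwn.1 hε
      have hq0' : (0 : ℝ) < q := by exact_mod_cast hq0
      refine ⟨min ((q : ℝ) / 2) (s / 2), by positivity, lt_of_le_of_lt ?_ hq,
        (min_le_right _ _).trans_lt (by linarith)⟩
      rw [← ENNReal.ofReal_coe_nnreal]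
      exact ENNReal.ofReal_le_ofReal (by linarith [min_le_left ((q : ℝ) / 2) (s / 2)])
    have hcs := (hc (s - η / 2) (by linarith) (by linarith)).totallyBounded
    obtain ⟨T, hT, hTc⟩ := EMetric.totallyBounded_iff.1 hcs (ENNReal.ofReal η) (by simpa using hη0)
    refine ⟨T, hT, fun y hy => ?_⟩
    rw [Metric.mem_closedEBall, edist_comm] at hy
    have h1 : edist x y < ENNReal.ofReal (s - η / 2) + ENNReal.ofReal η := by
      rw [← ENNReal.ofReal_add (by linarith) hη0.le]
      exact hy.trans_lt ((ENNReal.ofReal_lt_ofReal_iff (by linarith)).2 (by linarith))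
    obtain ⟨z, hz1, hz2⟩ := hlen x y _ _ (by simpa using by assumption) h1
    have hz3 := hTc (show z ∈ Metric.closedEBall x _ by rwa [Metric.mem_closedEBall, edist_comm])
    simp only [mem_iUnion, exists_prop, Metric.mem_eball] at hz3 ⊢
    obtain ⟨p, hp, hzp⟩ := hz3
    refine ⟨p, hp, lt_of_le_of_lt (edist_triangle y z p) (lt_trans ?_ hη.1)⟩
    rw [two_mul, ENNReal.ofReal_add hη0.le hη0.le]
    exact ENNReal.add_lt_add (by rwa [edist_comm]) hzp
  have hmono : ∀ s t : ℝ, s ≤ t → IsCompact (Metric.closedEBall x (ENNReal.ofReal t)) →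
      IsCompact (Metric.closedEBall x (ENNReal.ofReal s)) := fun s t hst ht =>
    ht.of_isClosed_subset Metric.isClosed_closedEBall
      (Metric.closedEBall_subset_closedEBall (ENNReal.ofReal_le_ofReal hst))
  rcases le_or_gt r 0 with hr | hr
  · exact hmono r 0 hr (hlim 0 le_rfl fun t ht ht' => absurd ht' (not_lt.2 ht))
  set T : Set ℝ := {s | 0 ≤ s ∧ s ≤ r ∧ IsCompact (Metric.closedEBall x (ENNReal.ofReal s))} with hT
  have h0T : (0 : ℝ) ∈ T :=
    ⟨le_rfl, hr.le, hlim 0 le_rfl fun t ht ht' => absurd ht' (not_lt.2 ht)⟩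
  have hbdd : BddAbove T := ⟨r, fun s hs => hs.2.1⟩
  have hs0 : 0 ≤ sSup T := le_csSup hbdd h0T
  have hc : IsCompact (Metric.closedEBall x (ENNReal.ofReal (sSup T))) := by
    refine hlim _ hs0 fun t ht hts => ?_
    obtain ⟨s, hs, hts'⟩ := exists_lt_of_lt_csSup ⟨0, h0T⟩ hts
    exact hmono t s hts'.le hs.2.2
  obtain ⟨δ, hδ, hcδ⟩ := hext _ hs0 hc
  by_contra hnr
  have hlt : sSup T + δ < r := by
    by_contra hge
    exact hnr (hmono r _ (not_lt.1 hge) hcδ)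
  have : sSup T + δ ≤ sSup T := le_csSup hbdd ⟨by linarith, hlt.le, hcδ⟩
  linarith

end HopfRinow

section Riemannian

variable {n : ℕ} {M : Type*} [EMetricSpace M] [ChartedSpace (Coord n) M]
  [RiemannianBundle (fun x : M => TangentSpace (𝓡 n) x)] [IsManifold (𝓡 n) ∞ M]
  [IsContMDiffRiemannianBundle (𝓡 n) ∞ (Coord n) (fun x : M => TangentSpace (𝓡 n) x)]
  [IsRiemannianManifold (𝓡 n) M]
  {e : OpenPartialHomeomorph M (Coord n)}

/-- Points of a Riemannian manifold at distance less than `a + b` have a point between them, on a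
curve of length less than `a + b`. -/
lemma exists_between_edist (n : ℕ) {M : Type*} [EMetricSpace M]
    [ChartedSpace (Coord n) M] [RiemannianBundle (fun x : M => TangentSpace (𝓡 n) x)]
    [IsManifold (𝓡 n) ∞ M] [IsRiemannianManifold (𝓡 n) M]
    (x y : M) (a b : ℝ≥0∞) (hb0 : 0 < b) (h : edist x y < a + b) :
    ∃ z : M, edist x z ≤ a ∧ edist z y < b := by
  rcases lt_or_ge (edist x y) a with hxa | hxa
  · exact ⟨y, hxa.le, by simpa using hb0⟩
  have hM := fun p q : M => (IsRiemannianManifold.out (I := 𝓡 n) p q)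
  rw [hM] at h
  obtain ⟨γ, h0, h1, hγ, hL⟩ := exists_lt_of_riemannianEDist_lt h
  have hcont : ContinuousOn (fun t => edist x (γ t)) (Icc 0 1) :=
    continuous_const.edist continuous_id |>.comp_continuousOn hγ.continuousOn
  have hmem : a ∈ Icc (edist x (γ 0)) (edist x (γ 1)) := by
    rw [h0, h1, edist_self]; exact ⟨by simp, hxa⟩
  obtain ⟨t, ht, hta⟩ := intermediate_value_Icc zero_le_one hcont hmem
  refine ⟨γ t, hta.le, ?_⟩
  have h2 : a ≤ pathELength (𝓡 n) γ 0 t := by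
    rw [← hta]
    change edist x (γ t) ≤ _
    rw [hM]
    exact riemannianEDist_le_pathELength (hγ.mono (Icc_subset_Icc le_rfl ht.2)) h0 rfl ht.1
  have h3 : edist (γ t) y ≤ pathELength (𝓡 n) γ t 1 := by
    rw [hM]
    exact riemannianEDist_le_pathELength (hγ.mono (Icc_subset_Icc ht.1 le_rfl)) rfl h1 ht.2
  have h4 := pathELength_add (I := 𝓡 n) (γ := γ) ht.1 ht.2
  rw [← h4] at hL
  have ha : a ≠ ⊤ := by
    rintro rfl
    rw [top_le_iff] at h2
    rw [h2] at hL; simp at hL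
  by_contra hb
  have : a + b ≤ pathELength (𝓡 n) γ 0 t + pathELength (𝓡 n) γ t 1 :=
    add_le_add h2 ((not_lt.1 hb).trans h3)
  exact absurd hL (not_lt.2 this)

/-- Closed balls of a complete Riemannian manifold are compact. -/
theorem isCompact_closedEBall (n : ℕ) {M : Type*} [EMetricSpace M]
    [ChartedSpace (Coord n) M] [RiemannianBundle (fun x : M => TangentSpace (𝓡 n) x)]
    [IsManifold (𝓡 n) ∞ M] [IsRiemannianManifold (𝓡 n) M]
    [CompleteSpace M] (x : M) (r : ℝ) :
    IsCompact (Metric.closedEBall x (ENNReal.ofReal r)) := by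
  have : LocallyCompactSpace M := ChartedSpace.locallyCompactSpace (Coord n) M
  exact isCompact_closedEBall_of_between (exists_between_edist n) x r

/-- In an extended metric space the points at finite distance from `x` form an open and closed
set. -/
lemma edist_ne_top_of_connected [PreconnectedSpace M] (x y : M) : edist x y ≠ ⊤ := by
  have h1 : IsClopen (Metric.eball x ⊤) := ⟨Metric.isClosed_eball_top, Metric.isOpen_eball⟩
  have h2 := h1.eq_univ ⟨x, Metric.mem_eball_self (by simp)⟩
  have h3 : y ∈ Metric.eball x ⊤ := h2 ▸ mem_univ y
  rw [Metric.mem_eball, edist_comm] at h3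
  exact h3.ne

/-- The length of a coordinate segment bounds the distance of its end points. -/
lemma edist_le_of_segment (he : e ∈ atlas (Coord n) M) {p q : Coord n} {C : ℝ}
    (hseg : ∀ t ∈ Icc (0 : ℝ) 1, AffineMap.lineMap p q t ∈ e.target)
    (hC : ∀ t ∈ Icc (0 : ℝ) 1,
      metricForm (metricInChart e) (AffineMap.lineMap p q t) (q - p) (q - p) ≤ C ^ 2)
    (hC0 : 0 ≤ C) : edist (e.symm p) (e.symm q) ≤ ENNReal.ofReal C := by
  rw [IsRiemannianManifold.out (I := 𝓡 n)]
  set η : ℝ → Coord n := fun t => AffineMap.lineMap p q t with hη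
  have hηd : ∀ t, HasDerivAt η (q - p) t := fun t => by
    simpa [hη] using AffineMap.hasDerivAt_lineMap (a := p) (b := q) (x := t)
  have hηs : ContDiff ℝ 1 η := by
    simp only [hη, AffineMap.lineMap_apply_module']
    fun_prop
  have h1 : ContMDiffOn 𝓘(ℝ, ℝ) (𝓡 n) 1 (e.symm ∘ η) (Icc 0 1) :=
    ((contMDiffOn_chart_symm he).of_le (by simp)).comp hηs.contMDiff.contMDiffOn hseg
  refine (riemannianEDist_le_pathELength h1 (by simp [hη]) (by simp [hη]) zero_le_one).trans ?_
  rw [pathELength_eq_lintegral_mfderiv_Icc]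
  have hbound : ∀ t ∈ Icc (0 : ℝ) 1,
      ‖mfderiv 𝓘(ℝ, ℝ) (𝓡 n) (e.symm ∘ η) t (1 : ℝ)‖ₑ ≤ ENNReal.ofReal C := by
    intro t ht
    have hd : MDifferentiableAt 𝓘(ℝ, ℝ) (𝓡 n) η t :=
      (hηd t).differentiableAt.mdifferentiableAt
    have h2 := mfderiv_comp t (mdiff_chart_symm he (hseg t ht)) hd
    have h3 : mfderiv 𝓘(ℝ, ℝ) (𝓡 n) (e.symm ∘ η) t (1 : ℝ)
        = mfderiv (𝓡 n) (𝓡 n) e.symm (η t) (q - p) := by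
      rw [h2, mfderiv_eq_fderiv]
      change mfderiv (𝓡 n) (𝓡 n) e.symm (η t) (fderiv ℝ η t 1) = _
      rw [fderiv_eq_smul_deriv, (hηd t).deriv, one_smul]
    rw [h3, ← ofReal_norm]
    refine ENNReal.ofReal_le_ofReal ?_
    refine le_of_sq_le_sq ?_ hC0
    rw [← real_inner_self_eq_norm_sq, ← metricForm_metricInChart]
    exact hC t ht
  calc _ ≤ ∫⁻ t in Icc (0 : ℝ) 1, ENNReal.ofReal C := setLIntegral_mono' measurableSet_Icc hbound
    _ = ENNReal.ofReal C := by simp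

end Riemannian

/-! ### Smoothing of Lipschitz functions -/

/-- Near each point of a compact set the metric is at most `4` times the metric at that point, with
a uniform radius. -/
lemma IsMetricOn.exists_comparison {n : ℕ} {U C : Set (Coord n)}
    {G : Coord n → Matrix (Fin n) (Fin n) ℝ} (h : IsMetricOn U G) (hC : IsCompact C)
    (hCU : C ⊆ U) : ∃ ε > 0, Metric.cthickening ε C ⊆ U ∧
      ∀ y ∈ C, ∀ z, dist z y < ε → ∀ v, metricForm G z v v ≤ 4 * metricForm G y v v := by
  obtain ⟨δ, hδ, hδU⟩ := hC.exists_cthickening_subset_open h.isOpen hCU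
  have hcont : ContinuousOn (metricForm G) U := fun y hy =>
    (h.contDiff_metricForm hy).continuousAt.continuousWithinAt
  have hc2 : ContinuousOn (fun p : Coord n × Coord n => metricForm G p.1 p.2 p.2)
      (C ×ˢ Metric.sphere 0 1) := by
    refine ContinuousOn.clm_apply (ContinuousOn.clm_apply ?_ continuousOn_snd) continuousOn_snd
    exact (hcont.mono hCU).comp continuousOn_fst fun p hp => hp.1
  obtain ⟨l, hl0, hl⟩ := (hC.prod (isCompact_sphere (0 : Coord n) 1)).exists_forall_le' hc2
    (a := 0) fun p hp => h.isLeviCivita.pos p.1 (hCU hp.1) p.2 fun h0 => by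
      have := hp.2; rw [h0] at this; simp at this
  have hlow : ∀ y ∈ C, ∀ v, l * ‖v‖ ^ 2 ≤ metricForm G y v v := by
    intro y hy v
    rcases eq_or_ne v 0 with rfl | hv
    · simp
    have h1 := hl (y, ‖v‖⁻¹ • v) ⟨hy, by simp [norm_smul, hv]⟩
    simp only [map_smul, smul_apply, smul_eq_mul] at h1
    have h2 := norm_pos_iff.2 hv
    calc l * ‖v‖ ^ 2 ≤ (‖v‖⁻¹ * (‖v‖⁻¹ * metricForm G y v v)) * ‖v‖ ^ 2 :=
          mul_le_mul_of_nonneg_right h1 (sq_nonneg _)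
      _ = metricForm G y v v := by field_simp
  have huc := (hC.cthickening (r := δ)).uniformContinuousOn_of_continuous (hcont.mono hδU)
  obtain ⟨η, hη, hηu⟩ := Metric.uniformContinuousOn_iff.1 huc (3 * l) (by positivity)
  refine ⟨min δ η, lt_min hδ hη, (Metric.cthickening_mono (min_le_left _ _) _).trans hδU,
    fun y hy z hz v => ?_⟩
  have h1 := hηu z (Metric.mem_cthickening_of_dist_le z y δ C hy (hz.le.trans (min_le_left _ _)))
    y (Metric.self_subset_cthickening _ hy) (hz.trans_le (min_le_right _ _))
  rw [dist_eq_norm] at h1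
  have h2 : ‖(metricForm G z - metricForm G y) v v‖ ≤ 3 * l * ‖v‖ * ‖v‖ :=
    ((metricForm G z - metricForm G y).le_opNorm₂ v v).trans (by gcongr)
  have h3 := (le_abs_self _).trans h2
  simp only [sub_apply] at h3
  nlinarith [hlow y hy v]

section Smoothing

variable {n : ℕ} {M : Type*} [EMetricSpace M] [ChartedSpace (Coord n) M]
  [RiemannianBundle (fun x : M => TangentSpace (𝓡 n) x)] [IsManifold (𝓡 n) ∞ M]
  [IsContMDiffRiemannianBundle (𝓡 n) ∞ (Coord n) (fun x : M => TangentSpace (𝓡 n) x)]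
  [IsRiemannianManifold (𝓡 n) M]
  {e : OpenPartialHomeomorph M (Coord n)}

/-- Mollification of a Lipschitz function in a chart: convolution with a bump function of small
support at most doubles the Lipschitz constant with respect to the Riemannian metric. -/
theorem exists_mollification (he : e ∈ atlas (Coord n) M) {C : Set (Coord n)} (hC : IsCompact C)
    (hCe : C ⊆ e.target) {u : M → ℝ} (huc : Continuous u) {L : ℝ} (hL : 0 ≤ L)
    (hu : ∀ x y : M, ∀ c : ℝ, 0 ≤ c → edist x y ≤ ENNReal.ofReal c → |u x - u y| ≤ L * c)
    {δ : ℝ} (hδ : 0 < δ) :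
    ∃ H : Coord n → ℝ, ContDiff ℝ ∞ H ∧ ∀ y ∈ C, |H y - u (e.symm y)| ≤ δ ∧
      gradSq (metricInChart e) H y ≤ (2 * L) ^ 2 := by
  have h := isMetricOn_metricInChart he
  obtain ⟨ε, hε, hεU, hcomp⟩ := h.exists_comparison hC hCe
  have hC' : IsCompact (Metric.cthickening ε C) := hC.cthickening
  have hug : ContinuousOn (u ∘ e.symm) (Metric.cthickening ε C) :=
    huc.comp_continuousOn (e.continuousOn_symm.mono hεU)
  obtain ⟨η, hη, hηu⟩ := Metric.uniformContinuousOn_iff.1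
    (hC'.uniformContinuousOn_of_continuous hug) δ hδ
  set r : ℝ := min ε η with hr
  have hr0 : 0 < r := lt_min hε hη
  set g : Coord n → ℝ := (Metric.cthickening ε C).indicator (u ∘ e.symm) with hg
  have hgi : Integrable g volume :=
    (integrable_indicator_iff Metric.isClosed_cthickening.measurableSet).2
      (hug.integrableOn_compact hC')
  let φ : ContDiffBump (0 : Coord n) := ⟨r / 4, r / 2, by positivity, by linarith⟩
  have hφo : φ.rOut = r / 2 := rfl
  set H : Coord n → ℝ :=
    convolution (φ.normed volume) g (ContinuousLinearMap.lsmul ℝ ℝ) volume with hH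
  have hHs : ContDiff ℝ ∞ H := φ.hasCompactSupport_normed.contDiff_convolution_left _
    φ.contDiff_normed hgi.locallyIntegrable
  have hin : ∀ y ∈ C, ∀ z, dist z y < ε → z ∈ Metric.cthickening ε C := fun y hy z hz =>
    Metric.mem_cthickening_of_dist_le z y ε C hy hz.le
  have hgv : ∀ y ∈ C, ∀ z, dist z y < ε → g z = u (e.symm z) := fun y hy z hz =>
    indicator_of_mem (hin y hy z hz) _
  -- the segment from `p` to `q` has length at most twice `|q - p|` in the metric at `y`
  have hlip : ∀ y ∈ C, ∀ p q, dist p y < ε → dist q y < ε →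
      |g q - g p| ≤ L * (2 * √(metricForm (metricInChart e) y (q - p) (q - p))) := by
    intro y hy p q hp hq
    rw [hgv y hy p hp, hgv y hy q hq]
    refine hu _ _ _ (by positivity) ?_
    rw [edist_comm]
    have hseg : ∀ t ∈ Icc (0 : ℝ) 1, dist (AffineMap.lineMap p q t) y < ε := fun t ht =>
      (convex_ball y ε).segment_subset (Metric.mem_ball.2 hp) (Metric.mem_ball.2 hq)
        (segment_eq_image_lineMap ℝ p q ▸ mem_image_of_mem _ ht)
    refine edist_le_of_segment he (fun t ht => hεU (hin y hy _ (hseg t ht))) (fun t ht => ?_)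
      (by positivity)
    rw [mul_pow, Real.sq_sqrt]
    · rw [show (2 : ℝ) ^ 2 = 4 by norm_num]
      exact hcomp y hy _ (hseg t ht) _
    · rcases eq_or_ne (q - p) 0 with h0 | h0
      · simp [h0]
      · exact (h.isLeviCivita.pos y (hCe hy) _ h0).le
  have hconv : ∀ z, Integrable (fun s => φ.normed volume s * g (z - s)) volume := fun z =>
    (HasCompactSupport.convolutionExists_left (ContinuousLinearMap.lsmul ℝ ℝ)
      φ.hasCompactSupport_normed φ.continuous_normed hgi.locallyIntegrable z)
  have hHdiff : ∀ y ∈ C, ∀ w, ‖w‖ < r / 2 →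
      |H (y + w) - H y| ≤ L * (2 * √(metricForm (metricInChart e) y w w)) := by
    intro y hy w hw
    have h1 : H (y + w) - H y
        = ∫ s, φ.normed volume s * (g (y + w - s) - g (y - s)) := by
      simp only [mul_sub]
      rw [integral_sub (hconv _) (hconv _)]
      rfl
    set c : ℝ := L * (2 * √(metricForm (metricInChart e) y w w)) with hc
    have h2 : ∀ s, ‖φ.normed volume s * (g (y + w - s) - g (y - s))‖
        ≤ φ.normed volume s * c := by
      intro s
      by_cases hs : s ∈ Metric.ball (0 : Coord n) (r / 2)
      · rw [mem_ball_zero_iff] at hs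
        rw [norm_mul, Real.norm_of_nonneg (φ.nonneg_normed s)]
        refine mul_le_mul_of_nonneg_left ?_ (φ.nonneg_normed s)
        have hre : r ≤ ε := min_le_left _ _
        have := hlip y hy (y - s) (y + w - s) (by rw [dist_eq_norm]; simp; linarith)
          (by
            rw [dist_eq_norm, show y + w - s - y = w - s by abel]
            exact (norm_sub_le _ _).trans_lt (by linarith))
        rwa [show y + w - s - (y - s) = w by abel] at this
      · have : φ.normed volume s = 0 := by
          rw [← Function.notMem_support, φ.support_normed_eq, hφo]
          exact hs
        simp [this]
    have h3 : Integrable (fun s => φ.normed volume s * c) volume :=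
      (φ.continuous_normed.integrable_of_hasCompactSupport φ.hasCompactSupport_normed).mul_const c
    have h4 := norm_integral_le_of_norm_le h3 (Filter.Eventually.of_forall h2)
    rw [h1]
    refine h4.trans_eq ?_
    rw [integral_mul_const, φ.integral_normed, one_mul]
  have hder : ∀ y ∈ C, ∀ v, fderiv ℝ H y v
      ≤ L * (2 * √(metricForm (metricInChart e) y v v)) := by
    intro y hy v
    have hl : HasDerivAt (fun t : ℝ => y + t • v) v 0 := by
      simpa using ((hasDerivAt_id (0 : ℝ)).smul_const v).const_add y
    have hd : HasDerivAt (fun t : ℝ => H (y + t • v)) (fderiv ℝ H y v) 0 := by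
      have hHd : HasFDerivAt H (fderiv ℝ H y) (y + (0 : ℝ) • v) := by
        rw [zero_smul, add_zero]; exact hHs.contDiffAt.diff_infty.hasFDerivAt
      exact hHd.comp_hasDerivAt 0 hl
    have hnb : ∀ᶠ t : ℝ in nhds 0, ‖t • v‖ < r / 2 := by
      have : Continuous fun t : ℝ => ‖t • v‖ := by fun_prop
      refine this.continuousAt.eventually_lt continuousAt_const ?_
      simp; positivity
    have hb := norm_deriv_le_of_lip' (f := fun t : ℝ => H (y + t • v)) (x₀ := 0)
      (C := L * (2 * √(metricForm (metricInChart e) y v v))) (by positivity) (by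
        filter_upwards [hnb] with t ht
        have h1 := hHdiff y hy (t • v) ht
        simp only [map_smul, smul_apply, smul_eq_mul] at h1
        rw [← mul_assoc t t, Real.sqrt_mul (mul_self_nonneg t), Real.sqrt_mul_self_eq_abs] at h1
        rw [Real.norm_eq_abs, zero_smul, add_zero, sub_zero, Real.norm_eq_abs]
        linarith)
    rw [hd.deriv] at hb
    exact (le_abs_self _).trans hb
  refine ⟨H, hHs, fun y hy => ⟨?_, ?_⟩⟩
  · have := ContDiffBump.dist_normed_convolution_le (φ := φ) (μ := volume) (x₀ := y) (ε := δ)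
      (g := g) hgi.aestronglyMeasurable (fun z hz => by
        rw [hφo, Metric.mem_ball] at hz
        have hze : dist z y < ε := hz.trans (by linarith [min_le_left ε η])
        have hy' : dist y y < ε := by simpa using hε
        rw [hgv y hy z hze, hgv y hy y hy']
        exact (hηu z (hin y hy z hze) y (hin y hy y hy')
          (hz.trans (by linarith [min_le_right ε η]))).le)
    rw [hgv y hy y (by simpa using hε), Real.dist_eq] at this
    exact this
  · -- apply the bound on `dH` to the gradient itself, for which `dH (∇H) = |∇H|²`
    have h1 := IsMetricOn.gradIn_eq_gradField (metricInChart e) H H y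
    have h2 := hder y hy (gradField (metricInChart e) H y)
    rw [h.metricForm_gradField (hCe hy), ← h1, ← gradSq_eq_gradIn] at h2
    have h3 : 0 ≤ gradSq (metricInChart e) H y := by
      obtain ⟨b, hb⟩ := h.exists_ortho (hCe hy)
      rw [IsMetricOn.gradSq_eq_sum hb]
      exact Finset.sum_nonneg fun a _ => sq_nonneg _
    have h4 := Real.sq_sqrt h3
    have h5 := Real.sqrt_nonneg (gradSq (metricInChart e) H y)
    rw [← h4] at h2 ⊢
    refine pow_le_pow_left₀ h5 ?_ 2
    rcases h5.eq_or_lt with h0 | h0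
    · rw [← h0]; positivity
    · rw [Real.sqrt_sq h5] at h2
      nlinarith

variable [SecondCountableTopology M]

/-- Smoothing of a compactly supported Lipschitz function: mollifications `h i` in charts are
glued by a partition of unity `ρ i`. In the gradient `∑ ρ i ∇(h i) + ∑ (h i - u) ∇(ρ i) + u ∑ ∇(ρ
i)` the first sum is bounded by `2 L`, the second by `L` if `h i` is close to `u`, and the last
one is zero. -/
theorem exists_smoothing {u : M → ℝ} (huc : Continuous u) (hus : HasCompactSupport u)
    {L : ℝ} (hL : 0 < L)
    (hu : ∀ x y : M, ∀ c : ℝ, 0 ≤ c → edist x y ≤ ENNReal.ofReal c → |u x - u y| ≤ L * c)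
    {δ : ℝ} (hδ : 0 < δ) :
    ∃ v : M → ℝ, ContMDiff (𝓡 n) 𝓘(ℝ, ℝ) ∞ v ∧ HasCompactSupport v ∧ (∀ x, |v x - u x| ≤ δ) ∧
      ∀ x, gradInner n v v x ≤ (3 * L) ^ 2 := by
  obtain ⟨I, ρ, hρs, hρ0, hρe, hρc, hρle, hρ1⟩ := exists_finite_partition (n := n) hus
  have hDc : Continuous fun x => ∑ i ∈ I, √(gradInner n (ρ i) (ρ i) x) :=
    continuous_finsetSum _ fun i _ => (continuous_gradInner (hρs i) (hρs i)).sqrt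
  have hKI : IsCompact (⋃ i ∈ I, tsupport (ρ i)) := I.isCompact_biUnion fun i _ => hρc i
  have hDK : ∃ D : ℝ, 0 < D ∧ ∀ x, ∑ i ∈ I, √(gradInner n (ρ i) (ρ i) x) ≤ D := by
    obtain ⟨D, hD⟩ := hKI.exists_bound_of_continuousOn hDc.continuousOn
    refine ⟨max D 1, by positivity, fun x => ?_⟩
    by_cases hx : x ∈ ⋃ i ∈ I, tsupport (ρ i)
    · exact (le_abs_self _).trans ((hD x hx).trans (le_max_left _ _))
    · refine le_trans (le_of_eq (Finset.sum_eq_zero fun i hi => ?_))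
        (zero_le_one.trans (le_max_right D 1))
      rw [gradInner_eq_zero fun hm => hx (mem_biUnion hi hm), Real.sqrt_zero]
  obtain ⟨D, hD0, hD⟩ := hDK
  -- the error of the mollifications makes `∑ |h i - u| |∇(ρ i)|` at most `L`
  set d : ℝ := min δ (L / D) with hd
  have hd0 : 0 < d := lt_min hδ (by positivity)
  have hmol : ∀ i : M, ∃ H : Coord n → ℝ, ContDiff ℝ ∞ H ∧
      ∀ y ∈ chartAt (Coord n) i '' tsupport (ρ i), |H y - u ((chartAt (Coord n) i).symm y)| ≤ d ∧
        gradSq (metricInChart (chartAt (Coord n) i)) H y ≤ (2 * L) ^ 2 := fun i =>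
    exists_mollification (chart_mem_atlas _ i)
      ((hρc i).image_of_continuousOn ((chartAt (Coord n) i).continuousOn.mono (hρe i)))
      (by rintro _ ⟨z, hz, rfl⟩; exact (chartAt (Coord n) i).map_source (hρe i hz)) huc hL.le hu hd0
  choose H hHs hH using hmol
  set h : M → M → ℝ := fun i x => H i (chartAt (Coord n) i x) with hh
  have hhs : ∀ i, ∀ x ∈ (chartAt (Coord n) i).source, ContMDiffAt (𝓡 n) 𝓘(ℝ, ℝ) ∞ (h i) x :=
    fun i x hx => (hHs i).contMDiff.contMDiffAt.comp x
      ((contMDiffOn_chart (chart_mem_atlas _ i)).contMDiffAt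
        ((chartAt (Coord n) i).open_source.mem_nhds hx))
  have hclose : ∀ i, ∀ x ∈ tsupport (ρ i), |h i x - u x| ≤ d := by
    intro i x hx
    have := (hH i _ (mem_image_of_mem _ hx)).1
    rwa [(chartAt (Coord n) i).left_inv (hρe i hx)] at this
  have hterm : ∀ i, ContMDiff (𝓡 n) 𝓘(ℝ, ℝ) ∞ (fun x => ρ i x * h i x) := by
    intro i x
    by_cases hx : x ∈ tsupport (ρ i)
    · exact (hρs i x).mul (hhs i x (hρe i hx))
    · refine (contMDiffAt_const (c := (0 : ℝ))).congr_of_eventuallyEq ?_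
      filter_upwards [notMem_tsupport_iff_eventuallyEq.1 hx] with z hz
      rw [hz]; simp
  have hu0 : ∀ x, u x * (∑ i ∈ I, ρ i x) = u x := by
    intro x
    by_cases hx : x ∈ tsupport u
    · rw [hρ1 x hx, mul_one]
    · rw [image_eq_zero_of_notMem_tsupport hx, zero_mul]
  refine ⟨fun x => ∑ i ∈ I, ρ i x * h i x, ?_, ?_, fun x => ?_, fun x => ?_⟩
  · exact contMDiff_finsetSum fun i _ => hterm i
  · refine HasCompactSupport.intro hKI fun x hx => Finset.sum_eq_zero fun i hi => ?_
    rw [image_eq_zero_of_notMem_tsupport fun hm => hx (mem_biUnion hi hm), zero_mul]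
  · have h1 : ∑ i ∈ I, ρ i x * h i x - u x = ∑ i ∈ I, ρ i x * (h i x - u x) := by
      simp only [mul_sub, Finset.sum_sub_distrib, ← Finset.sum_mul]
      rw [mul_comm _ (u x), hu0]
    rw [h1]
    calc |∑ i ∈ I, ρ i x * (h i x - u x)| ≤ ∑ i ∈ I, |ρ i x * (h i x - u x)| :=
          Finset.abs_sum_le_sum_abs _ _
      _ ≤ ∑ i ∈ I, ρ i x * d := by
          refine Finset.sum_le_sum fun i _ => ?_
          rw [abs_mul, abs_of_nonneg (hρ0 i x)]
          by_cases hx : x ∈ tsupport (ρ i)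
          · exact mul_le_mul_of_nonneg_left (hclose i x hx) (hρ0 i x)
          · rw [image_eq_zero_of_notMem_tsupport hx]; simp
      _ ≤ 1 * d := by
          rw [← Finset.sum_mul]
          exact mul_le_mul_of_nonneg_right (hρle x) hd0.le
      _ ≤ δ := by rw [one_mul]; exact min_le_left _ _
  · obtain ⟨b, hb⟩ := exists_frame (n := n) x
    -- the components of a differential in the orthonormal frame, so that norms are Euclidean
    let T : (Coord n →L[ℝ] ℝ) → EuclideanSpace ℝ (Fin n) := fun θ => WithLp.toLp 2 fun a => θ (b a)
    have hTadd : ∀ θ θ', T (θ + θ') = T θ + T θ' := fun θ θ' => by ext a; simp [T]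
    have hTsmul : ∀ (c : ℝ) θ, T (c • θ) = c • T θ := fun c θ => by ext a; simp [T]
    have hTsum : ∀ θ : M → (Coord n →L[ℝ] ℝ), T (∑ i ∈ I, θ i) = ∑ i ∈ I, T (θ i) := fun θ => by
      ext a; simp [T, sum_apply]
    have hTn : ∀ w : M → ℝ, ‖T (chartDeriv n w x)‖ = √(gradInner n w w x) := fun w => by
      rw [hb, EuclideanSpace.norm_eq]
      refine congrArg Real.sqrt (Finset.sum_congr rfl fun a _ => ?_)
      simp [T, sq]
    have hmulT : ∀ i ∈ I, T (chartDeriv n (fun x => ρ i x * h i x) x)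
        = (ρ i x • T (chartDeriv n (h i) x) + (h i x - u x) • T (chartDeriv n (ρ i) x))
          + u x • T (chartDeriv n (ρ i) x) := by
      intro i _
      by_cases hx : x ∈ tsupport (ρ i)
      · rw [chartDeriv_mul_at (hρs i x) (hhs i x (hρe i hx)), hTadd, hTsmul, hTsmul, sub_smul]
        abel
      · have hz := notMem_tsupport_iff_eventuallyEq.1 hx
        have h0 : chartDeriv n (fun _ : M => (0 : ℝ)) x = 0 := by
          rw [chartDeriv]; exact fderiv_const_apply 0
        have h1 : chartDeriv n (ρ i) x = 0 := by
          rw [chartDeriv_congr hz]; exact h0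
        have h2 : chartDeriv n (fun x => ρ i x * h i x) x = 0 := by
          rw [chartDeriv_congr (v := fun _ : M => (0 : ℝ)) (by
            filter_upwards [hz] with z hz'
            rw [hz']; simp)]
          exact h0
        have hT0 : T 0 = 0 := by ext a; simp [T]
        rw [h1, h2, hT0, image_eq_zero_of_notMem_tsupport hx]
        simp
    -- where `u ≠ 0` the functions `ρ i` sum to one
    have hlast : u x • ∑ i ∈ I, T (chartDeriv n (ρ i) x) = 0 := by
      by_cases hux : u x = 0
      · rw [hux, zero_smul]
      · have hnb : (fun z => ∑ i ∈ I, ρ i z) =ᶠ[nhds x] fun _ => (1 : ℝ) := by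
          filter_upwards [huc.isOpen_support.mem_nhds hux] with z hz
          exact hρ1 z (subset_tsupport _ hz)
        have h1 : chartDeriv n (fun z => ∑ i ∈ I, ρ i z) x = 0 := by
          rw [chartDeriv_congr hnb, chartDeriv]; exact fderiv_const_apply 1
        rw [chartDeriv_sum I fun i _ => hρs i] at h1
        rw [← hTsum, h1]
        ext a; simp [T]
    have hgr : ∀ i ∈ I, x ∈ tsupport (ρ i) → ‖T (chartDeriv n (h i) x)‖ ≤ 2 * L := by
      intro i _ hx
      have hxs := hρe i hx
      have hev : h i ∘ (chartAt (Coord n) i).symm =ᶠ[nhds (chartAt (Coord n) i x)] H i := by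
        filter_upwards [(chartAt (Coord n) i).open_target.mem_nhds
          ((chartAt (Coord n) i).map_source hxs)] with z hz
        simp only [hh, Function.comp_apply, (chartAt (Coord n) i).right_inv hz]
      have hdf : DifferentiableAt ℝ (h i ∘ (chartAt (Coord n) i).symm) (chartAt (Coord n) i x) :=
        ((hHs i).contDiffAt.diff_infty).congr_of_eventuallyEq hev
      rw [hTn, gradInner_eq_of_diff (chart_mem_atlas _ i) hxs hdf hdf, gradIn_congr hev hev,
        ← gradSq_eq_gradIn]
      rw [Real.sqrt_le_left (by positivity)]
      exact (hH i _ (mem_image_of_mem _ hx)).2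
    have hfin : ‖T (chartDeriv n (fun x => ∑ i ∈ I, ρ i x * h i x) x)‖ ≤ 3 * L := by
      rw [chartDeriv_sum I fun i _ => hterm i, hTsum, Finset.sum_congr rfl hmulT,
        Finset.sum_add_distrib, ← Finset.smul_sum, hlast, add_zero]
      calc _ ≤ ∑ i ∈ I, (ρ i x * (2 * L) + d * √(gradInner n (ρ i) (ρ i) x)) := by
            refine norm_sum_le_of_le _ fun i hi => ?_
            by_cases hx : x ∈ tsupport (ρ i)
            · refine (norm_add_le _ _).trans (add_le_add ?_ ?_)
              · rw [norm_smul, Real.norm_of_nonneg (hρ0 i x)]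
                exact mul_le_mul_of_nonneg_left (hgr i hi hx) (hρ0 i x)
              · rw [norm_smul, hTn]
                exact mul_le_mul_of_nonneg_right (hclose i x hx) (Real.sqrt_nonneg _)
            · have h1 : ‖T (chartDeriv n (ρ i) x)‖ = 0 := by
                rw [hTn, gradInner_eq_zero hx, Real.sqrt_zero]
              rw [norm_eq_zero.1 h1, image_eq_zero_of_notMem_tsupport hx, gradInner_eq_zero hx]
              simp
        _ = (∑ i ∈ I, ρ i x) * (2 * L) + d * ∑ i ∈ I, √(gradInner n (ρ i) (ρ i) x) := by
            rw [Finset.sum_add_distrib, Finset.sum_mul, Finset.mul_sum]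
        _ ≤ 1 * (2 * L) + L / D * D := by
            gcongr
            · exact hρle x
            · exact min_le_right _ _
            · exact hD x
        _ = 3 * L := by field_simp; ring
    rw [hTn] at hfin
    exact (Real.sqrt_le_left (by positivity)).1 hfin

/-- Cutoff functions with small gradient on a complete connected Riemannian manifold. The function
`2 - d / R` of the distance `d` to a point, truncated to `[0, 1]`, is compactly supported and has
Lipschitz constant `1 / R`. Its smoothing `v` is only approximately `1` on `K`, and only
approximately between `0` and `1`; composing with a smooth step function corrects this. -/
theorem exists_cutoff [CompleteSpace M] [ConnectedSpace M] {K : Set M} (hK : IsCompact K) {δ : ℝ}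
    (hδ : 0 < δ) :
    ∃ φ : M → ℝ, ContMDiff (𝓡 n) 𝓘(ℝ, ℝ) ∞ φ ∧ HasCompactSupport φ ∧ (∀ x, 0 ≤ φ x) ∧
      (∀ x, φ x ≤ 1) ∧ (∀ x ∈ K, φ x = 1) ∧ ∀ x, gradInner n φ φ x ≤ δ ^ 2 := by
  obtain ⟨x₀⟩ : Nonempty M := inferInstance
  have hfin := fun x y : M => edist_ne_top_of_connected x y
  -- a step from `0` at `t = 0` to `1` for `t ≥ 1 / 2`, the largest error allowed in the smoothing
  set s : ℝ → ℝ := fun t => Real.smoothTransition (2 * t) with hs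
  have hss : ContDiff ℝ ∞ s := Real.smoothTransition.contDiff.comp (contDiff_const.mul contDiff_id)
  obtain ⟨S, hS⟩ := (isCompact_Icc (a := (-1 : ℝ)) (b := 2)).exists_bound_of_continuousOn
    (hss.continuous_deriv (by simp)).continuousOn
  set d : M → ℝ := fun x => (edist x₀ x).toReal with hd
  have hdc : Continuous d :=
    ENNReal.continuousOn_toReal.comp_continuous (continuous_const.edist continuous_id)
      fun x => hfin x₀ x
  have hdl : ∀ x y : M, ∀ c : ℝ, 0 ≤ c → edist x y ≤ ENNReal.ofReal c → |d x - d y| ≤ c := by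
    have key : ∀ x y : M, ∀ c : ℝ, 0 ≤ c → edist x y ≤ ENNReal.ofReal c → d x ≤ d y + c := by
      intro x y c hc hxy
      have h1 : edist x₀ x ≤ edist x₀ y + ENNReal.ofReal c :=
        (edist_triangle x₀ y x).trans (add_le_add le_rfl (by rwa [edist_comm]))
      have h2 := ENNReal.toReal_mono (ENNReal.add_ne_top.2 ⟨hfin _ _, ENNReal.ofReal_ne_top⟩) h1
      rwa [ENNReal.toReal_add (hfin _ _) ENNReal.ofReal_ne_top, ENNReal.toReal_ofReal hc] at h2
    intro x y c hc hxy
    rw [abs_le]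
    exact ⟨by linarith [key y x c hc (by rwa [edist_comm])], by linarith [key x y c hc hxy]⟩
  obtain ⟨B, hB⟩ := hK.exists_bound_of_continuousOn hdc.continuousOn
  -- `K` lies in the ball of radius `R`, and the gradient is at most `3 (|S| + 1) / R ≤ δ`
  set R : ℝ := max (max B 1) (3 * (|S| + 1) / δ) with hR
  have hR1 : 1 ≤ R := (le_max_right B 1).trans (le_max_left _ _)
  have hR0 : 0 < R := by linarith
  have hRB : B ≤ R := (le_max_left B 1).trans (le_max_left _ _)
  have hRS : 3 * (|S| + 1) / δ ≤ R := le_max_right _ _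
  set u : M → ℝ := fun x => max 0 (min 1 (2 - d x / R)) with hu
  have huc : Continuous u := by fun_prop
  have hu0 : ∀ x, 0 ≤ u x := fun x => le_max_left _ _
  have hu1 : ∀ x, u x ≤ 1 := fun x => max_le zero_le_one (min_le_left _ _)
  have hus : HasCompactSupport u := by
    refine HasCompactSupport.intro (isCompact_closedEBall n x₀ (2 * R)) fun x hx => ?_
    rw [Metric.mem_closedEBall, edist_comm, not_le,
      ENNReal.ofReal_lt_iff_lt_toReal (by positivity) (hfin _ _)] at hx
    refine max_eq_left ((min_le_right _ _).trans ?_)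
    rw [sub_nonpos, le_div_iff₀ hR0]
    exact hx.le
  have hul : ∀ x y : M, ∀ c : ℝ, 0 ≤ c → edist x y ≤ ENNReal.ofReal c →
      |u x - u y| ≤ 1 / R * c := by
    intro x y c hc hxy
    have h1 : |u x - u y| ≤ |(2 - d x / R) - (2 - d y / R)| := by
      have h2 := abs_max_sub_max_le_max 0 (min 1 (2 - d x / R)) 0 (min 1 (2 - d y / R))
      have h3 := abs_min_sub_min_le_max 1 (2 - d x / R) 1 (2 - d y / R)
      rw [sub_self, abs_zero] at h2 h3
      exact (h2.trans (max_eq_right (abs_nonneg _)).le).trans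
        (h3.trans (max_eq_right (abs_nonneg _)).le)
    refine h1.trans ?_
    rw [show (2 - d x / R) - (2 - d y / R) = (1 / R) * (d y - d x) by ring, abs_mul,
      abs_of_pos (by positivity : 0 < 1 / R), abs_sub_comm]
    exact mul_le_mul_of_nonneg_left (hdl x y c hc hxy) (by positivity)
  obtain ⟨v, hvs, hvc, hvu, hvg⟩ := exists_smoothing (n := n) huc hus (L := 1 / R) (by positivity)
    hul (δ := 1 / 2) (by norm_num)
  have hφs : ContMDiff (𝓡 n) 𝓘(ℝ, ℝ) ∞ (fun x => s (v x)) := hss.contMDiff.comp hvs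
  refine ⟨fun x => s (v x), hφs, ?_,
    fun x => Real.smoothTransition.nonneg _, fun x => Real.smoothTransition.le_one _,
    fun x hx => ?_, fun x => ?_⟩
  · exact hvc.comp_left (g := s) (by simp [hs])
  · refine Real.smoothTransition.one_of_one_le ?_
    have h1 : u x = 1 := by
      have hdx : d x ≤ R := ((le_abs_self _).trans (hB x hx)).trans hRB
      have : d x / R ≤ 1 := (div_le_one hR0).2 hdx
      simp only [hu]
      rw [min_eq_left (by linarith), max_eq_right zero_le_one]
    have h2 := (abs_le.1 (hvu x)).1
    rw [h1] at h2
    linarith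
  · have hds : HasDerivAt s (deriv s (v x)) (v x) :=
      (hss.differentiable (by simp)).differentiableAt.hasDerivAt
    rw [gradInner_comp_left hvs hds, gradInner_comm, gradInner_comp_left hvs hds]
    have hSb : |deriv s (v x)| ≤ |S| + 1 := by
      have h2 := abs_le.1 (hvu x)
      refine (hS (v x) ⟨by linarith [hu0 x], by linarith [hu1 x]⟩).trans ?_
      linarith [le_abs_self S]
    have hq : 3 * (1 / R) * (|S| + 1) ≤ δ := by
      rw [div_le_iff₀ hδ] at hRS
      rw [show 3 * (1 / R) * (|S| + 1) = 3 * (|S| + 1) / R by ring, div_le_iff₀ hR0]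
      linarith
    calc deriv s (v x) * (deriv s (v x) * gradInner n v v x)
        = |deriv s (v x)| ^ 2 * gradInner n v v x := by rw [sq_abs]; ring
      _ ≤ (|S| + 1) ^ 2 * (3 * (1 / R)) ^ 2 := by
          exact mul_le_mul (pow_le_pow_left₀ (abs_nonneg _) hSb 2) (hvg x)
            (gradInner_self_nonneg v x) (by positivity)
      _ = (3 * (1 / R) * (|S| + 1)) ^ 2 := by ring
      _ ≤ δ ^ 2 := by gcongr

end Smoothing

/-! ### Integral estimates -/

section Estimates

variable {n : ℕ} {M : Type*} [TopologicalSpace M] [ChartedSpace (Coord n) M]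
  [RiemannianBundle (fun x : M => TangentSpace (𝓡 n) x)] [IsManifold (𝓡 n) ∞ M]
  [IsContMDiffRiemannianBundle (𝓡 n) ∞ (Coord n) (fun x : M => TangentSpace (𝓡 n) x)]
  {f V φ : M → ℝ} {ε : ℝ} {x : M}

lemma contMDiff_rpow (hf : ContMDiff (𝓡 n) 𝓘(ℝ, ℝ) ∞ f) (hpos : ∀ x, 0 < f x + ε) (s : ℝ) :
    ContMDiff (𝓡 n) 𝓘(ℝ, ℝ) ∞ (fun x => (f x + ε) ^ s) := by
  intro x
  have h1 : ContDiffAt ℝ ∞ (fun t : ℝ => (t + ε) ^ s) (f x) :=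
    (contDiffAt_id.add contDiffAt_const).rpow_const_of_ne (hpos x).ne'
  exact h1.contMDiffAt.comp x (hf x)

lemma gradInner_rpow (hf : ContMDiff (𝓡 n) 𝓘(ℝ, ℝ) ∞ f) (hpos : ∀ x, 0 < f x + ε) (s : ℝ)
    (v : M → ℝ) (x : M) : gradInner n (fun x => (f x + ε) ^ s) v x
      = s * (f x + ε) ^ (s - 1) * gradInner n f v x := by
  have h1 : HasDerivAt (fun t : ℝ => (t + ε) ^ s) (s * (f x + ε) ^ (s - 1)) (f x) := by
    have := ((hasDerivAt_id (f x)).add_const ε).rpow_const (p := s) (Or.inl (hpos x).ne')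
    simpa using this
  exact gradInner_comp_left hf h1 v

lemma gradInner_mul_self {u v : M → ℝ} (hu : ContMDiff (𝓡 n) 𝓘(ℝ, ℝ) ∞ u)
    (hv : ContMDiff (𝓡 n) 𝓘(ℝ, ℝ) ∞ v) (x : M) :
    gradInner n (fun z => u z * v z) (fun z => u z * v z) x
      = u x ^ 2 * gradInner n v v x + 2 * (u x * v x * gradInner n u v x)
        + gradInner n u u x * v x ^ 2 := by
  rw [gradInner_mul_left hu hv, gradInner_comm v, gradInner_comm u,
    gradInner_mul_left hu hv, gradInner_mul_left hu hv, gradInner_comm v u]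
  ring

/-- The arithmetic of `test_pointwise`, with `t = f + ε`, `s = t ^ (n / 8 - 1)`, `F = f`,
`G = |∇f|²` and `g = ⟨∇φ, ∇f⟩`. Replacing `F` by `t` in the zeroth order terms costs the error with
`ε`; the coefficient of `G` is `(n / 4 - 1) / 2 + (n + 2) / (4 n) = (n² - 2 n + 4) / (8 n)`. -/
lemma test_algebra {N R v φ s t ε F G g K : ℝ} (hN : 4 ≤ N) (ht0 : 0 < t) (hF : F = t - ε)
    (hv : 0 ≤ v) (hε : 0 < ε) (hle : s ^ 2 * t ≤ K) :
    8 * (N ^ 2 - 2 * N + 4) / N ^ 3 * (φ ^ 2 * ((N / 8) ^ 2 * s ^ 2 * G))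
      + 8 / N * (φ * (s * t) * (N / 8 * s * g)) - v * (φ * (s * t)) ^ 2
      + R / (N - 1) * (φ * (s * t)) ^ 2 - ε * (|R| / (N - 1)) * (φ ^ 2 * K)
    ≤ 1 / 2 * (φ * φ * ((N / 4 - 1) * s ^ 2 * G) + s ^ 2 * t * (2 * φ * g)
        + φ * φ * (s ^ 2 * t) * (2 * ((N + 2) / (4 * N) * (G / t) - v * F
            + R / (N - 1) * F))) := by
  have hn0 : (0 : ℝ) < N := by linarith
  have hn1 : (0 : ℝ) < N - 1 := by linarith
  have key : 1 / 2 * (φ * φ * ((N / 4 - 1) * s ^ 2 * G) + s ^ 2 * t * (2 * φ * g)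
        + φ * φ * (s ^ 2 * t) * (2 * ((N + 2) / (4 * N) * (G / t) - v * F
            + R / (N - 1) * F)))
      = 8 * (N ^ 2 - 2 * N + 4) / N ^ 3 * (φ ^ 2 * ((N / 8) ^ 2 * s ^ 2 * G))
        + 8 / N * (φ * (s * t) * (N / 8 * s * g)) - v * (φ * (s * t)) ^ 2
        + R / (N - 1) * (φ * (s * t)) ^ 2
        + ε * (φ ^ 2 * (s ^ 2 * t) * (v - R / (N - 1))) := by
    subst hF
    generalize R / (N - 1) = r
    field_simp
    ring
  rw [key]
  have h1 : R / (N - 1) ≤ |R| / (N - 1) := by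
    gcongr; exact le_abs_self R
  have h2 : 0 ≤ φ ^ 2 * (s ^ 2 * t) := by positivity
  have h3 : φ ^ 2 * (s ^ 2 * t) ≤ φ ^ 2 * K := mul_le_mul_of_nonneg_left hle (sq_nonneg _)
  have h4 : 0 ≤ |R| / (N - 1) := by positivity
  generalize R / (N - 1) = r at *
  generalize |R| / (N - 1) = r' at *
  have h5 : -(r' * (φ ^ 2 * K)) ≤ φ ^ 2 * (s ^ 2 * t) * (v - r) := by
    have := mul_nonneg h2 hv
    have := mul_le_mul_of_nonneg_left h1 h2
    have := mul_le_mul_of_nonneg_left h3 h4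
    linarith
  have := mul_le_mul_of_nonneg_left h5 hε.le
  linarith

/-- The pointwise form of the Bochner inequality tested with `φ² (f + ε)^{n/4-1}`, written in terms
of `w = (f + ε)^{n/8}`. -/
lemma test_pointwise (hn : 4 ≤ n) (hf : ContMDiff (𝓡 n) 𝓘(ℝ, ℝ) ∞ f)
    (hf0 : ∀ x, 0 ≤ f x) (hV0 : ∀ x, 0 ≤ V x) (hε : 0 < ε) (hε1 : ε ≤ 1)
    (hφ : ContMDiff (𝓡 n) 𝓘(ℝ, ℝ) ∞ φ) (R : ℝ) (x : M) :
    8 * ((n : ℝ) ^ 2 - 2 * n + 4) / (n : ℝ) ^ 3 *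
        (φ x ^ 2 * gradInner n (fun x => (f x + ε) ^ ((n : ℝ) / 8))
          (fun x => (f x + ε) ^ ((n : ℝ) / 8)) x)
      + 8 / n * (φ x * (f x + ε) ^ ((n : ℝ) / 8) *
          gradInner n φ (fun x => (f x + ε) ^ ((n : ℝ) / 8)) x)
      - V x * (φ x * (f x + ε) ^ ((n : ℝ) / 8)) ^ 2
      + R / ((n : ℝ) - 1) * (φ x * (f x + ε) ^ ((n : ℝ) / 8)) ^ 2
      - ε * (|R| / ((n : ℝ) - 1)) * (φ x ^ 2 * (f x + 1) ^ ((n : ℝ) / 4 - 1))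
    ≤ 1 / 2 * (gradInner n (fun x => φ x * φ x * (f x + ε) ^ ((n : ℝ) / 4 - 1)) f x
        + φ x * φ x * (f x + ε) ^ ((n : ℝ) / 4 - 1) * (2 *
          (((n : ℝ) + 2) / (4 * n) * (gradInner n f f x / (f x + ε)) - V x * f x
            + R / ((n : ℝ) - 1) * f x))) := by
  have hpos : ∀ x, 0 < f x + ε := fun x => by linarith [hf0 x]
  have hn4 : (4 : ℝ) ≤ n := by exact_mod_cast hn
  have hn0 : (0 : ℝ) < n := by linarith
  have hn1 : (0 : ℝ) < (n : ℝ) - 1 := by linarith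
  set t := f x + ε with ht
  have ht0 : 0 < t := hpos x
  set s := t ^ ((n : ℝ) / 8 - 1) with hs
  have e1 : t ^ ((n : ℝ) / 8) = s * t := by
    rw [hs, Real.rpow_sub_one ht0.ne', div_mul_cancel₀ _ ht0.ne']
  have e3 : t ^ ((n : ℝ) / 4 - 1 - 1) = s ^ 2 := by
    rw [hs, sq, ← Real.rpow_add ht0]; congr 1; ring
  have e2 : t ^ ((n : ℝ) / 4 - 1) = s ^ 2 * t := by
    rw [← e3, Real.rpow_sub_one ht0.ne' ((n : ℝ) / 4 - 1), div_mul_cancel₀ _ ht0.ne']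
  have hle : s ^ 2 * t ≤ (f x + 1) ^ ((n : ℝ) / 4 - 1) := by
    rw [← e2]
    exact Real.rpow_le_rpow ht0.le (by linarith) (by linarith)
  have hg1 : gradInner n (fun x => (f x + ε) ^ ((n : ℝ) / 8))
      (fun x => (f x + ε) ^ ((n : ℝ) / 8)) x = ((n : ℝ) / 8) ^ 2 * s ^ 2 * gradInner n f f x := by
    rw [gradInner_rpow hf hpos, gradInner_comm, gradInner_rpow hf hpos]
    ring
  have hg2 : gradInner n φ (fun x => (f x + ε) ^ ((n : ℝ) / 8)) x
      = (n : ℝ) / 8 * s * gradInner n φ f x := by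
    rw [gradInner_comm, gradInner_rpow hf hpos, gradInner_comm f]
  have hg3 : gradInner n (fun x => φ x * φ x * (f x + ε) ^ ((n : ℝ) / 4 - 1)) f x
      = φ x * φ x * (((n : ℝ) / 4 - 1) * s ^ 2 * gradInner n f f x)
        + s ^ 2 * t * (2 * φ x * gradInner n φ f x) := by
    have hφφ : ContMDiff (𝓡 n) 𝓘(ℝ, ℝ) ∞ (fun x => φ x * φ x) := hφ.mul hφ
    rw [gradInner_mul_left hφφ (contMDiff_rpow hf hpos _), gradInner_rpow hf hpos,
      gradInner_mul_left hφ hφ, e2, e3]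
    ring
  rw [hg1, hg2, hg3, e1, e2]
  exact test_algebra hn4 ht0 (by rw [ht]; ring) (hV0 x) hε hle

/-- Young's inequality for the cross term. -/
lemma abs_cross_le {u w : M → ℝ} {τ : ℝ} (hτ : 0 < τ) (x : M) :
    |u x * w x * gradInner n u w x| ≤ τ / 2 * (u x ^ 2 * gradInner n w w x)
      + 1 / (2 * τ) * (gradInner n u u x * w x ^ 2) := by
  have h1 := abs_gradInner_le (n := n) u w x
  have hu := Real.sq_sqrt (gradInner_self_nonneg (n := n) u x)
  have hw := Real.sq_sqrt (gradInner_self_nonneg (n := n) w x)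
  set p := √(gradInner n u u x)
  set q := √(gradInner n w w x)
  rw [← hu, ← hw, abs_mul, abs_mul]
  have h2 : |u x| * |w x| * |gradInner n u w x| ≤ |u x| * |w x| * (p * q) :=
    mul_le_mul_of_nonneg_left h1 (by positivity)
  refine h2.trans ?_
  have h3 : 0 ≤ (τ * (|u x| * q) - p * |w x|) ^ 2 / (2 * τ) := by positivity
  have h4 : (τ * (|u x| * q) - p * |w x|) ^ 2 / (2 * τ)
      = τ / 2 * (|u x| ^ 2 * q ^ 2) + 1 / (2 * τ) * (p ^ 2 * |w x| ^ 2)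
        - |u x| * |w x| * (p * q) := by field_simp; ring
  rw [← sq_abs (u x), ← sq_abs (w x)]
  linarith

variable [SecondCountableTopology M] [T2Space M] [Nonempty M] [MeasurableSpace M] [BorelSpace M]

/-- The integrated form of `test_pointwise`. -/
lemma test_integral (hn : 4 ≤ n) (hf : ContMDiff (𝓡 n) 𝓘(ℝ, ℝ) ∞ f)
    (hf0 : ∀ x, 0 ≤ f x) (hV : Continuous V) (hV0 : ∀ x, 0 ≤ V x) (hε : 0 < ε) (hε1 : ε ≤ 1)
    (hφ : ContMDiff (𝓡 n) 𝓘(ℝ, ℝ) ∞ φ) (hφc : HasCompactSupport φ) {R : ℝ}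
    (hweak : ∀ ψ : M → ℝ, ContMDiff (𝓡 n) 𝓘(ℝ, ℝ) ∞ ψ → (∀ x, 0 ≤ ψ x) → HasCompactSupport ψ →
      ∫ x, (gradInner n ψ f x + ψ x * (2 * (((n : ℝ) + 2) / (4 * n) *
        (gradInner n f f x / (f x + ε)) - V x * f x + R / ((n : ℝ) - 1) * f x)))
          ∂riemannianVolume n M ≤ 0) {w : M → ℝ} (hw : w = fun x => (f x + ε) ^ ((n : ℝ) / 8)) :
    8 * ((n : ℝ) ^ 2 - 2 * n + 4) / (n : ℝ) ^ 3 *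
        ∫ x, φ x ^ 2 * gradInner n w w x ∂riemannianVolume n M
      + 8 / n * ∫ x, φ x * w x * gradInner n φ w x ∂riemannianVolume n M
      - ∫ x, V x * (φ x * w x) ^ 2 ∂riemannianVolume n M
      + R / ((n : ℝ) - 1) * ∫ x, (φ x * w x) ^ 2 ∂riemannianVolume n M
    ≤ ε * (|R| / ((n : ℝ) - 1)) *
        ∫ x, φ x ^ 2 * (f x + 1) ^ ((n : ℝ) / 4 - 1) ∂riemannianVolume n M := by
  have hpos : ∀ x, 0 < f x + ε := fun x => by linarith [hf0 x]
  have hpos1 : ∀ x, 0 < f x + 1 := fun x => by linarith [hf0 x]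
  have hws : ContMDiff (𝓡 n) 𝓘(ℝ, ℝ) ∞ w := hw ▸ contMDiff_rpow hf hpos _
  have hcs : ∀ {F : M → ℝ}, (∀ x, φ x = 0 → F x = 0) → HasCompactSupport F := fun {F} h =>
    hφc.mono' ((Function.support_subset_iff'.2 fun x hx =>
      h x (Function.notMem_support.1 fun hm => hx (subset_tsupport _ hm))))
  have i1 : Integrable (fun x => φ x ^ 2 * gradInner n w w x) (riemannianVolume n M) :=
    integrable_of_cont ((hφ.continuous.pow 2).mul (continuous_gradInner hws hws))
      (hcs fun x hx => by simp [hx])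
  have i2 : Integrable (fun x => φ x * w x * gradInner n φ w x) (riemannianVolume n M) :=
    integrable_of_cont ((hφ.continuous.mul hws.continuous).mul (continuous_gradInner hφ hws))
      (hcs fun x hx => by simp [hx])
  have i3 : Integrable (fun x => V x * (φ x * w x) ^ 2) (riemannianVolume n M) :=
    integrable_of_cont (hV.mul ((hφ.continuous.mul hws.continuous).pow 2))
      (hcs fun x hx => by simp [hx])
  have i4 : Integrable (fun x => (φ x * w x) ^ 2) (riemannianVolume n M) :=
    integrable_of_cont ((hφ.continuous.mul hws.continuous).pow 2) (hcs fun x hx => by simp [hx])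
  have i5 : Integrable (fun x => φ x ^ 2 * (f x + 1) ^ ((n : ℝ) / 4 - 1)) (riemannianVolume n M) :=
    integrable_of_cont ((hφ.continuous.pow 2).mul (contMDiff_rpow (n := n) hf hpos1 _).continuous)
      (hcs fun x hx => by simp [hx])
  have hψs : ContMDiff (𝓡 n) 𝓘(ℝ, ℝ) ∞ (fun x => φ x * φ x * (f x + ε) ^ ((n : ℝ) / 4 - 1)) :=
    (hφ.mul hφ).mul (contMDiff_rpow hf hpos _)
  have hψc : HasCompactSupport (fun x => φ x * φ x * (f x + ε) ^ ((n : ℝ) / 4 - 1)) :=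
    hcs fun x hx => by simp [hx]
  have hwk := hweak _ hψs (fun x => mul_nonneg (mul_self_nonneg _) (Real.rpow_nonneg (hpos x).le _))
    hψc
  have i6 : Integrable (fun x =>
      gradInner n (fun x => φ x * φ x * (f x + ε) ^ ((n : ℝ) / 4 - 1)) f x
        + φ x * φ x * (f x + ε) ^ ((n : ℝ) / 4 - 1) * (2 *
          (((n : ℝ) + 2) / (4 * n) * (gradInner n f f x / (f x + ε)) - V x * f x
            + R / ((n : ℝ) - 1) * f x))) (riemannianVolume n M) := by
    refine integrable_of_cont ((continuous_gradInner hψs hf).add (hψs.continuous.mul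
      (continuous_const.mul (((continuous_const.mul ((continuous_gradInner hf hf).div
        (hf.continuous.add continuous_const) fun x => (hpos x).ne')).sub
          (hV.mul hf.continuous)).add (continuous_const.mul hf.continuous)))))
      (HasCompactSupport.intro hψc fun x hx => ?_)
    rw [gradInner_eq_zero hx]
    have h0 : φ x * φ x * (f x + ε) ^ ((n : ℝ) / 4 - 1) = 0 :=
      image_eq_zero_of_notMem_tsupport
        (f := fun x => φ x * φ x * (f x + ε) ^ ((n : ℝ) / 4 - 1)) hx
    rw [h0]; ring
  have hint := integral_mono (((((i1.const_mul (8 * ((n : ℝ) ^ 2 - 2 * n + 4) / (n : ℝ) ^ 3)).add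
    (i2.const_mul (8 / (n : ℝ)))).sub i3).add (i4.const_mul (R / ((n : ℝ) - 1)))).sub
      (i5.const_mul (ε * (|R| / ((n : ℝ) - 1))))) (i6.const_mul (1 / 2)) (fun x => by
        have := test_pointwise hn hf hf0 hV0 hε hε1 hφ R x
        rw [← hw] at this
        simpa only [Pi.add_apply, Pi.sub_apply, hw] using this)
  rw [integral_const_mul] at hint
  have hsplit := integral_sub' ((((i1.const_mul (8 * ((n : ℝ) ^ 2 - 2 * n + 4) / (n : ℝ) ^ 3)).add
    (i2.const_mul (8 / (n : ℝ)))).sub i3).add (i4.const_mul (R / ((n : ℝ) - 1))))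
      (i5.const_mul (ε * (|R| / ((n : ℝ) - 1))))
  rw [hsplit, integral_add' (((i1.const_mul _).add (i2.const_mul _)).sub i3) (i4.const_mul _),
    integral_sub' ((i1.const_mul _).add (i2.const_mul _)) i3,
    integral_add' (i1.const_mul _) (i2.const_mul _), integral_const_mul, integral_const_mul,
    integral_const_mul, integral_const_mul] at hint
  linarith

/-- The Sobolev inequality for `φ w`, with `|∇(φ w)|²` expanded. -/
lemma sobolev_integral {Λ R : ℝ} (hΛ : 0 < Λ)
    (hQ : (Λ : EReal) ≤ sobolevConstant n M) (hR : ∀ x : M, scalarCurvature (n := n) x = R)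
    {w : M → ℝ} (hw : ContMDiff (𝓡 n) 𝓘(ℝ, ℝ) ∞ w) (hφ : ContMDiff (𝓡 n) 𝓘(ℝ, ℝ) ∞ φ)
    (hφc : HasCompactSupport φ) (hne : ∃ x, φ x * w x ≠ 0) :
    Λ * (∫ x, |φ x * w x| ^ (2 * (n : ℝ) / ((n : ℝ) - 2)) ∂riemannianVolume n M)
        ^ (((n : ℝ) - 2) / (n : ℝ))
      ≤ ∫ x, φ x ^ 2 * gradInner n w w x ∂riemannianVolume n M
        + 2 * ∫ x, φ x * w x * gradInner n φ w x ∂riemannianVolume n M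
        + ∫ x, gradInner n φ φ x * w x ^ 2 ∂riemannianVolume n M
        + ((n : ℝ) - 2) / (4 * ((n : ℝ) - 1)) * R *
          ∫ x, (φ x * w x) ^ 2 ∂riemannianVolume n M := by
  have hus := hφ.mul hw
  have huc : HasCompactSupport (fun x => φ x * w x) := hφc.mul_right
  have hune : (fun x => φ x * w x) ≠ 0 := by
    obtain ⟨x, hx⟩ := hne
    exact fun h => hx (congrFun h x)
  have h1 := hQ.trans (iInf_le _ ⟨fun x => φ x * w x, hus, huc, hune⟩)
  rw [EReal.coe_le_coe_iff] at h1
  set S := (∫ x, |φ x * w x| ^ (2 * (n : ℝ) / ((n : ℝ) - 2)) ∂riemannianVolume n M)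
        ^ (((n : ℝ) - 2) / (n : ℝ)) with hS
  have hS0 : 0 ≤ S :=
    Real.rpow_nonneg (integral_nonneg fun x => Real.rpow_nonneg (abs_nonneg _) _) _
  -- for `S = 0` the quotient would be `0` by convention, which is less than `Λ`
  have hSp : 0 < S := by
    rcases hS0.eq_or_lt with h0 | h0
    · rw [← h0, div_zero] at h1; linarith
    · exact h0
  rw [le_div_iff₀ hSp] at h1
  refine h1.trans (le_of_eq ?_)
  have i1 : Integrable (fun x => φ x ^ 2 * gradInner n w w x) (riemannianVolume n M) :=
    integrable_of_cont ((hφ.continuous.pow 2).mul (continuous_gradInner hw hw))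
      (HasCompactSupport.intro hφc fun x hx => by simp [image_eq_zero_of_notMem_tsupport hx])
  have i2 : Integrable (fun x => φ x * w x * gradInner n φ w x) (riemannianVolume n M) :=
    integrable_of_cont ((hφ.continuous.mul hw.continuous).mul (continuous_gradInner hφ hw))
      (HasCompactSupport.intro hφc fun x hx => by simp [image_eq_zero_of_notMem_tsupport hx])
  have i3 : Integrable (fun x => gradInner n φ φ x * w x ^ 2) (riemannianVolume n M) :=
    integrable_of_cont ((continuous_gradInner hφ hφ).mul (hw.continuous.pow 2))
      (HasCompactSupport.intro hφc fun x hx => by simp [gradInner_eq_zero hx])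
  have i4 : Integrable (fun x => (φ x * w x) ^ 2) (riemannianVolume n M) :=
    integrable_of_cont ((hφ.continuous.mul hw.continuous).pow 2)
      (HasCompactSupport.intro hφc fun x hx => by simp [image_eq_zero_of_notMem_tsupport hx])
  set c := ((n : ℝ) - 2) / (4 * ((n : ℝ) - 1)) * R with hc
  have i12 : Integrable (fun x => φ x ^ 2 * gradInner n w w x
      + 2 * (φ x * w x * gradInner n φ w x)) (riemannianVolume n M) := i1.add (i2.const_mul _)
  have i123 : Integrable (fun x => φ x ^ 2 * gradInner n w w x
      + 2 * (φ x * w x * gradInner n φ w x) + gradInner n φ φ x * w x ^ 2)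
      (riemannianVolume n M) := i12.add i3
  have e : ∀ x, normGradSq (n := n) (fun x => φ x * w x) x
      + ((n : ℝ) - 2) / (4 * ((n : ℝ) - 1)) * scalarCurvature (n := n) x * (φ x * w x) ^ 2
      = φ x ^ 2 * gradInner n w w x + 2 * (φ x * w x * gradInner n φ w x)
        + gradInner n φ φ x * w x ^ 2 + c * (φ x * w x) ^ 2 := fun x => by
    rw [normGradSq_eq_gradInner, hR, gradInner_mul_self hφ hw]
  rw [integral_congr_ae (Filter.Eventually.of_forall e), integral_add i123 (i4.const_mul c),
    integral_add i12 i3, integral_add i1 (i2.const_mul 2), integral_const_mul, integral_const_mul]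

/-- Hölder's inequality for the curvature term. -/
lemma holder_integral (hn : 4 ≤ n) (hV : Continuous V) (hV0 : ∀ x, 0 ≤ V x)
    (hVi : Integrable (fun x => V x ^ ((n : ℝ) / 2)) (riemannianVolume n M)) {u : M → ℝ}
    (hu : Continuous u) (huc : HasCompactSupport u) :
    ∫ x, V x * u x ^ 2 ∂riemannianVolume n M
      ≤ (∫ x, V x ^ ((n : ℝ) / 2) ∂riemannianVolume n M) ^ (2 / (n : ℝ)) *
        (∫ x, |u x| ^ (2 * (n : ℝ) / ((n : ℝ) - 2)) ∂riemannianVolume n M)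
          ^ (((n : ℝ) - 2) / (n : ℝ)) := by
  have hn4 : (4 : ℝ) ≤ n := by exact_mod_cast hn
  have hn0 : (0 : ℝ) < n := by linarith
  have hn2 : (0 : ℝ) < (n : ℝ) - 2 := by linarith
  have hpq : ((n : ℝ) / 2).HolderConjugate ((n : ℝ) / ((n : ℝ) - 2)) := by
    rw [Real.holderConjugate_iff]
    exact ⟨by linarith, by field_simp; ring⟩
  have hVm : MemLp V (ENNReal.ofReal ((n : ℝ) / 2)) (riemannianVolume n M) := by
    rw [← integrable_norm_rpow_iff hV.aestronglyMeasurable (by simp; linarith) (by simp),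
      ENNReal.toReal_ofReal (by positivity)]
    simpa only [Real.norm_of_nonneg (hV0 _)] using hVi
  have hu2 : HasCompactSupport (fun x => u x ^ 2) :=
    HasCompactSupport.intro huc fun x hx => by simp [image_eq_zero_of_notMem_tsupport hx]
  have hu2c : Continuous (fun x => u x ^ 2) := hu.pow 2
  have hum : MemLp (fun x => u x ^ 2) (ENNReal.ofReal ((n : ℝ) / ((n : ℝ) - 2)))
      (riemannianVolume n M) := hu2c.memLp_of_hasCompactSupport hu2
  have h := integral_mul_le_Lp_mul_Lq_of_nonneg hpq (Filter.Eventually.of_forall hV0)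
    (Filter.Eventually.of_forall fun x => sq_nonneg (u x)) hVm hum
  have e1 : ∀ x, (u x ^ 2) ^ ((n : ℝ) / ((n : ℝ) - 2)) = |u x| ^ (2 * (n : ℝ) / ((n : ℝ) - 2)) := by
    intro x
    rw [← sq_abs, ← Real.rpow_natCast, ← Real.rpow_mul (abs_nonneg _)]
    congr 1
    push_cast; ring
  simp only [e1, one_div_div] at h
  exact h

end Estimates

/-! ### The gap theorem -/

/-- The absorption argument: the tested Bochner inequality `h1` plus `m` times the Sobolev
inequality `h2`, with the cross term absorbed into the surplus `(a - m) A`. Here `A`, `X`, `B`,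
`D` are the integrals of `φ² |∇w|²`, `φ w ⟨∇φ, ∇w⟩`, `φ² w²` and `|∇φ|² w²`, `P` is the curvature
term and `S` is the square of the `L^(2n/(n-2))`-norm of `φ w`. -/
lemma absorb {N R a m Λ τ A X B D P S K : ℝ} (hN : 4 ≤ N) (hm : 0 < m)
    (hτ : τ = 2 * (a - m) / (8 / N + 2 * m)) (hB : 0 ≤ B)
    (hmR : 0 ≤ (4 / (N - 2) - m) * R)
    (h1 : a * A + 8 / N * X - P + R / (N - 1) * B ≤ K)
    (h2 : Λ * S ≤ A + 2 * X + D + (N - 2) / (4 * (N - 1)) * R * B)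
    (h3 : P ≤ m * Λ / 2 * S) (h4 : |X| ≤ τ / 2 * A + 1 / (2 * τ) * D) :
    m * Λ / 2 * S ≤ (m + (8 / N + 2 * m) * (1 / (2 * τ))) * D + K := by
  have hN0 : 0 < N := by linarith
  have hN1 : 0 < N - 1 := by linarith
  have hN2 : 0 < N - 2 := by linarith
  have h8 : 0 < 8 / N := by positivity
  have hq : 0 < 8 / N + 2 * m := by positivity
  have e1 : (8 / N + 2 * m) * (τ / 2) = a - m := by
    rw [hτ]; field_simp
  have e2 : R / (N - 1) = 4 / (N - 2) * ((N - 2) / (4 * (N - 1)) * R) := by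
    field_simp
  have e3 : 0 ≤ (4 / (N - 2) - m) * ((N - 2) / (4 * (N - 1)) * R) * B := by
    refine mul_nonneg ?_ hB
    have := mul_nonneg (show 0 ≤ (N - 2) / (4 * (N - 1)) by positivity) hmR
    linarith
  rw [e2] at h1
  have h5 := mul_le_mul_of_nonneg_left h2 hm.le
  have h6 : (2 * m - 8 / N) * X ≤ (8 / N + 2 * m) * |X| := by
    have h7 := le_abs_self X
    have h8' := neg_abs_le X
    nlinarith [mul_le_mul_of_nonneg_left h7 hm.le, mul_le_mul_of_nonneg_left h8' h8.le]
  have h7 := mul_le_mul_of_nonneg_left h4 hq.le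
  have h9 : (8 / N + 2 * m) * (τ / 2 * A + 1 / (2 * τ) * D)
      = (a - m) * A + (8 / N + 2 * m) * (1 / (2 * τ)) * D := by
    rw [← e1]; ring
  linarith

lemma le_of_forall_eps {a b c : ℝ} (h : ∀ ε, 0 < ε → ε ≤ 1 → a ≤ b + ε * c) : a ≤ b := by
  by_contra! hab
  have hc : 0 < 2 * (|c| + 1) := by positivity
  have h1 := h (min 1 ((a - b) / (2 * (|c| + 1)))) (lt_min one_pos (div_pos (by linarith) hc))
    (min_le_left _ _)
  have hε0 : 0 < min 1 ((a - b) / (2 * (|c| + 1))) := lt_min one_pos (div_pos (by linarith) hc)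
  have h2 : min 1 ((a - b) / (2 * (|c| + 1))) * c ≤ (a - b) / (2 * (|c| + 1)) * (|c| + 1) :=
    (mul_le_mul_of_nonneg_left (by linarith [le_abs_self c] : c ≤ |c| + 1) hε0.le).trans
      (mul_le_mul_of_nonneg_right (min_le_right _ _) (by positivity))
  have h3 : (a - b) / (2 * (|c| + 1)) * (|c| + 1) = (a - b) / 2 := by
    have : |c| + 1 ≠ 0 := by positivity
    field_simp
  linarith

lemma add_rpow_le_of_nonneg {a b s : ℝ} (ha : 0 ≤ a) (hb : 0 ≤ b) (hs : 0 ≤ s) :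
    (a + b) ^ s ≤ 2 ^ s * (a ^ s + b ^ s) := by
  have h1 : a + b ≤ 2 * max a b := by linarith [le_max_left a b, le_max_right a b]
  have h2 : (a + b) ^ s ≤ (2 * max a b) ^ s := Real.rpow_le_rpow (by positivity) h1 hs
  rw [Real.mul_rpow (by norm_num) (le_max_of_le_left ha)] at h2
  refine h2.trans (mul_le_mul_of_nonneg_left ?_ (by positivity))
  have := Real.rpow_nonneg ha s
  have := Real.rpow_nonneg hb s
  rcases max_choice a b with h | h <;> rw [h] <;> linarith

section Gap

variable {n : ℕ} {M : Type*} [TopologicalSpace M] [ChartedSpace (Coord n) M]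
  [RiemannianBundle (fun x : M => TangentSpace (𝓡 n) x)] [IsManifold (𝓡 n) ∞ M]
  [IsContMDiffRiemannianBundle (𝓡 n) ∞ (Coord n) (fun x : M => TangentSpace (𝓡 n) x)]
  [SecondCountableTopology M] [T2Space M] [Nonempty M] [MeasurableSpace M] [BorelSpace M]
  {f V φ : M → ℝ}

lemma integrable_of_lintegral_le {F : M → ℝ} (hF : Continuous F) (hF0 : ∀ x, 0 ≤ F x) {c : ℝ}
    (hc : 0 ≤ c) (h : ∫⁻ x, ENNReal.ofReal (F x) ∂riemannianVolume n M ≤ ENNReal.ofReal c) :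
    Integrable F (riemannianVolume n M) ∧ ∫ x, F x ∂riemannianVolume n M ≤ c := by
  have hi : Integrable F (riemannianVolume n M) := by
    refine ⟨hF.aestronglyMeasurable, ?_⟩
    rw [hasFiniteIntegral_iff_ofReal (Filter.Eventually.of_forall hF0)]
    exact h.trans_lt ENNReal.ofReal_lt_top
  refine ⟨hi, ?_⟩
  rw [integral_eq_lintegral_of_nonneg_ae (Filter.Eventually.of_forall hF0) hF.aestronglyMeasurable]
  exact ENNReal.toReal_le_of_le_ofReal hc h

/-- The energy estimate for `w = (f + ε)^{n/8}`. The function `V` stands for the curvature and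
satisfies `‖V‖_{n/2} ≤ m Λ / 2`, so that its contribution is at most half of the Sobolev term. -/
lemma energy_estimate (hn : 4 ≤ n) {Λ R m ε : ℝ} (hΛ : 0 < Λ) (hm : 0 < m)
    (hma : m < 8 * ((n : ℝ) ^ 2 - 2 * n + 4) / (n : ℝ) ^ 3)
    (hmR : 0 ≤ (4 / ((n : ℝ) - 2) - m) * R)
    (hQ : (Λ : EReal) ≤ sobolevConstant n M) (hR : ∀ x : M, scalarCurvature (n := n) x = R)
    (hf : ContMDiff (𝓡 n) 𝓘(ℝ, ℝ) ∞ f)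
    (hf0 : ∀ x, 0 ≤ f x) (hV : Continuous V) (hV0 : ∀ x, 0 ≤ V x)
    (hVi : Integrable (fun x => V x ^ ((n : ℝ) / 2)) (riemannianVolume n M))
    (hVs : (∫ x, V x ^ ((n : ℝ) / 2) ∂riemannianVolume n M) ^ (2 / (n : ℝ)) ≤ m * Λ / 2)
    (hε : 0 < ε) (hε1 : ε ≤ 1)
    (hφ : ContMDiff (𝓡 n) 𝓘(ℝ, ℝ) ∞ φ) (hφc : HasCompactSupport φ) (hne : ∃ x, φ x ≠ 0)
    (hweak : ∀ ψ : M → ℝ, ContMDiff (𝓡 n) 𝓘(ℝ, ℝ) ∞ ψ → (∀ x, 0 ≤ ψ x) → HasCompactSupport ψ →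
      ∫ x, (gradInner n ψ f x + ψ x * (2 * (((n : ℝ) + 2) / (4 * n) *
        (gradInner n f f x / (f x + ε)) - V x * f x + R / ((n : ℝ) - 1) * f x)))
          ∂riemannianVolume n M ≤ 0) {w : M → ℝ} (hw : w = fun x => (f x + ε) ^ ((n : ℝ) / 8))
    {τ : ℝ} (hτ : τ = 2 * (8 * ((n : ℝ) ^ 2 - 2 * n + 4) / (n : ℝ) ^ 3 - m) / (8 / n + 2 * m)) :
    m * Λ / 2 * (∫ x, |φ x * w x| ^ (2 * (n : ℝ) / ((n : ℝ) - 2)) ∂riemannianVolume n M)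
        ^ (((n : ℝ) - 2) / (n : ℝ))
      ≤ (m + (8 / n + 2 * m) * (1 / (2 * τ))) *
          ∫ x, gradInner n φ φ x * w x ^ 2 ∂riemannianVolume n M
        + ε * (|R| / ((n : ℝ) - 1)) *
          ∫ x, φ x ^ 2 * (f x + 1) ^ ((n : ℝ) / 4 - 1) ∂riemannianVolume n M := by
  have hn4 : (4 : ℝ) ≤ n := by exact_mod_cast hn
  have hpos : ∀ x, 0 < f x + ε := fun x => by linarith [hf0 x]
  have hws : ContMDiff (𝓡 n) 𝓘(ℝ, ℝ) ∞ w := hw ▸ contMDiff_rpow hf hpos _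
  have hwp : ∀ x, 0 < w x := fun x => by rw [hw]; exact Real.rpow_pos_of_pos (hpos x) _
  have hτ0 : 0 < τ := by
    rw [hτ]; exact div_pos (by linarith) (by positivity)
  have h1 := test_integral hn hf hf0 hV hV0 hε hε1 hφ hφc hweak hw
  have h2 := sobolev_integral hΛ hQ hR hws hφ hφc
    (by obtain ⟨x, hx⟩ := hne; exact ⟨x, mul_ne_zero hx (hwp x).ne'⟩)
  have huc : HasCompactSupport (fun x => φ x * w x) :=
    HasCompactSupport.intro hφc fun x hx => by simp [image_eq_zero_of_notMem_tsupport hx]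
  have h3 := holder_integral hn hV hV0 hVi (hφ.continuous.mul hws.continuous) huc
  have hS0 : 0 ≤ (∫ x, |φ x * w x| ^ (2 * (n : ℝ) / ((n : ℝ) - 2)) ∂riemannianVolume n M)
        ^ (((n : ℝ) - 2) / (n : ℝ)) :=
    Real.rpow_nonneg (integral_nonneg fun x => Real.rpow_nonneg (abs_nonneg _) _) _
  have h3' := h3.trans (mul_le_mul_of_nonneg_right hVs hS0)
  have i1 : Integrable (fun x => φ x ^ 2 * gradInner n w w x) (riemannianVolume n M) :=
    integrable_of_cont ((hφ.continuous.pow 2).mul (continuous_gradInner hws hws))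
      (HasCompactSupport.intro hφc fun x hx => by simp [image_eq_zero_of_notMem_tsupport hx])
  have i2 : Integrable (fun x => φ x * w x * gradInner n φ w x) (riemannianVolume n M) :=
    integrable_of_cont ((hφ.continuous.mul hws.continuous).mul (continuous_gradInner hφ hws))
      (HasCompactSupport.intro hφc fun x hx => by simp [image_eq_zero_of_notMem_tsupport hx])
  have i3 : Integrable (fun x => gradInner n φ φ x * w x ^ 2) (riemannianVolume n M) :=
    integrable_of_cont ((continuous_gradInner hφ hφ).mul (hws.continuous.pow 2))
      (HasCompactSupport.intro hφc fun x hx => by simp [gradInner_eq_zero hx])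
  have h4 : |∫ x, φ x * w x * gradInner n φ w x ∂riemannianVolume n M|
      ≤ τ / 2 * (∫ x, φ x ^ 2 * gradInner n w w x ∂riemannianVolume n M)
        + 1 / (2 * τ) * ∫ x, gradInner n φ φ x * w x ^ 2 ∂riemannianVolume n M := by
    rw [← integral_const_mul, ← integral_const_mul,
      ← integral_add (i1.const_mul (τ / 2)) (i3.const_mul (1 / (2 * τ)))]
    refine (abs_integral_le_integral_abs).trans
      (integral_mono i2.abs ((i1.const_mul _).add (i3.const_mul _)) fun x => ?_)
    exact abs_cross_le hτ0 x
  exact absorb hn4 hm hτ (integral_nonneg fun x => sq_nonneg _) hmR h1 h2 h3' h4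

/-- The limit `ε → 0` of `energy_estimate`. On the left `w ≥ f ^ (n / 8)`; on the right
`w² = (f + ε) ^ (n / 4)` is split by `add_rpow_le_of_nonneg`, so that no convergence theorem is
needed and every error is a multiple of `ε`. -/
lemma energy_estimate_limit (hn : 4 ≤ n) {Λ R m : ℝ} (hΛ : 0 < Λ) (hm : 0 < m)
    (hma : m < 8 * ((n : ℝ) ^ 2 - 2 * n + 4) / (n : ℝ) ^ 3)
    (hmR : 0 ≤ (4 / ((n : ℝ) - 2) - m) * R)
    (hQ : (Λ : EReal) ≤ sobolevConstant n M) (hR : ∀ x : M, scalarCurvature (n := n) x = R)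
    (hf : ContMDiff (𝓡 n) 𝓘(ℝ, ℝ) ∞ f)
    (hf0 : ∀ x, 0 ≤ f x) (hV : Continuous V) (hV0 : ∀ x, 0 ≤ V x)
    (hVi : Integrable (fun x => V x ^ ((n : ℝ) / 2)) (riemannianVolume n M))
    (hVs : (∫ x, V x ^ ((n : ℝ) / 2) ∂riemannianVolume n M) ^ (2 / (n : ℝ)) ≤ m * Λ / 2)
    (hφ : ContMDiff (𝓡 n) 𝓘(ℝ, ℝ) ∞ φ) (hφc : HasCompactSupport φ) (hne : ∃ x, φ x ≠ 0)
    (hweak : ∀ ε : ℝ, 0 < ε → ∀ ψ : M → ℝ, ContMDiff (𝓡 n) 𝓘(ℝ, ℝ) ∞ ψ → (∀ x, 0 ≤ ψ x) →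
      HasCompactSupport ψ →
      ∫ x, (gradInner n ψ f x + ψ x * (2 * (((n : ℝ) + 2) / (4 * n) *
        (gradInner n f f x / (f x + ε)) - V x * f x + R / ((n : ℝ) - 1) * f x)))
          ∂riemannianVolume n M ≤ 0)
    {τ : ℝ} (hτ : τ = 2 * (8 * ((n : ℝ) ^ 2 - 2 * n + 4) / (n : ℝ) ^ 3 - m) / (8 / n + 2 * m)) :
    m * Λ / 2 * (∫ x, |φ x * f x ^ ((n : ℝ) / 8)| ^ (2 * (n : ℝ) / ((n : ℝ) - 2))
        ∂riemannianVolume n M) ^ (((n : ℝ) - 2) / (n : ℝ))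
      ≤ (m + (8 / n + 2 * m) * (1 / (2 * τ))) * (2 ^ ((n : ℝ) / 4) *
          ∫ x, gradInner n φ φ x * f x ^ ((n : ℝ) / 4) ∂riemannianVolume n M) := by
  have hn4 : (4 : ℝ) ≤ n := by exact_mod_cast hn
  have hn2 : (0 : ℝ) < (n : ℝ) - 2 := by linarith
  have hn0 : (0 : ℝ) < n := by linarith
  have hτ0 : 0 < τ := by
    rw [hτ]; exact div_pos (by linarith) (by positivity)
  set C := m + (8 / n + 2 * m) * (1 / (2 * τ)) with hC
  have hC0 : 0 ≤ C := by positivity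
  have hfc4 : Continuous (fun x => f x ^ ((n : ℝ) / 4)) :=
    hf.continuous.rpow_const fun x => Or.inr (by positivity)
  have hfc8 : Continuous (fun x => f x ^ ((n : ℝ) / 8)) :=
    hf.continuous.rpow_const fun x => Or.inr (by positivity)
  have i0 : Integrable (fun x => gradInner n φ φ x * f x ^ ((n : ℝ) / 4)) (riemannianVolume n M) :=
    integrable_of_cont ((continuous_gradInner hφ hφ).mul hfc4)
      (HasCompactSupport.intro hφc fun x hx => by simp [gradInner_eq_zero hx])
  have i1 : Integrable (fun x => gradInner n φ φ x) (riemannianVolume n M) :=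
    integrable_of_cont (continuous_gradInner hφ hφ)
      (HasCompactSupport.intro hφc fun x hx => gradInner_eq_zero hx φ)
  have hp0 : 2 * (n : ℝ) / ((n : ℝ) - 2) ≠ 0 := by positivity
  have hint : ∀ w : M → ℝ, Continuous w → Integrable
      (fun x => |φ x * w x| ^ (2 * (n : ℝ) / ((n : ℝ) - 2))) (riemannianVolume n M) := fun w hw =>
    integrable_of_cont ((hφ.continuous.mul hw).abs.rpow_const fun x => Or.inr (by positivity))
      (HasCompactSupport.intro hφc fun x hx => by
        simp [image_eq_zero_of_notMem_tsupport hx, Real.zero_rpow hp0])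
  refine le_of_forall_eps (c := C * (2 ^ ((n : ℝ) / 4) *
      ∫ x, gradInner n φ φ x ∂riemannianVolume n M) + |R| / ((n : ℝ) - 1) *
      ∫ x, φ x ^ 2 * (f x + 1) ^ ((n : ℝ) / 4 - 1) ∂riemannianVolume n M) fun ε hε hε1 => ?_
  have hpos : ∀ x, 0 < f x + ε := fun x => by linarith [hf0 x]
  set w : M → ℝ := fun x => (f x + ε) ^ ((n : ℝ) / 8) with hw
  have hws : ContMDiff (𝓡 n) 𝓘(ℝ, ℝ) ∞ w := contMDiff_rpow hf hpos _
  have h1 := energy_estimate hn hΛ hm hma hmR hQ hR hf hf0 hV hV0 hVi hVs hε hε1 hφ hφc hne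
    (hweak ε hε) hw hτ
  rw [← hC] at h1
  have h2 : ∫ x, |φ x * f x ^ ((n : ℝ) / 8)| ^ (2 * (n : ℝ) / ((n : ℝ) - 2)) ∂riemannianVolume n M
      ≤ ∫ x, |φ x * w x| ^ (2 * (n : ℝ) / ((n : ℝ) - 2)) ∂riemannianVolume n M := by
    refine integral_mono (hint _ hfc8) (hint _ hws.continuous) fun x => ?_
    refine Real.rpow_le_rpow (abs_nonneg _) ?_ (by positivity)
    rw [abs_mul, abs_mul]
    refine mul_le_mul_of_nonneg_left ?_ (abs_nonneg _)
    have h3 := Real.rpow_nonneg (hf0 x) ((n : ℝ) / 8)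
    have h4 : f x ^ ((n : ℝ) / 8) ≤ w x :=
      Real.rpow_le_rpow (hf0 x) (by linarith) (by positivity)
    rwa [abs_of_nonneg h3, abs_of_nonneg (h3.trans h4)]
  have h3 : (∫ x, |φ x * f x ^ ((n : ℝ) / 8)| ^ (2 * (n : ℝ) / ((n : ℝ) - 2))
        ∂riemannianVolume n M) ^ (((n : ℝ) - 2) / (n : ℝ))
      ≤ (∫ x, |φ x * w x| ^ (2 * (n : ℝ) / ((n : ℝ) - 2)) ∂riemannianVolume n M)
        ^ (((n : ℝ) - 2) / (n : ℝ)) :=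
    Real.rpow_le_rpow (integral_nonneg fun x => Real.rpow_nonneg (abs_nonneg _) _) h2
      (by positivity)
  have h4 : ∫ x, gradInner n φ φ x * w x ^ 2 ∂riemannianVolume n M
      ≤ 2 ^ ((n : ℝ) / 4) * (∫ x, gradInner n φ φ x * f x ^ ((n : ℝ) / 4) ∂riemannianVolume n M)
        + ε * (2 ^ ((n : ℝ) / 4) * ∫ x, gradInner n φ φ x ∂riemannianVolume n M) := by
    rw [← mul_assoc ε, ← integral_const_mul, ← integral_const_mul,
      ← integral_add (i0.const_mul _) (i1.const_mul _)]
    refine integral_mono (integrable_of_cont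
      ((continuous_gradInner hφ hφ).mul (hws.continuous.pow 2))
        (HasCompactSupport.intro hφc fun x hx => by simp [gradInner_eq_zero hx]))
      ((i0.const_mul _).add (i1.const_mul _)) fun x => ?_
    have e1 : w x ^ 2 = (f x + ε) ^ ((n : ℝ) / 4) := by
      rw [hw, ← Real.rpow_natCast, ← Real.rpow_mul (hpos x).le]
      congr 1; push_cast; ring
    -- this uses `n ≥ 4` and `ε ≤ 1`
    have e2 : ε ^ ((n : ℝ) / 4) ≤ ε := by
      have := Real.rpow_le_rpow_of_exponent_ge hε hε1 (show (1 : ℝ) ≤ (n : ℝ) / 4 by linarith)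
      rwa [Real.rpow_one] at this
    have e3 := add_rpow_le_of_nonneg (s := (n : ℝ) / 4) (hf0 x) hε.le (by positivity)
    have e4 : (f x + ε) ^ ((n : ℝ) / 4) ≤ 2 ^ ((n : ℝ) / 4) * (f x ^ ((n : ℝ) / 4) + ε) :=
      e3.trans (mul_le_mul_of_nonneg_left (by linarith) (by positivity))
    have e5 := mul_le_mul_of_nonneg_left e4 (gradInner_self_nonneg (n := n) φ x)
    show gradInner n φ φ x * w x ^ 2 ≤ 2 ^ ((n : ℝ) / 4) * (gradInner n φ φ x * f x ^ ((n : ℝ) / 4))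
      + ε * 2 ^ ((n : ℝ) / 4) * gradInner n φ φ x
    rw [e1]
    linarith
  have h5 := mul_le_mul_of_nonneg_left h3 (show 0 ≤ m * Λ / 2 by positivity)
  have h6 := mul_le_mul_of_nonneg_left h4 hC0
  linarith

end Gap

section Main

variable {n : ℕ} {M : Type*} [EMetricSpace M] [ChartedSpace (Coord n) M]
  [RiemannianBundle (fun x : M => TangentSpace (𝓡 n) x)] [IsManifold (𝓡 n) ∞ M]
  [IsContMDiffRiemannianBundle (𝓡 n) ∞ (Coord n) (fun x : M => TangentSpace (𝓡 n) x)]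
  [IsRiemannianManifold (𝓡 n) M] [SecondCountableTopology M] [CompleteSpace M] [ConnectedSpace M]
  [MeasurableSpace M] [BorelSpace M]

/-- Vanishing of `E` if some `m > 0` satisfies `m < 8 (n² - 2 n + 4) / n³` and
`(4 / (n - 2) - m) R ≥ 0`. The bound `(m Λ / 6) ^ (n / 2)` on the curvature integral makes the
`L^(n/2)`-norm of `V = |W| + n / (n - 2) |E| ≤ 3 max |W| |E|` at most `m Λ / 2`. -/
theorem normE_eq_zero (hn : 4 ≤ n) {Λ R m : ℝ} (hΛ : 0 < Λ) (hm : 0 < m)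
    (hma : m < 8 * ((n : ℝ) ^ 2 - 2 * n + 4) / (n : ℝ) ^ 3)
    (hmR : 0 ≤ (4 / ((n : ℝ) - 2) - m) * R) (hM : HasHarmonicCurvature n M)
    (hQ : (Λ : EReal) ≤ sobolevConstant n M) (hR : ∀ x : M, scalarCurvature (n := n) x = R)
    (hsmall : ∫⁻ x : M, ENNReal.ofReal
      (normW (n := n) x ^ ((n : ℝ) / 2) + normE (n := n) x ^ ((n : ℝ) / 2)) ∂riemannianVolume n M
        ≤ ENNReal.ofReal ((m * Λ / 6) ^ ((n : ℝ) / 2))) (x₁ : M) :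
    normE (n := n) x₁ = 0 := by
  have hn4 : (4 : ℝ) ≤ n := by exact_mod_cast hn
  have hn2 : (0 : ℝ) < (n : ℝ) - 2 := by linarith
  have hn0 : (0 : ℝ) < n := by linarith
  set c := (m * Λ / 6) ^ ((n : ℝ) / 2) with hc
  have hc0 : 0 ≤ c := by positivity
  have hWc : Continuous (fun x : M => normW (n := n) x ^ ((n : ℝ) / 2)) :=
    (continuous_normW (n := n)).rpow_const fun x => Or.inr (by positivity)
  have hEc : Continuous (fun x : M => normE (n := n) x ^ ((n : ℝ) / 2)) :=
    (continuous_normE (n := n)).rpow_const fun x => Or.inr (by positivity)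
  have hW0 : ∀ x : M, 0 ≤ normW (n := n) x ^ ((n : ℝ) / 2) :=
    fun x => Real.rpow_nonneg (normW_nonneg x) _
  have hE0 : ∀ x : M, 0 ≤ normE (n := n) x ^ ((n : ℝ) / 2) :=
    fun x => Real.rpow_nonneg (normE_nonneg x) _
  have hWEc : Continuous (fun x : M =>
      normW (n := n) x ^ ((n : ℝ) / 2) + normE (n := n) x ^ ((n : ℝ) / 2)) := hWc.add hEc
  obtain ⟨hi, hle⟩ := integrable_of_lintegral_le hWEc
    (fun x => add_nonneg (hW0 x) (hE0 x)) hc0 hsmall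
  have hEi : Integrable (fun x : M => normE (n := n) x ^ ((n : ℝ) / 2)) (riemannianVolume n M) :=
    hi.mono' hEc.aestronglyMeasurable (Filter.Eventually.of_forall fun x => by
      rw [Real.norm_of_nonneg (hE0 x)]; linarith [hW0 x])
  have hEle : ∫ x : M, normE (n := n) x ^ ((n : ℝ) / 2) ∂riemannianVolume n M ≤ c :=
    (integral_mono hEi hi fun x => by linarith [hW0 x]).trans hle
  set V : M → ℝ := fun x => normW (n := n) x + (n : ℝ) / (n - 2) * normE (n := n) x with hVdef
  have hV : Continuous V := (continuous_normW (n := n)).add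
    (continuous_const.mul (continuous_normE (n := n)))
  have hV0 : ∀ x, 0 ≤ V x := fun x => add_nonneg (normW_nonneg x)
    (mul_nonneg (by positivity) (normE_nonneg x))
  have hVc : Continuous (fun x => V x ^ ((n : ℝ) / 2)) :=
    hV.rpow_const fun x => Or.inr (by positivity)
  have hVle : ∀ x, V x ^ ((n : ℝ) / 2) ≤ 3 ^ ((n : ℝ) / 2) *
      (normW (n := n) x ^ ((n : ℝ) / 2) + normE (n := n) x ^ ((n : ℝ) / 2)) := by
    intro x
    have h1 : (n : ℝ) / (n - 2) ≤ 2 := by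
      rw [div_le_iff₀ hn2]; linarith
    have h2 : V x ≤ 3 * max (normW (n := n) x) (normE (n := n) x) := by
      have := mul_le_mul_of_nonneg_right h1 (normE_nonneg (n := n) x)
      have := le_max_left (normW (n := n) x) (normE (n := n) x)
      have := le_max_right (normW (n := n) x) (normE (n := n) x)
      simp only [hVdef]; linarith
    have h3 := Real.rpow_le_rpow (hV0 x) h2 (show 0 ≤ (n : ℝ) / 2 by positivity)
    rw [Real.mul_rpow (by norm_num) (le_max_of_le_left (normW_nonneg x))] at h3
    refine h3.trans (mul_le_mul_of_nonneg_left ?_ (by positivity))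
    rcases max_choice (normW (n := n) x) (normE (n := n) x) with h | h <;> rw [h] <;>
      linarith [hW0 x, hE0 x]
  have hVi : Integrable (fun x => V x ^ ((n : ℝ) / 2)) (riemannianVolume n M) :=
    (hi.const_mul (3 ^ ((n : ℝ) / 2))).mono' hVc.aestronglyMeasurable
      (Filter.Eventually.of_forall fun x => by
        rw [Real.norm_of_nonneg (Real.rpow_nonneg (hV0 x) _)]; exact hVle x)
  have hVs : (∫ x, V x ^ ((n : ℝ) / 2) ∂riemannianVolume n M) ^ (2 / (n : ℝ)) ≤ m * Λ / 2 := by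
    have h1 : ∫ x, V x ^ ((n : ℝ) / 2) ∂riemannianVolume n M ≤ (m * Λ / 2) ^ ((n : ℝ) / 2) := by
      refine (integral_mono hVi (hi.const_mul (3 ^ ((n : ℝ) / 2))) hVle).trans ?_
      rw [integral_const_mul]
      refine (mul_le_mul_of_nonneg_left hle (by positivity)).trans (le_of_eq ?_)
      rw [hc, ← Real.mul_rpow (by norm_num) (by positivity)]
      congr 1; ring
    have h2 := Real.rpow_le_rpow (integral_nonneg fun x => Real.rpow_nonneg (hV0 x) _) h1
      (show 0 ≤ 2 / (n : ℝ) by positivity)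
    refine h2.trans (le_of_eq ?_)
    rw [← Real.rpow_mul (by positivity), div_mul_div_cancel₀ (by norm_num), div_self hn0.ne',
      Real.rpow_one]
  set f : M → ℝ := fun x => normE (n := n) x ^ 2 with hfdef
  have hf : ContMDiff (𝓡 n) 𝓘(ℝ, ℝ) ∞ f := contMDiff_normE_sq
  have hf0 : ∀ x, 0 ≤ f x := fun x => sq_nonneg _
  have hf4 : ∀ x, f x ^ ((n : ℝ) / 4) = normE (n := n) x ^ ((n : ℝ) / 2) := fun x => by
    simp only [hfdef]
    rw [← Real.rpow_natCast, ← Real.rpow_mul (normE_nonneg x)]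
    congr 1; push_cast; ring
  by_contra hx₁
  obtain ⟨τ, hτ⟩ : ∃ τ, τ = 2 * (8 * ((n : ℝ) ^ 2 - 2 * n + 4) / (n : ℝ) ^ 3 - m) /
    (8 / n + 2 * m) := ⟨_, rfl⟩
  have hτ0 : 0 < τ := by
    rw [hτ]; exact div_pos (by linarith) (by positivity)
  set C := (m + (8 / n + 2 * m) * (1 / (2 * τ))) * 2 ^ ((n : ℝ) / 4) with hC
  have hC0 : 0 ≤ C := by positivity
  -- a fixed cutoff function detects that `E` does not vanish at `x₁`
  obtain ⟨φ₀, hφ₀, hφ₀c, hφ₀0, hφ₀1, hφ₀x, -⟩ :=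
    exists_cutoff (n := n) (isCompact_singleton (x := x₁)) one_pos
  have hfc8 : Continuous (fun x => f x ^ ((n : ℝ) / 8)) :=
    hf.continuous.rpow_const fun x => Or.inr (by positivity)
  have hp0 : 2 * (n : ℝ) / ((n : ℝ) - 2) ≠ 0 := by positivity
  have hcont : ∀ φ : M → ℝ, Continuous φ →
      Continuous (fun x => |φ x * f x ^ ((n : ℝ) / 8)| ^ (2 * (n : ℝ) / ((n : ℝ) - 2))) :=
    fun φ hφ => (hφ.mul hfc8).abs.rpow_const fun x => Or.inr (by positivity)
  have hcs : ∀ φ : M → ℝ, HasCompactSupport φ → HasCompactSupport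
      (fun x => |φ x * f x ^ ((n : ℝ) / 8)| ^ (2 * (n : ℝ) / ((n : ℝ) - 2))) := fun φ hφ =>
    HasCompactSupport.intro hφ fun x hx => by
      simp [image_eq_zero_of_notMem_tsupport hx, Real.zero_rpow hp0]
  have hT : 0 < ∫ x, |φ₀ x * f x ^ ((n : ℝ) / 8)| ^ (2 * (n : ℝ) / ((n : ℝ) - 2))
      ∂riemannianVolume n M := by
    refine (hcont φ₀ hφ₀.continuous).integral_pos_of_hasCompactSupport_nonneg_nonzero (hcs φ₀ hφ₀c)
      (fun x => Real.rpow_nonneg (abs_nonneg _) _) (x := x₁) ?_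
    have : 0 < f x₁ := by simp only [hfdef]; positivity
    rw [hφ₀x x₁ rfl, one_mul]
    positivity
  set T := (∫ x, |φ₀ x * f x ^ ((n : ℝ) / 8)| ^ (2 * (n : ℝ) / ((n : ℝ) - 2))
      ∂riemannianVolume n M) ^ (((n : ℝ) - 2) / (n : ℝ)) with hTdef
  have hT0 : 0 < m * Λ / 2 * T := mul_pos (by positivity) (Real.rpow_pos_of_pos hT _)
  have key : ∀ δ : ℝ, 0 < δ → m * Λ / 2 * T ≤ C * (δ ^ 2 * c) := by
    intro δ hδ
    obtain ⟨φ, hφ, hφc, hφ0, hφ1, hφK, hφδ⟩ := exists_cutoff (n := n)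
      (show IsCompact (insert x₁ (tsupport φ₀)) from IsCompact.insert hφ₀c x₁) hδ
    have h1 := energy_estimate_limit hn hΛ hm hma hmR hQ hR hf hf0 hV hV0 hVi hVs hφ hφc
      ⟨x₁, by rw [hφK x₁ (mem_insert _ _)]; exact one_ne_zero⟩
      (fun ε hε ψ hψ hψ0 hψc => weak_bochner hM (by omega) hε hR hψ hψ0 hψc) hτ
    have h2 : T ≤ (∫ x, |φ x * f x ^ ((n : ℝ) / 8)| ^ (2 * (n : ℝ) / ((n : ℝ) - 2))
        ∂riemannianVolume n M) ^ (((n : ℝ) - 2) / (n : ℝ)) := by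
      refine Real.rpow_le_rpow hT.le ?_ (by positivity)
      refine integral_mono (integrable_of_cont (hcont φ₀ hφ₀.continuous) (hcs φ₀ hφ₀c))
        (integrable_of_cont (hcont φ hφ.continuous) (hcs φ hφc)) fun x => ?_
      refine Real.rpow_le_rpow (abs_nonneg _) ?_ (by positivity)
      rw [abs_mul, abs_mul]
      refine mul_le_mul_of_nonneg_right ?_ (abs_nonneg _)
      rw [abs_of_nonneg (hφ₀0 x), abs_of_nonneg (hφ0 x)]
      by_cases hx : x ∈ tsupport φ₀
      · rw [hφK x (mem_insert_of_mem _ hx)]; exact hφ₀1 x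
      · rw [image_eq_zero_of_notMem_tsupport hx]; exact hφ0 x
    have h3 : ∫ x, gradInner n φ φ x * f x ^ ((n : ℝ) / 4) ∂riemannianVolume n M ≤ δ ^ 2 * c := by
      have i1 : Integrable (fun x => gradInner n φ φ x * f x ^ ((n : ℝ) / 4))
          (riemannianVolume n M) :=
        integrable_of_cont ((continuous_gradInner hφ hφ).mul
          (hf.continuous.rpow_const fun x => Or.inr (by positivity)))
          (HasCompactSupport.intro hφc fun x hx => by simp [gradInner_eq_zero hx])
      refine (integral_mono i1 (hEi.const_mul (δ ^ 2)) fun x => ?_).trans ?_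
      · show gradInner n φ φ x * f x ^ ((n : ℝ) / 4) ≤ δ ^ 2 * normE (n := n) x ^ ((n : ℝ) / 2)
        rw [hf4]
        exact mul_le_mul_of_nonneg_right (hφδ x) (hE0 x)
      · rw [integral_const_mul]
        exact mul_le_mul_of_nonneg_left hEle (sq_nonneg _)
    have h4 := mul_le_mul_of_nonneg_left h2 (show 0 ≤ m * Λ / 2 by positivity)
    have h5 := mul_le_mul_of_nonneg_left h3 hC0
    rw [hC] at h5 ⊢
    linarith
  -- the gradient of the cutoff function is arbitrarily small
  have hq : 0 < m * Λ / 2 * T / (2 * (C * c + 1)) := by positivity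
  have h1 := key _ (Real.sqrt_pos.2 hq)
  rw [Real.sq_sqrt hq.le] at h1
  have h2 : C * (m * Λ / 2 * T / (2 * (C * c + 1)) * c)
      ≤ m * Λ / 2 * T / (2 * (C * c + 1)) * (C * c + 1) := by linarith
  have h3 : m * Λ / 2 * T / (2 * (C * c + 1)) * (C * c + 1) = m * Λ / 2 * T / 2 := by
    have : C * c + 1 ≠ 0 := by positivity
    field_simp
  linarith

end Main

end HarmonicCurvature


theorem theorem3 (n : ℕ) (hn : 4 ≤ n) (Λ : ℝ) (hΛ : 0 < Λ) :
    ∃ c₀ : ℝ, 0 < c₀ ∧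
      ∀ (M : Type*) [EMetricSpace M] [ChartedSpace (HarmonicCurvature.Coord n) M]
        [IsManifold (𝓡 n) ∞ M] [SecondCountableTopology M] [ConnectedSpace M] [NoncompactSpace M]
        [MeasurableSpace M] [BorelSpace M]
        [RiemannianBundle (fun x : M => TangentSpace (𝓡 n) x)]
        [IsContMDiffRiemannianBundle (𝓡 n) ∞ (HarmonicCurvature.Coord n)
          (fun x : M => TangentSpace (𝓡 n) x)]
        [IsRiemannianManifold (𝓡 n) M] [CompleteSpace M],
        HarmonicCurvature.HasHarmonicCurvature n M →
        (Λ : EReal) ≤ HarmonicCurvature.sobolevConstant n M →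
        ((∀ x : M, 0 ≤ HarmonicCurvature.scalarCurvature (n := n) x) ∨
          ((∀ x : M, HarmonicCurvature.scalarCurvature (n := n) x < 0) ∧ 6 ≤ n)) →
        ∫⁻ x : M, ENNReal.ofReal
            (HarmonicCurvature.normW (n := n) x ^ ((n : ℝ) / 2)
              + HarmonicCurvature.normE (n := n) x ^ ((n : ℝ) / 2))
            ∂HarmonicCurvature.riemannianVolume n M ≤ ENNReal.ofReal c₀ →
        HarmonicCurvature.IsEinstein n M := by
  have hn4 : (4 : ℝ) ≤ n := by exact_mod_cast hn
  have hn0 : (0 : ℝ) < n := by linarith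
  have hn2 : (0 : ℝ) < (n : ℝ) - 2 := by linarith
  have hnum : 0 < (n : ℝ) ^ 2 - 2 * n + 4 := by nlinarith
  obtain ⟨a, ha⟩ : ∃ a, a = 8 * ((n : ℝ) ^ 2 - 2 * n + 4) / (n : ℝ) ^ 3 := ⟨_, rfl⟩
  have ha0 : 0 < a := by rw [ha]; positivity
  have hk0 : 0 < 4 / ((n : ℝ) - 2) := by positivity
  obtain ⟨m, hm⟩ : ∃ m, m = min (a / 2) (4 / ((n : ℝ) - 2)) := ⟨_, rfl⟩
  have hm0 : 0 < m := by rw [hm]; exact lt_min (by positivity) hk0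
  have hmk : m ≤ 4 / ((n : ℝ) - 2) := hm ▸ min_le_right _ _
  refine ⟨(m * Λ / 6) ^ ((n : ℝ) / 2), by positivity, ?_⟩
  intro M _ _ _ _ _ _ _ _ _ _ _ _ hM hQ hcase hsmall
  refine HarmonicCurvature.isEinstein_of_normE hM fun x₁ => ?_
  have hR : ∀ x : M, HarmonicCurvature.scalarCurvature (n := n) x
      = HarmonicCurvature.scalarCurvature (n := n) x₁ :=
    fun x => HarmonicCurvature.scalarCurvature_const hM x x₁
  rcases hcase with h | ⟨h, hn6⟩
  · refine HarmonicCurvature.normE_eq_zero hn hΛ hm0 ?_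
      (mul_nonneg (by linarith) (h x₁)) hM hQ hR hsmall x₁
    rw [← ha]
    exact lt_of_le_of_lt (hm ▸ min_le_left _ _) (by linarith)
  · -- here `m = 4 / (n - 2)` is forced, and it is admissible exactly when `n (n - 4)² > 16`
    refine HarmonicCurvature.normE_eq_zero hn hΛ hk0 ?_ (by simp) hM hQ hR
      (hsmall.trans (ENNReal.ofReal_le_ofReal (Real.rpow_le_rpow (by positivity)
        (by gcongr) (by positivity)))) x₁
    have hn6' : (6 : ℝ) ≤ n := by exact_mod_cast hn6
    rw [div_lt_div_iff₀ hn2 (by positivity)]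
    nlinarith [mul_nonneg (sub_nonneg.2 hn6') (sub_nonneg.2 hn6'),
      mul_nonneg (mul_nonneg (sub_nonneg.2 hn6') (sub_nonneg.2 hn6')) (sub_nonneg.2 hn6')]
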